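/- **Setting.** A vector-valued function in $H^1(\Omega)$ has values in $\mathbb R^3$; $|\cdot|$ is the Euclidean norm of vectors and matrices, $A_{\rm sym}=\frac12(A+A^T)$. Let $M\ge 1$ and let $\mathcal M=\{m_1,\dots,m_M\}\subset\mathbb R^3$ be unit vectors with $m_j\neq\pm m_k$ for $j\ne k$ (slip normals). In each plane $m_j^\perp$ let $b_{1,j},b_{2,j}$ be two linearly independent unit vectors (Burgers vectors), so that each $s\in m_j^\perp$ has unique components $c_1,c_2$ with $s=c_1b_{1,j}+c_2b_{2,j}$. Let $\sigma,\tau\ge0$. Let $A\subset\mathbb R^3$ be open and $\beta:A\to\mathbb R^{3\times3}$. For each $j$ let $s_j(x)=s$ if $\beta(x)=s\otimes m_j$ for some $s\in m_j^\perp$, and $s_j(x)=0$ otherwise, and let $c_{1,j},c_{2,j}$ be the components of $s_j$ with respect to $b_{1,j},b_{2,j}$. In Cartesian coordinates $(t,y,z)$ with first axis $m_j$, write $A_t$ for the slice of $A$ at height $t$, and $|D_{y,z}f|(A_t)=\sup\int_{A_t} f\cdot{\rm div}\,\phi\,dy\,dz$, the supremum being over $C^1$ fields $\phi$ with compact support in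 $A_t$ and $|\phi|\le1$ (divergence taken row by row if $f$ is vector-valued; the value is $+\infty$ if $f$ is not locally integrable in $A_t$). Put $$\|{\rm curl}_{m_j}\beta\|=\int|D_{y,z}s_j|(A_t)\,dt,\qquad \|{\rm curl}_{m_j}\beta\|_{\rm lam}=\sum_{i=1}^2\int|D_{y,z}c_{i,j}|(A_t)\,dt.$$ The side conditions are * (SSC) for a.e. $x\in A$ there are $j$, $i\in\{1,2\}$ and $c\in\mathbb R$ with $\beta(x)=c\,b_{i,j}\otimes m_j$; * (RSC) for a.e. $x\in A$ there are $j$ and $s\in m_j^\perp$ with $\beta(x)=s\otimes m_j$. The energies on $A$, with values in $[0,\infty]$ and the convention $0\cdot\infty=0$, are $$E(u,\beta)=\int_A|(\nabla u-\beta)_{\rm sym}|^2dx+\sigma\sum_{j}\|{\rm curl}_{m_j}\beta\|+\tau\int_A|\beta|\,dx$$ if (SSC) holds and $E(u,\beta)=+\infty$ otherwise, and $$E_{\rm rel}(u,\beta)=\int_A|(\nabla u-\beta)_{\rm sym}|^2dx+\sigma\sum_{j}\|{\rm curl}_{m_j}\beta\|_{\rm lam}+\tau\sum_{j}\sum_{i=1}^2\int_A|c_{i,j}|\,dx$$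 if (RSC) holds and $E_{\rm rel}(u,\beta)=+\infty$ otherwise. **Proposition.** Let $\Omega\subset\mathbb R^3$ be a Lipschitz domain, let $\Omega_1,\dots,\Omega_N\subset\Omega$ be pairwise disjoint open sets (slip patches), and assign to each $\Omega_i$ a normal $m_{\nu(i)}\in\mathcal M$. Let $u\in H^1(\Omega)$ and let $\beta:\Omega\to\mathbb R^{3\times3}$ be $C^\infty$ such that $\beta=s\otimes m_{\nu(i)}$ with $s\in m_{\nu(i)}^\perp$ on $\Omega_i$ for each $i$, $\beta=0$ on $\Omega\setminus\bigcup_i\Omega_i$, and for each $i$ the support $K_i=\overline{\{x\in\Omega_i: s(x)\ne0\}}$ is a compact subset of $\Omega_i\cup(\partial\Omega\cap\partial\Omega_i)$ with Lipschitz boundary. Then there is a sequence $(u_n,\beta_n)$ with $u_n\in H^1(\Omega)$, $u_n=u$ on $\partial\Omega$ (that is, $u_n-u\in H^1_0(\Omega)$), $\beta_n\in L^\infty(\Omega)$ satisfying (SSC), and $$E(u_n,\beta_n)\to E_{\rm rel}(u,\beta)$$ where the energies are taken on $A=\Omega$. Moreover, for each $i$, the relaxed energy taken on $A=\Omega_i$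 is convex as a function of $s$: the map $s\mapsto E_{\rm rel}(u,s\otimes m_{\nu(i)})\in[0,\infty]$ is convex on the space of measurable fields $s:\Omega_i\to m_{\nu(i)}^\perp$. -/

import Mathlib

open MeasureTheory Filter Topology
open scoped ENNReal NNReal ContDiff

noncomputable section

namespace SlipRelax

/-- Physical space. -/
abbrev E3 : Type := EuclideanSpace ℝ (Fin 3)

/-- Coordinates `(y, z)` in a slip plane. -/
abbrev E2 : Type := EuclideanSpace ℝ (Fin 2)

abbrev Mat3 : Type := Matrix (Fin 3) (Fin 3) ℝ

/-- The rank-one matrix `s ⊗ m`. -/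
def tensor (s m : E3) : Mat3 := Matrix.of fun i k => s i * m k

/-- Squared Euclidean (Frobenius) norm of a matrix. -/
def frobSq (A : Mat3) : ℝ := ∑ i, ∑ k, A i k ^ 2

/-- Euclidean (Frobenius) norm of a matrix. -/
def frob (A : Mat3) : ℝ := Real.sqrt (frobSq A)

def symPart (A : Mat3) : Mat3 := (1 / 2 : ℝ) • (A + A.transpose)

/-! ### Lipschitz boundaries -/

/-- Near each boundary point, in suitable Cartesian coordinates, the set is the region below the
graph of a Lipschitz function.  (The points of the graph are boundary points, so they belong to
the set if it is closed and not if it is open.) -/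
def HasLipschitzBoundary (A : Set E3) : Prop :=
  ∀ p ∈ frontier A, ∃ (F : OrthonormalBasis (Fin 3) ℝ E3) (r : ℝ) (L : ℝ≥0) (g : E2 → ℝ),
    0 < r ∧ LipschitzWith L g ∧
      ∀ x ∈ Metric.ball p r,
        (inner ℝ (F 0) x < g !₂[inner ℝ (F 1) x, inner ℝ (F 2) x] → x ∈ A) ∧
        (g !₂[inner ℝ (F 1) x, inner ℝ (F 2) x] < inner ℝ (F 0) x → x ∉ A)

/-- Lipschitz domains; boundedness is not asked for. -/
def IsLipschitzDomain (Ω : Set E3) : Prop :=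
  IsOpen Ω ∧ IsConnected Ω ∧ HasLipschitzBoundary Ω

/-! ### Sobolev functions -/

/-- An `ℝ³`-valued function in `H¹(Ω)`, together with (a representative of) its weak gradient,
`grad x i k = ∂ₖ uᵢ (x)`.  Both are used only up to null sets of `Ω`, and the weak gradient is
determined almost everywhere in `Ω` by the function. -/
structure H1 (Ω : Set E3) where
  toFun : E3 → E3
  grad : E3 → Mat3
  memLp_toFun : MemLp toFun 2 (volume.restrict Ω)
  memLp_grad : ∀ i k, MemLp (fun x => grad x i k) 2 (volume.restrict Ω)
  weak_grad : ∀ (i k : Fin 3) (φ : E3 → ℝ), ContDiff ℝ ∞ φ → HasCompactSupport φ →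
    tsupport φ ⊆ Ω →
      ∫ x in Ω, toFun x i * fderiv ℝ φ x (EuclideanSpace.single k 1)
        = -∫ x in Ω, grad x i k * φ x

/-- `u = v` on `∂Ω` in the Sobolev sense: `u - v` lies in `H¹₀(Ω)`, the closure of the smooth
functions with compact support in `Ω` with respect to the `H¹` norm. -/
def SameBoundaryValues {Ω : Set E3} (u v : H1 Ω) : Prop :=
  ∃ φ : ℕ → E3 → E3,
    (∀ n, ContDiff ℝ ∞ (φ n) ∧ HasCompactSupport (φ n) ∧ tsupport (φ n) ⊆ Ω) ∧
    Tendsto (fun n => ∫⁻ x in Ω, ENNReal.ofReal (‖u.toFun x - v.toFun x - φ n x‖ ^ 2))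
      atTop (𝓝 0) ∧
    Tendsto (fun n => ∫⁻ x in Ω, ENNReal.ofReal (frobSq (u.grad x - v.grad x -
        Matrix.of fun i k => fderiv ℝ (φ n) x (EuclideanSpace.single k 1) i)))
      atTop (𝓝 0)

/-! ### Slip planes -/

/-- A slip plane with its two Burgers vectors.  The vectors `frame 0, frame 1, frame 2` are the
axes of Cartesian coordinates `(x¹, y, z)`, the first one being the slip normal. -/
structure SlipPlane where
  frame : OrthonormalBasis (Fin 3) ℝ E3
  burgers : Fin 2 → E3
  norm_burgers : ∀ i, ‖burgers i‖ = 1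
  inner_burgers : ∀ i, inner ℝ (frame 0) (burgers i) = 0
  linearIndependent_burgers : LinearIndependent ℝ burgers

namespace SlipPlane

variable (S : SlipPlane)

/-- The slip normal `m`. -/
def normal : E3 := S.frame 0

/-- The `y`- and `z`-components of a vector. -/
def inPlane (v : E3) (i : Fin 2) : ℝ := inner ℝ (S.frame i.succ) v

/-- The point with Cartesian coordinates `(t, y, z)`. -/
def point (t : ℝ) (y : E2) : E3 := t • S.frame 0 + y 0 • S.frame 1 + y 1 • S.frame 2

/-- The slice `A ∩ {x¹ = t}`, in the coordinates `(y, z)`. -/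
def slice (A : Set E3) (t : ℝ) : Set E2 := {y | S.point t y ∈ A}

/-- Determinant of the in-plane components of two vectors. -/
def det (v w : E3) : ℝ := S.inPlane v 0 * S.inPlane w 1 - S.inPlane v 1 * S.inPlane w 0

/-- The components `c₁, c₂` of a vector `s ∈ m^⊥` in the basis of the Burgers vectors (by Cramer's
rule; see `eq_sum_coeff`). -/
def coeff (s : E3) : Fin 2 → ℝ :=
  ![S.det s (S.burgers 1) / S.det (S.burgers 0) (S.burgers 1),
    S.det (S.burgers 0) s / S.det (S.burgers 0) (S.burgers 1)]

theorem eq_of_inPlane {v : E3} (hv : inner ℝ S.normal v = 0) :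
    v = S.inPlane v 0 • S.frame 1 + S.inPlane v 1 • S.frame 2 := by
  conv_lhs => rw [← S.frame.sum_repr' v]
  rw [Fin.sum_univ_three]
  have h0 : inner ℝ (S.frame 0) v = 0 := hv
  rw [h0, zero_smul, zero_add]
  rfl

theorem det_burgers_ne_zero : S.det (S.burgers 0) (S.burgers 1) ≠ 0 := by
  intro h
  have e0 := S.eq_of_inPlane (S.inner_burgers 0)
  have e1 := S.eq_of_inPlane (S.inner_burgers 1)
  unfold det at h
  have hli := LinearIndependent.pair_iff.1
    (show LinearIndependent ℝ ![S.burgers 0, S.burgers 1] by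
      convert S.linearIndependent_burgers using 1
      ext i; fin_cases i <;> rfl)
  set a := S.inPlane (S.burgers 0) 0
  set b := S.inPlane (S.burgers 0) 1
  set c := S.inPlane (S.burgers 1) 0
  set d := S.inPlane (S.burgers 1) 1
  have k1 := hli d (-b) (by
    rw [e0, e1]
    have : d * a - b * c = 0 := by linarith
    calc _ = (d * a - b * c) • S.frame 1 + (d * b - b * d) • S.frame 2 := by module
      _ = 0 := by rw [this, mul_comm d b, sub_self]; simp)
  have k2 := hli c (-a) (by
    rw [e0, e1]
    have : c * b - a * d = 0 := by linarith
    calc _ = (c * a - a * c) • S.frame 1 + (c * b - a * d) • S.frame 2 := by module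
      _ = 0 := by rw [this, mul_comm c a, sub_self]; simp)
  have ha : a = 0 := by linarith [k2.2]
  have hb : b = 0 := by linarith [k1.2]
  have : S.burgers 0 = 0 := by rw [e0, ha, hb]; simp
  have hn := S.norm_burgers 0
  rw [this, norm_zero] at hn
  exact zero_ne_one hn

theorem eq_sum_coeff {s : E3} (hs : inner ℝ S.normal s = 0) :
    s = S.coeff s 0 • S.burgers 0 + S.coeff s 1 • S.burgers 1 := by
  have hd := S.det_burgers_ne_zero
  have e0 := S.eq_of_inPlane (S.inner_burgers 0)
  have e1 := S.eq_of_inPlane (S.inner_burgers 1)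
  have es := S.eq_of_inPlane hs
  simp only [coeff, Matrix.cons_val_zero, Matrix.cons_val_one]
  have key : S.det (S.burgers 0) (S.burgers 1) • s
      = S.det s (S.burgers 1) • S.burgers 0 + S.det (S.burgers 0) s • S.burgers 1 := by
    unfold det
    set a := S.inPlane (S.burgers 0) 0
    set b := S.inPlane (S.burgers 0) 1
    set c := S.inPlane (S.burgers 1) 0
    set d := S.inPlane (S.burgers 1) 1
    set p := S.inPlane s 0
    set q := S.inPlane s 1
    rw [e0, e1, es]
    module
  rw [div_eq_inv_mul, div_eq_inv_mul, mul_smul, mul_smul, ← smul_add, ← key, smul_smul,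
    inv_mul_cancel₀ hd, one_smul]

/-- The set where `β` can be written as `s ⊗ m` with `s ∈ m^⊥`. -/
def activeSet (β : E3 → Mat3) : Set E3 :=
  {x | ∃ s : E3, inner ℝ S.normal s = 0 ∧ β x = tensor s S.normal}

open Classical in
/-- The slip vector on this slip plane: `s(x)` if `β(x) = s(x) ⊗ m` with `s(x) ∈ m^⊥`
(then `s = β m`, since `|m| = 1`), and `0` elsewhere. -/
def slip (β : E3 → Mat3) (x : E3) : E3 :=
  if x ∈ S.activeSet β then WithLp.toLp 2 ((β x).mulVec S.normal) else 0

theorem slip_eq {β : E3 → Mat3} {x s : E3} (hs : inner ℝ S.normal s = 0)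
    (h : β x = tensor s S.normal) : S.slip β x = s := by
  have hm : ∑ k, S.normal k * S.normal k = 1 := by
    have h1 : ‖S.normal‖ = 1 := S.frame.orthonormal.1 0
    have h2 := EuclideanSpace.real_norm_sq_eq S.normal
    rw [h1] at h2
    simp only [← pow_two]
    linarith
  rw [slip, if_pos ⟨s, hs, h⟩, h]
  ext i
  simp only [tensor, Matrix.mulVec, dotProduct, Matrix.of_apply, mul_assoc]
  rw [← Finset.mul_sum, hm, mul_one]

end SlipPlane

/-! ### Planar total variation -/

/-- Admissible test fields on a planar open set `U`: `C¹`, compactly supported in `U`, with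
Euclidean norm at most one; `φ y i` is the `i`-th row. -/
def planarTest (ι : Type) [Fintype ι] (U : Set E2) : Set (E2 → ι → E2) :=
  {φ | ContDiff ℝ 1 φ ∧ HasCompactSupport φ ∧ tsupport φ ⊆ U ∧ ∀ y, ∑ i, ‖φ y i‖ ^ 2 ≤ 1}

/-- Row-wise divergence. -/
def rowDiv {ι : Type} (φ : E2 → ι → E2) (y : E2) (i : ι) : ℝ :=
  ∑ k : Fin 2, fderiv ℝ (fun z => φ z i k) y (EuclideanSpace.single k 1)

open Classical in
/-- Total variation on the planar open set `U` of a vector field `f` (infinite if `f` is not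
locally integrable in `U`). -/
def planarVariation {ι : Type} [Fintype ι] (U : Set E2) (f : E2 → ι → ℝ) : ℝ≥0∞ :=
  if ∀ i, LocallyIntegrableOn (fun y => f y i) U volume then
    ⨆ φ ∈ planarTest ι U, ENNReal.ofReal (∫ y in U, ∑ i, f y i * rowDiv φ y i)
  else ⊤

namespace SlipPlane

variable (S : SlipPlane)

/-- The planar curl `‖curl_m β‖` on `A`: the planar total variation of the slip vector in each
slice `A ∩ {x¹ = t}`, integrated over `t`. -/
def curlNorm (A : Set E3) (β : E3 → Mat3) : ℝ≥0∞ :=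
  ∫⁻ t : ℝ, planarVariation (S.slice A t) fun y => S.inPlane (S.slip β (S.point t y))

/-- The laminated curl `‖curl_m β‖_lam` on `A`: the same with the total variations of the two
Burgers components in place of the total variation of the slip vector. -/
def lamCurlNorm (A : Set E3) (β : E3 → Mat3) : ℝ≥0∞ :=
  ∑ i : Fin 2, ∫⁻ t : ℝ, planarVariation (S.slice A t)
    fun y (_ : Fin 1) => S.coeff (S.slip β (S.point t y)) i

/-- The laminated hardening on `A`, the sum of the `L¹` norms of the two Burgers components. -/
def lamHardening (A : Set E3) (β : E3 → Mat3) : ℝ≥0∞ :=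
  ∑ i : Fin 2, ∫⁻ x in A, ENNReal.ofReal |S.coeff (S.slip β x) i|

end SlipPlane

/-! ### Side conditions and energies -/

variable {M : ℕ}

/-- (SSC): almost everywhere `β` is slip along a single Burgers vector of a single slip plane. -/
def SSC (S : Fin M → SlipPlane) (A : Set E3) (β : E3 → Mat3) : Prop :=
  ∀ᵐ x ∂(volume.restrict A), ∃ (j : Fin M) (i : Fin 2) (c : ℝ),
    β x = tensor (c • (S j).burgers i) (S j).normal

/-- (RSC): almost everywhere `β = s ⊗ m` for a single slip normal `m` and some `s ∈ m^⊥`. -/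
def RSC (S : Fin M → SlipPlane) (A : Set E3) (β : E3 → Mat3) : Prop :=
  ∀ᵐ x ∂(volume.restrict A), ∃ (j : Fin M) (s : E3),
    inner ℝ (S j).normal s = 0 ∧ β x = tensor s (S j).normal

/-- Elastic energy `∫_A |(∇u - β)_sym|²`. -/
def elasticEnergy {Ω : Set E3} (A : Set E3) (u : H1 Ω) (β : E3 → Mat3) : ℝ≥0∞ :=
  ∫⁻ x in A, ENNReal.ofReal (frobSq (symPart (u.grad x - β x)))

open Classical in
/-- The single-slip energy `E(u, β)` on `A`. -/
def energy (S : Fin M → SlipPlane) (σ τ : ℝ≥0) {Ω : Set E3} (A : Set E3) (u : H1 Ω)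
    (β : E3 → Mat3) : ℝ≥0∞ :=
  if SSC S A β then
    elasticEnergy A u β + (σ : ℝ≥0∞) * ∑ j, (S j).curlNorm A β
      + (τ : ℝ≥0∞) * ∫⁻ x in A, ENNReal.ofReal (frob (β x))
  else ⊤

open Classical in
/-- The relaxed energy `E_rel(u, β)` on `A`. -/
def relEnergy (S : Fin M → SlipPlane) (σ τ : ℝ≥0) {Ω : Set E3} (A : Set E3) (u : H1 Ω)
    (β : E3 → Mat3) : ℝ≥0∞ :=
  if RSC S A β then
    elasticEnergy A u β + (σ : ℝ≥0∞) * ∑ j, (S j).lamCurlNorm A β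
      + (τ : ℝ≥0∞) * ∑ j, (S j).lamHardening A β
  else ⊤

/-- Measurable slip fields `s : A → m^⊥`. -/
def slipFields (A : Set E3) (m : E3) : Set (E3 → E3) :=
  {s | AEStronglyMeasurable s (volume.restrict A) ∧ ∀ x ∈ A, inner ℝ m (s x) = 0}

end SlipRelax

end

noncomputable section

namespace SlipRelax

/-! The recovery sequence is a simple laminate. On the slip plane with normal `m`, a slip `c₁ b₁ +
c₂ b₂` is replaced by layers orthogonal to `m`, of thickness `π / (n + 1)`, that carry `2 c₁ b₁` and
`2 c₂ b₂` alternately. With the square wave `q` this is the pair of components `(1 ± q((n + 1) m·x))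
cᵢ`, so (SSC) holds. The planar curl differentiates only within the slices `m·x = t`, and `q` is
constant on each of them: jumps between layers cost nothing, and a slice carries `2 cₖ bₖ` with a
constant unit vector `bₖ`, whose variation is that of the scalar `2 cₖ` (`planarVariation_smul`).
Hence the curl and hardening terms of the laminate are those of the relaxed energy with weights `1 ±
q` (`curlNorm_laminate`, `lintegral_frob_laminate`). The weights converge weakly to `1` because a
shift by half a period reverses the sign of `q` (`tendsto_lintegral_squareWave`). The strain error
is a sum of terms `q((n + 1) m·x) d ⊗ m` with `d = c₁ b₁ - c₂ b₂`. Up to `O(1/n)` such a term is the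
gradient of a triangle wave times `d / (n + 1)`; after cutting off `d` and smoothing the wave, the
corrector is a test field (`exists_laminate_corrector`). Adding the correctors to `u` keeps the
boundary values and makes `∇uₙ - βₙ` converge to `∇u - β` in `L²`.

The strain may blow up at `∂Ω`, so the components are first truncated by smooth contractions of the
line. These do not increase the variation, and lower semicontinuity gives convergence
(`tendsto_variation_comp`). Square integrability of the components follows from finite elastic
energy, since `|sym(s ⊗ m)|² = |s|² / 2` for `s ⊥ m`. If the relaxed energy is infinite, the
constant strains `n b ⊗ m` have energies tending to infinity. All approximation steps are statements
about the closure of the set of admissible energies in `[0, ∞]`, which makes diagonal sequences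
unnecessary.

Convexity holds term by term: a squared norm of an affine function, a supremum of linear
functionals, and absolute values of linear functionals. Integrating the inequality for the variation
over the slices requires the slice variation to be measurable in `t`
(`aemeasurable_variation_slice`), which comes from reducing the supremum to countably many test
fields. -/

/-! ### Products with compactly supported functions and integration by parts. -/

theorem contDiff_of_contDiffAt_tsupport {E F : Type*} [NormedAddCommGroup E] [NormedSpace ℝ E]
    [NormedAddCommGroup F] [NormedSpace ℝ F] {n : WithTop ℕ∞} {f : E → F}
    (h : ∀ x ∈ tsupport f, ContDiffAt ℝ n f x) : ContDiff ℝ n f := by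
  refine contDiff_iff_contDiffAt.2 fun x => ?_
  by_cases hx : x ∈ tsupport f
  · exact h x hx
  · exact contDiffAt_const.congr_of_eventuallyEq (notMem_tsupport_iff_eventuallyEq.1 hx)

theorem contDiff_smul_of_tsupport_subset {E F : Type*} [NormedAddCommGroup E] [NormedSpace ℝ E]
    [NormedAddCommGroup F] [NormedSpace ℝ F] {n : WithTop ℕ∞} {U : Set E} (hU : IsOpen U)
    {f : E → ℝ} {g : E → F} (hf : ContDiffOn ℝ n f U) (hg : ContDiff ℝ n g)
    (hs : tsupport g ⊆ U) : ContDiff ℝ n (fun x => f x • g x) := by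
  refine contDiff_of_contDiffAt_tsupport fun x hx => ?_
  have hx' : x ∈ U := hs (tsupport_smul_subset_right f g hx)
  exact (hf.contDiffAt (hU.mem_nhds hx')).smul hg.contDiffAt

theorem continuous_mul_of_tsupport_subset {E : Type*} [TopologicalSpace E]
    {U : Set E} (hU : IsOpen U) {f g : E → ℝ} (hf : ContinuousOn f U) (hg : Continuous g)
    (hs : tsupport g ⊆ U) : Continuous (fun x => f x * g x) := by
  refine continuous_of_tsupport fun x hx => ?_
  have hx' : x ∈ U := hs (tsupport_mul_subset_right hx)
  exact (hf.continuousAt (hU.mem_nhds hx')).mul hg.continuousAt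

theorem integrable_mul_of_tsupport_subset {E : Type*} [TopologicalSpace E] [MeasurableSpace E]
    [OpensMeasurableSpace E] [T2Space E] {μ : Measure E} [IsFiniteMeasureOnCompacts μ]
    {U : Set E} (hU : IsOpen U) {f g : E → ℝ} (hf : ContinuousOn f U) (hg : Continuous g)
    (hs : tsupport g ⊆ U) (hc : HasCompactSupport g) : Integrable (fun x => f x * g x) μ :=
  (continuous_mul_of_tsupport_subset hU hf hg hs).integrable_of_hasCompactSupport
    (hc.mul_left)

/-- Nothing is known about `f` outside `U`, but every product in sight vanishes off `tsupport g`, so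
whole-space integration by parts applies without boundary term. -/
theorem integral_mul_fderiv_of_tsupport_subset {E : Type*} [NormedAddCommGroup E]
    [NormedSpace ℝ E] [FiniteDimensional ℝ E] [MeasurableSpace E] [BorelSpace E]
    {μ : Measure E} [μ.IsAddHaarMeasure] {U : Set E} (hU : IsOpen U) {f g : E → ℝ}
    (hf : ContDiffOn ℝ 1 f U) (hg : ContDiff ℝ 1 g) (hs : tsupport g ⊆ U)
    (hc : HasCompactSupport g) (v : E) :
    ∫ x, f x * fderiv ℝ g x v ∂μ = -∫ x, fderiv ℝ f x v * g x ∂μ := by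
  have hf' : ContinuousOn (fun x => fderiv ℝ f x v) U :=
    (hf.continuousOn_fderiv_of_isOpen hU le_rfl).clm_apply continuousOn_const
  have hg' : Continuous (fun x => fderiv ℝ g x v) :=
    (hg.continuous_fderiv one_ne_zero).clm_apply continuous_const
  refine integral_mul_fderiv_eq_neg_fderiv_mul_of_integrable ?_ ?_ ?_ ?_ ?_
  · exact integrable_mul_of_tsupport_subset hU hf' hg.continuous hs hc
  · exact integrable_mul_of_tsupport_subset hU hf.continuousOn hg'
      ((tsupport_fderiv_apply_subset ℝ v).trans hs) (hc.fderiv_apply ℝ v)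
  · exact integrable_mul_of_tsupport_subset hU hf.continuousOn hg.continuous hs hc
  · exact fun x hx => (hf.contDiffAt (hU.mem_nhds (hs hx))).differentiableAt one_ne_zero
  · exact fun x _ => hg.differentiable one_ne_zero x

/-! ### Scalar and vectorial total variation in the plane. -/

/-- Divergence of a planar vector field. -/
def divergence (ψ : E2 → E2) (y : E2) : ℝ :=
  ∑ k : Fin 2, fderiv ℝ (fun z => ψ z k) y (EuclideanSpace.single k 1)

/-- Planar test vector fields. -/
def vectorTest (U : Set E2) : Set (E2 → E2) :=
  {ψ | ContDiff ℝ 1 ψ ∧ HasCompactSupport ψ ∧ tsupport ψ ⊆ U ∧ ∀ y, ‖ψ y‖ ≤ 1}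

open Classical in
/-- Total variation of a scalar function on a planar open set. -/
def variation (U : Set E2) (g : E2 → ℝ) : ℝ≥0∞ :=
  if LocallyIntegrableOn g U volume then
    ⨆ ψ ∈ vectorTest U, ENNReal.ofReal (∫ y in U, g y * divergence ψ y)
  else ⊤

theorem differentiable_comp_apply {ψ : E2 → E2} (h : ContDiff ℝ 1 ψ) (k : Fin 2) :
    Differentiable ℝ (fun z => ψ z k) :=
  (contDiff_euclidean.1 h k).differentiable one_ne_zero

theorem continuous_divergence {ψ : E2 → E2} (h : ContDiff ℝ 1 ψ) :
    Continuous (divergence ψ) := by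
  unfold divergence
  refine continuous_finsetSum _ fun k _ => ?_
  exact ((contDiff_euclidean.1 h k).continuous_fderiv one_ne_zero).clm_apply continuous_const

theorem support_divergence_subset (ψ : E2 → E2) :
    Function.support (divergence ψ) ⊆ tsupport ψ := by
  intro y hy
  by_contra hn
  apply hy
  unfold divergence
  refine Finset.sum_eq_zero fun k _ => ?_
  have : (fun z => ψ z k) =ᶠ[𝓝 y] fun _ => 0 := by
    filter_upwards [notMem_tsupport_iff_eventuallyEq.1 hn] with z hz
    simp [hz]
  rw [this.fderiv_eq]
  simp

theorem sum_weight_rowDiv {ι : Type} [Fintype ι] {φ : E2 → ι → E2} (h : ContDiff ℝ 1 φ)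
    (w : ι → ℝ) (y : E2) :
    ∑ i, w i * rowDiv φ y i = divergence (fun z => ∑ i, w i • φ z i) y := by
  unfold divergence rowDiv
  simp_rw [Finset.mul_sum]
  rw [Finset.sum_comm]
  refine Finset.sum_congr rfl fun k _ => ?_
  have e : (fun z => (∑ i, w i • φ z i : E2) k) = fun z => ∑ i, w i * φ z i k := by
    ext z; simp
  rw [e, fderiv_fun_sum]
  · rw [sum_apply]
    refine Finset.sum_congr rfl fun i _ => ?_
    rw [fderiv_const_mul]
    · rfl
    · exact differentiable_comp_apply (contDiff_pi.1 h i) k y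
  · intro i _
    exact (differentiable_comp_apply (contDiff_pi.1 h i) k y).const_mul _

theorem rowDiv_smul {ι : Type} {ψ : E2 → E2} (h : ContDiff ℝ 1 ψ)
    (w : ι → ℝ) (y : E2) (i : ι) :
    rowDiv (fun z i => w i • ψ z) y i = w i * divergence ψ y := by
  unfold divergence rowDiv
  rw [Finset.mul_sum]
  refine Finset.sum_congr rfl fun k _ => ?_
  have e : (fun z => (w i • ψ z : E2) k) = fun z => w i * ψ z k := by
    ext z; simp
  rw [e, fderiv_const_mul (differentiable_comp_apply h k y)]
  rfl

theorem norm_sum_smul_le_one {ι : Type} [Fintype ι] {w : ι → ℝ} (hw : ∑ i, w i ^ 2 = 1)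
    {v : ι → E2} (hv : ∑ i, ‖v i‖ ^ 2 ≤ 1) : ‖∑ i, w i • v i‖ ≤ 1 := by
  have h1 : ‖∑ i, w i • v i‖ ≤ ∑ i, |w i| * ‖v i‖ :=
    (norm_sum_le _ _).trans (le_of_eq (by simp [norm_smul]))
  have h2 := Finset.sum_mul_sq_le_sq_mul_sq Finset.univ (fun i => |w i|) (fun i => ‖v i‖)
  simp only [sq_abs, hw, one_mul] at h2
  have h3 : 0 ≤ ∑ i, |w i| * ‖v i‖ := Finset.sum_nonneg fun i _ => by positivity
  nlinarith

/-- For a constant unit vector `w`, contracting a test field with `w` gives a scalar test field by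
Cauchy–Schwarz, and `w ⊗ ψ` lifts a scalar one back; the two suprema coincide. This is what makes a
slip along a single Burgers vector cost exactly the variation of its component. -/
theorem planarVariation_smul {ι : Type} [Fintype ι] {U : Set E2}
    (g : E2 → ℝ) {w : ι → ℝ} (hw : ∑ i, w i ^ 2 = 1) {a : ℝ} (ha : 0 < a) :
    planarVariation U (fun y i => a * g y * w i) = ENNReal.ofReal a * variation U g := by
  have hloc : (∀ i, LocallyIntegrableOn (fun y => a * g y * w i) U volume) ↔
      LocallyIntegrableOn g U volume := by
    constructor
    · intro h
      obtain ⟨i, hi⟩ : ∃ i, w i ≠ 0 := by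
        by_contra! hn
        simp [hn] at hw
      have := (h i).smul (a * w i)⁻¹
      convert this using 1
      ext y
      simp only [Pi.smul_apply, smul_eq_mul]
      field_simp
    · intro h i
      have := h.smul (a * w i)
      convert this using 1
      ext y
      simp only [Pi.smul_apply, smul_eq_mul]
      ring
  unfold planarVariation variation
  by_cases hg : LocallyIntegrableOn g U volume
  · rw [if_pos hg, if_pos (hloc.2 hg)]
    simp_rw [ENNReal.mul_iSup]
    apply le_antisymm
    · refine iSup₂_le fun φ hφ => ?_
      obtain ⟨h1, h2, h3, h4⟩ := hφ
      have hmem : (fun z => ∑ i, w i • φ z i) ∈ vectorTest U := by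
        have hsub : Function.support (fun z => ∑ i, w i • φ z i) ⊆ Function.support φ := by
          intro z hz
          rw [Function.mem_support] at hz ⊢
          intro h0
          exact hz (by simp [h0])
        refine ⟨ContDiff.sum fun i _ => (contDiff_pi.1 h1 i).const_smul _, ?_, ?_, ?_⟩
        · exact h2.mono hsub
        · exact (closure_mono hsub).trans h3
        · intro y
          exact norm_sum_smul_le_one hw (h4 y)
      refine le_iSup₂_of_le _ hmem (le_of_eq ?_)
      rw [← ENNReal.ofReal_mul ha.le, ← integral_const_mul]
      congr 2
      ext y
      rw [← sum_weight_rowDiv h1, Finset.mul_sum, Finset.mul_sum]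
      exact Finset.sum_congr rfl fun i _ => by ring
    · refine iSup₂_le fun ψ hψ => ?_
      obtain ⟨h1, h2, h3, h4⟩ := hψ
      have hmem : (fun z i => w i • ψ z) ∈ planarTest ι U := by
        have hsub : Function.support (fun z i => w i • ψ z) ⊆ Function.support ψ := by
          intro z hz
          rw [Function.mem_support] at hz ⊢
          intro h0
          exact hz (by ext i; simp [h0])
        refine ⟨contDiff_pi.2 fun i => h1.const_smul _, h2.mono hsub,
          (closure_mono hsub).trans h3, fun y => ?_⟩
        simp only [norm_smul, mul_pow, Real.norm_eq_abs, sq_abs]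
        rw [← Finset.sum_mul, hw, one_mul]
        exact pow_le_one₀ (norm_nonneg _) (h4 y)
      refine le_iSup₂_of_le _ hmem (le_of_eq ?_)
      rw [← ENNReal.ofReal_mul ha.le, ← integral_const_mul]
      congr 2
      ext y
      simp_rw [rowDiv_smul h1]
      calc a * (g y * divergence ψ y) = (∑ i, w i ^ 2) * (a * (g y * divergence ψ y)) := by
            rw [hw, one_mul]
        _ = _ := by
            rw [Finset.sum_mul]
            exact Finset.sum_congr rfl fun i _ => by ring
  · rw [if_neg hg, if_neg (fun h => hg (hloc.1 h)), ENNReal.mul_top (by simpa using ha)]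

theorem planarVariation_scalar (U : Set E2) (g : E2 → ℝ) :
    planarVariation U (fun y (_ : Fin 1) => g y) = variation U g := by
  have := planarVariation_smul (U := U) g (w := fun _ : Fin 1 => 1) (by simp) one_pos
  simpa using this

theorem variation_congr {U : Set E2} {f g : E2 → ℝ} (h : f =ᵐ[volume.restrict U] g) :
    variation U f = variation U g := by
  have hi : ∀ ψ : E2 → E2, ∫ y in U, f y * divergence ψ y = ∫ y in U, g y * divergence ψ y :=
    fun ψ => integral_congr_ae (by filter_upwards [h] with y hy; rw [hy])
  unfold variation
  by_cases hl : LocallyIntegrableOn g U volume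
  · rw [if_pos hl, if_pos ((locallyIntegrableOn_congr h).2 hl)]
    exact iSup_congr fun ψ => by rw [hi]
  · rw [if_neg hl, if_neg fun h' => hl ((locallyIntegrableOn_congr h).1 h')]

theorem planarVariation_congr {ι : Type} [Fintype ι] {U : Set E2} (hU : MeasurableSet U)
    {f g : E2 → ι → ℝ} (h : ∀ y ∈ U, f y = g y) : planarVariation U f = planarVariation U g := by
  have hi : ∀ φ : E2 → ι → E2, ∫ y in U, ∑ i, f y i * rowDiv φ y i
      = ∫ y in U, ∑ i, g y i * rowDiv φ y i :=
    fun φ => setIntegral_congr_fun hU fun y hy => by simp only [h y hy]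
  have hl : ∀ i, (LocallyIntegrableOn (fun y => f y i) U volume ↔
      LocallyIntegrableOn (fun y => g y i) U volume) := fun i =>
    locallyIntegrableOn_congr ((ae_restrict_iff' hU).2 (ae_of_all _ fun y hy => congrFun (h y hy) i))
  unfold planarVariation
  by_cases h' : ∀ i, LocallyIntegrableOn (fun y => g y i) U volume
  · rw [if_pos h', if_pos fun i => (hl i).2 (h' i)]
    exact iSup_congr fun φ => by rw [hi]
  · rw [if_neg h', if_neg fun h'' => h' fun i => (hl i).1 (h'' i)]

theorem planarVariation_zero {ι : Type} [Fintype ι] (U : Set E2) :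
    planarVariation U (fun _ (_ : ι) => (0 : ℝ)) = 0 := by
  unfold planarVariation
  rw [if_pos fun i => locallyIntegrableOn_zero]
  simp

theorem variation_zero (U : Set E2) : variation U (fun _ => 0) = 0 := by
  rw [← planarVariation_scalar, planarVariation_zero]

theorem integrable_mul_divergence {U : Set E2} {g : E2 → ℝ}
    (hg : LocallyIntegrableOn g U volume) {ψ : E2 → E2} (hψ : ψ ∈ vectorTest U) :
    Integrable (fun y => g y * divergence ψ y) (volume.restrict U) := by
  obtain ⟨h1, h2, h3, -⟩ := hψ
  have hK : IntegrableOn g (tsupport ψ) volume := hg.integrableOn_compact_subset h3 h2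
  have h := hK.mul_continuousOn (continuous_divergence h1).continuousOn h2
  refine Integrable.restrict ?_
  refine (integrableOn_iff_integrable_of_support_subset ?_).1 h
  intro y hy
  exact support_divergence_subset ψ (right_ne_zero_of_mul hy)

theorem ofReal_integral_le_variation {U : Set E2} (g : E2 → ℝ) {ψ : E2 → E2}
    (hψ : ψ ∈ vectorTest U) :
    ENNReal.ofReal (∫ y in U, g y * divergence ψ y) ≤ variation U g := by
  unfold variation
  split_ifs
  · exact le_iSup₂_of_le ψ hψ le_rfl
  · exact le_top

/-- A supremum of linear functionals is sublinear. Strict positivity of the weights makes the right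
side infinite as soon as one of the functions is not locally integrable. -/
theorem variation_add_le (U : Set E2) (f g : E2 → ℝ) {a b : ℝ} (ha : 0 < a) (hb : 0 < b) :
    variation U (fun y => a * f y + b * g y) ≤
      ENNReal.ofReal a * variation U f + ENNReal.ofReal b * variation U g := by
  by_cases hf : LocallyIntegrableOn f U volume
  swap
  · have : variation U f = ⊤ := if_neg hf
    rw [this, ENNReal.mul_top (by simpa using ha)]
    simp
  by_cases hg : LocallyIntegrableOn g U volume
  swap
  · have : variation U g = ⊤ := if_neg hg
    rw [this, ENNReal.mul_top (by simpa using hb)]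
    simp
  have hs : LocallyIntegrableOn (fun y => a * f y + b * g y) U volume :=
    (hf.smul a).add (hg.smul b)
  have hv : variation U (fun y => a * f y + b * g y) = ⨆ ψ ∈ vectorTest U,
      ENNReal.ofReal (∫ y in U, (a * f y + b * g y) * divergence ψ y) := if_pos hs
  rw [hv]
  refine iSup₂_le fun ψ hψ => ?_
  have e : ∫ y in U, (a * f y + b * g y) * divergence ψ y
      = a * (∫ y in U, f y * divergence ψ y) + b * (∫ y in U, g y * divergence ψ y) := by
    rw [← integral_const_mul, ← integral_const_mul, ← integral_add]
    · congr 1; ext y; ring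
    · exact (integrable_mul_divergence hf hψ).const_mul a
    · exact (integrable_mul_divergence hg hψ).const_mul b
  rw [e]
  refine ENNReal.ofReal_add_le.trans ?_
  rw [ENNReal.ofReal_mul ha.le, ENNReal.ofReal_mul hb.le]
  gcongr
  · exact ofReal_integral_le_variation f hψ
  · exact ofReal_integral_le_variation g hψ

theorem tsupport_apply_subset (χ : E2 → E2) (k : Fin 2) :
    tsupport (fun z => χ z k) ⊆ tsupport χ :=
  tsupport_comp_subset (g := fun v : E2 => v k) rfl χ

theorem setIntegral_mul_divergence {U : Set E2} (hU : IsOpen U) {f : E2 → ℝ}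
    (hf : ContinuousOn f U) {χ : E2 → E2} (hχ : χ ∈ vectorTest U) :
    ∫ y in U, f y * divergence χ y = ∑ k : Fin 2,
      ∫ y, f y * fderiv ℝ (fun z => χ z k) y (EuclideanSpace.single k 1) := by
  obtain ⟨h1, h2, h3, -⟩ := hχ
  rw [setIntegral_eq_integral_of_forall_compl_eq_zero, ← integral_finsetSum]
  · simp only [divergence, Finset.mul_sum]
  · intro k _
    have hk := contDiff_euclidean.1 h1 k
    refine integrable_mul_of_tsupport_subset hU hf
      ((hk.continuous_fderiv one_ne_zero).clm_apply continuous_const) ?_ ?_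
    · exact (tsupport_fderiv_apply_subset ℝ _).trans ((tsupport_apply_subset χ k).trans h3)
    · have hc : HasCompactSupport (fun z => χ z k) :=
        h2.of_isClosed_subset (isClosed_tsupport _) (tsupport_apply_subset χ k)
      exact hc.fderiv_apply ℝ _
  · intro y hy
    by_contra hn
    exact hy (h3 (support_divergence_subset χ (right_ne_zero_of_mul hn)))

/-- Smooth contractions of the range decrease the variation. -/
theorem variation_comp_le {U : Set E2} (hU : IsOpen U) {c : E2 → ℝ} (hc : ContDiffOn ℝ 2 c U)
    {T : ℝ → ℝ} (hT : ContDiff ℝ 2 T) (hT' : ∀ x, |deriv T x| ≤ 1) :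
    variation U (fun y => T (c y)) ≤ variation U c := by
  have hloc : LocallyIntegrableOn (fun y => T (c y)) U volume :=
    (hT.continuous.comp_continuousOn hc.continuousOn).locallyIntegrableOn hU.measurableSet
  have hv : variation U (fun y => T (c y)) = ⨆ ψ ∈ vectorTest U,
      ENNReal.ofReal (∫ y in U, T (c y) * divergence ψ y) := if_pos hloc
  rw [hv]
  refine iSup₂_le fun ψ hψ => ?_
  obtain ⟨h1, h2, h3, h4⟩ := hψ
  have hdT : ContDiffOn ℝ 1 (fun y => deriv T (c y)) U :=
    (ContDiff.deriv' (n := 1) hT).comp_contDiffOn (hc.of_le one_le_two)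
  -- By the chain rule and two integrations by parts, `∫ T(c) div ψ = -∫ T'(c) ∇c·ψ = ∫ c div(T'(c)
  -- ψ)`. The field `T'(c) ψ` is admissible for `c` because `|T'| ≤ 1`, and it is `C¹` because `T`
  -- and `c` are `C²`.
  have hmem : (fun y => deriv T (c y) • ψ y) ∈ vectorTest U := by
    have hsm : ContDiff ℝ 1 (fun y => deriv T (c y) • ψ y) :=
      contDiff_smul_of_tsupport_subset hU hdT h1 h3
    have hsub : tsupport (fun y => deriv T (c y) • ψ y) ⊆ tsupport ψ :=
      tsupport_smul_subset_right (fun y => deriv T (c y)) ψ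
    refine ⟨hsm, h2.of_isClosed_subset (isClosed_tsupport _) hsub, hsub.trans h3, fun y => ?_⟩
    rw [norm_smul]
    exact mul_le_one₀ (hT' _) (norm_nonneg _) (h4 y)
  refine le_trans (le_of_eq ?_) (ofReal_integral_le_variation c hmem)
  congr 1
  rw [setIntegral_mul_divergence (f := fun y => T (c y)) hU
    (hT.continuous.comp_continuousOn hc.continuousOn) ⟨h1, h2, h3, h4⟩, setIntegral_mul_divergence hU hc.continuousOn hmem]
  refine Finset.sum_congr rfl fun k _ => ?_
  set p : E2 → ℝ := fun z => ψ z k with hp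
  have e : (fun z => (deriv T (c z) • ψ z : E2) k) = fun z => deriv T (c z) * p z := by
    ext z; simp [hp]
  have hp1 : ContDiff ℝ 1 p := contDiff_euclidean.1 h1 k
  have hps : tsupport p ⊆ U := (tsupport_apply_subset ψ k).trans h3
  have hpc : HasCompactSupport p := h2.of_isClosed_subset (isClosed_tsupport _)
    (tsupport_apply_subset ψ k)
  have hq1 : ContDiff ℝ 1 (fun z => deriv T (c z) * p z) :=
    contDiff_smul_of_tsupport_subset hU hdT hp1 hps
  have hqs : tsupport (fun z => deriv T (c z) * p z) ⊆ U :=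
    (tsupport_smul_subset_right (fun z => deriv T (c z)) p).trans hps
  have hqc : HasCompactSupport (fun z => deriv T (c z) * p z) := hpc.mul_left
  have hTc : ContDiffOn ℝ 1 (fun y => T (c y)) U :=
    (hT.of_le one_le_two).comp_contDiffOn (hc.of_le one_le_two)
  rw [e, integral_mul_fderiv_of_tsupport_subset hU hTc hp1 hps hpc,
    integral_mul_fderiv_of_tsupport_subset hU (hc.of_le one_le_two) hq1 hqs hqc]
  congr 2
  ext y
  by_cases hy : y ∈ U
  · have hcd : DifferentiableAt ℝ c y :=
      (hc.contDiffAt (hU.mem_nhds hy)).differentiableAt two_ne_zero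
    have := ((hT.differentiable two_ne_zero (c y)).hasDerivAt.comp_hasFDerivAt y
      hcd.hasFDerivAt).fderiv
    have e2 : fderiv ℝ (fun y => T (c y)) y = deriv T (c y) • fderiv ℝ c y := this
    rw [e2]
    change deriv T (c y) * fderiv ℝ c y _ * p y = fderiv ℝ c y _ * (deriv T (c y) * p y)
    ring
  · have : p y = 0 := image_eq_zero_of_notMem_tsupport fun h => hy (hps h)
    simp [this]

/-- The upper bound is the contraction estimate. The lower bound is lower semicontinuity: against a
fixed test field the integrals converge by dominated convergence, with `|c div ψ|` as majorant. -/
theorem tendsto_variation_comp {U : Set E2} (hU : IsOpen U) {c : E2 → ℝ}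
    (hc : ContDiffOn ℝ 2 c U) {T : ℕ → ℝ → ℝ} (hT : ∀ n, ContDiff ℝ 2 (T n))
    (hT' : ∀ n x, |deriv (T n) x| ≤ 1) (hT0 : ∀ n x, |T n x| ≤ |x|)
    (hlim : ∀ x, Tendsto (fun n => T n x) atTop (𝓝 x)) :
    Tendsto (fun n => variation U (fun y => T n (c y))) atTop (𝓝 (variation U c)) := by
  refine tendsto_of_le_liminf_of_limsup_le ?_ ?_
  swap
  · refine limsup_le_of_le (by isBoundedDefault) (Eventually.of_forall fun n => ?_)
    exact variation_comp_le hU hc (hT n) (hT' n)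
  have hloc : LocallyIntegrableOn c U volume := hc.continuousOn.locallyIntegrableOn hU.measurableSet
  have hv : variation U c = ⨆ ψ ∈ vectorTest U,
      ENNReal.ofReal (∫ y in U, c y * divergence ψ y) := if_pos hloc
  conv_lhs => rw [hv]
  refine iSup₂_le fun ψ hψ => ?_
  have ht : Tendsto (fun n => ENNReal.ofReal (∫ y in U, T n (c y) * divergence ψ y)) atTop
      (𝓝 (ENNReal.ofReal (∫ y in U, c y * divergence ψ y))) := by
    refine (ENNReal.continuous_ofReal.tendsto _).comp ?_
    refine tendsto_integral_of_dominated_convergence (fun y => |c y * divergence ψ y|) ?_ ?_ ?_ ?_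
    · intro n
      refine (integrable_mul_divergence ?_ hψ).aestronglyMeasurable
      exact ((hT n).continuous.comp_continuousOn hc.continuousOn).locallyIntegrableOn
        hU.measurableSet
    · exact (integrable_mul_divergence hloc hψ).abs
    · intro n
      refine ae_of_all _ fun y => ?_
      rw [Real.norm_eq_abs, abs_mul, abs_mul]
      exact mul_le_mul_of_nonneg_right (hT0 n _) (abs_nonneg _)
    · exact ae_of_all _ fun y => (hlim _).mul_const _
  rw [← ht.liminf_eq]
  exact liminf_le_liminf (Eventually.of_forall fun n => ofReal_integral_le_variation _ hψ)

/-! ### Weak convergence of rapidly oscillating square waves. -/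

/-- The square wave of period `2π` with values `±1`. -/
def squareWave (t : ℝ) : ℝ := if 0 ≤ Real.sin t then 1 else -1

theorem measurable_squareWave : Measurable squareWave :=
  Measurable.ite (measurableSet_le measurable_const Real.continuous_sin.measurable)
    measurable_const measurable_const

theorem squareWave_eq (t : ℝ) : squareWave t = 1 ∨ squareWave t = -1 := by
  unfold squareWave; split_ifs <;> simp

theorem abs_squareWave (t : ℝ) : |squareWave t| = 1 := by
  rcases squareWave_eq t with h | h <;> rw [h] <;> simp

theorem squareWave_add_pi {t : ℝ} (h : Real.sin t ≠ 0) :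
    squareWave (t + Real.pi) = -squareWave t := by
  unfold squareWave
  rw [Real.sin_add_pi]
  rcases lt_or_gt_of_ne h with h | h
  · rw [if_pos (by linarith), if_neg (by linarith), neg_neg]
  · rw [if_neg (by linarith), if_pos h.le]

section Oscillation

variable {E : Type*} [NormedAddCommGroup E] [NormedSpace ℝ E] [FiniteDimensional ℝ E]
  [MeasurableSpace E] [BorelSpace E] (μ : Measure E) [μ.IsAddHaarMeasure]

/-- The exceptional set is the preimage of a countable set under a surjective linear functional,
hence null. -/
theorem ae_sin_ne_zero {l : E →L[ℝ] ℝ} (hl : l ≠ 0) {a : ℝ} (ha : a ≠ 0) :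
    ∀ᵐ x ∂μ, Real.sin (a * l x) ≠ 0 := by
  have hsurj : Function.Surjective (l : E →ₗ[ℝ] ℝ) := by
    refine LinearMap.surjective fun h => hl ?_
    ext x
    exact LinearMap.congr_fun h x
  have hcount : {t : ℝ | Real.sin (a * t) = 0}.Countable := by
    have : {t : ℝ | Real.sin (a * t) = 0} ⊆ Set.range fun k : ℤ => k * Real.pi / a := by
      intro t ht
      obtain ⟨k, hk⟩ := Real.sin_eq_zero_iff.1 ht
      exact ⟨k, by simp only [hk]; field_simp⟩
    exact (Set.countable_range _).mono this
  have hmeas : MeasurableSet {t : ℝ | Real.sin (a * t) ≠ 0} :=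
    hcount.measurableSet.compl
  refine (ae_comp_linearMap_mem_iff (l : E →ₗ[ℝ] ℝ) μ volume hsurj hmeas).2 ?_
  have : ∀ᵐ t : ℝ, t ∉ {t : ℝ | Real.sin (a * t) = 0} := hcount.ae_notMem _
  exact this

/-- Continuity of translations in `L¹`, read off from the continuity of composition with
measure-preserving maps that depend continuously on a parameter. -/
theorem tendsto_integral_norm_sub_translate {f : E → ℝ} (hf : Integrable f μ) {v : ℕ → E}
    (hv : Tendsto v atTop (𝓝 0)) :
    Tendsto (fun n => ∫ x, ‖f (x + v n) - f x‖ ∂μ) atTop (𝓝 0) := by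
  let G : C(E, C(E, E)) :=
    ContinuousMap.curry ⟨fun p : E × E => p.2 + p.1, by fun_prop⟩
  have hG : Tendsto (fun n => G (v n)) atTop (𝓝 (G 0)) := (G.continuous.tendsto 0).comp hv
  have hmp : ∀ w, MeasurePreserving (G w) μ μ := fun w => measurePreserving_add_right μ w
  have key := Tendsto.compMeasurePreservingLp (p := 1)
    (tendsto_const_nhds (x := hf.toL1 f)) hG (fun n => hmp (v n)) (hmp 0) (by simp)
  have e0 : Lp.compMeasurePreserving (G 0) (hmp 0) (hf.toL1 f) = hf.toL1 f := by
    refine Lp.ext ?_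
    filter_upwards [Lp.coeFn_compMeasurePreserving (hf.toL1 f) (hmp 0)] with x hx
    rw [hx]
    change (hf.toL1 f) (x + 0) = _
    rw [add_zero]
  rw [e0, tendsto_iff_norm_sub_tendsto_zero] at key
  refine key.congr fun n => ?_
  rw [L1.norm_eq_integral_norm]
  refine integral_congr_ae ?_
  filter_upwards [Lp.coeFn_sub (Lp.compMeasurePreserving (G (v n)) (hmp (v n)) (hf.toL1 f))
    (hf.toL1 f), Lp.coeFn_compMeasurePreserving (hf.toL1 f) (hmp (v n)), hf.coeFn_toL1,
    (hmp (v n)).quasiMeasurePreserving.ae hf.coeFn_toL1] with x h1 h2 h3 h4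
  rw [h1, Pi.sub_apply, h2, h3, Function.comp_apply, h4]
  rfl

/-- Translating by half a period changes the sign of the wave, so twice the integral equals, up to
sign, the integral of the wave against `f(x + vₙ) - f(x)`, which is small in `L¹`. -/
theorem tendsto_integral_squareWave_mul {l : E →L[ℝ] ℝ} (hl : l ≠ 0) {f : E → ℝ}
    (hf : Integrable f μ) :
    Tendsto (fun n : ℕ => ∫ x, squareWave ((n + 1 : ℝ) * l x) * f x ∂μ) atTop (𝓝 0) := by
  obtain ⟨w, hw⟩ : ∃ w, l w ≠ 0 := by
    by_contra! h
    exact hl (by ext x; simp [h x])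
  -- Chosen so that `(n + 1) l(vₙ) = π`, half a period.
  set v : ℕ → E := fun n => (Real.pi / ((n + 1 : ℝ) * l w)) • w with hv
  have hv0 : Tendsto v atTop (𝓝 0) := by
    have h1 : Tendsto (fun n : ℕ => (Real.pi / l w) * (1 / ((n : ℝ) + 1))) atTop (𝓝 0) := by
      simpa using tendsto_one_div_add_atTop_nhds_zero_nat.const_mul (Real.pi / l w)
    have h2 := h1.smul_const w
    rw [zero_smul] at h2
    refine h2.congr fun n => ?_
    simp only [hv]
    congr 1
    field_simp
  have hT := tendsto_integral_norm_sub_translate μ hf hv0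
  refine squeeze_zero_norm (fun n => ?_) hT
  have hn : (n + 1 : ℝ) ≠ 0 := by positivity
  have hmeas : AEStronglyMeasurable (fun x => squareWave ((n + 1 : ℝ) * l x)) μ :=
    (measurable_squareWave.comp (by fun_prop)).aestronglyMeasurable
  have hint : ∀ g : E → ℝ, Integrable g μ →
      Integrable (fun x => squareWave ((n + 1 : ℝ) * l x) * g x) μ := fun g hg =>
    hg.bdd_mul hmeas (c := 1) (ae_of_all _ fun x => (abs_squareWave _).le)
  have hshift : ∫ x, squareWave ((n + 1 : ℝ) * l x) * f x ∂μ
      = -∫ x, squareWave ((n + 1 : ℝ) * l x) * f (x + v n) ∂μ := by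
    rw [← integral_add_right_eq_self _ (v n), ← integral_neg]
    refine integral_congr_ae ?_
    filter_upwards [ae_sin_ne_zero μ hl hn] with x hx
    have : (n + 1 : ℝ) * l (x + v n) = (n + 1 : ℝ) * l x + Real.pi := by
      simp only [hv, map_add, map_smul, smul_eq_mul]
      field_simp
    rw [this, squareWave_add_pi hx]
    ring
  have hf' : Integrable (fun x => f (x + v n)) μ := hf.comp_add_right (v n)
  have htwo : 2 * ∫ x, squareWave ((n + 1 : ℝ) * l x) * f x ∂μ
      = -∫ x, squareWave ((n + 1 : ℝ) * l x) * (f (x + v n) - f x) ∂μ := by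
    have : ∫ x, squareWave ((n + 1 : ℝ) * l x) * (f (x + v n) - f x) ∂μ
        = ∫ x, squareWave ((n + 1 : ℝ) * l x) * f (x + v n) ∂μ
          - ∫ x, squareWave ((n + 1 : ℝ) * l x) * f x ∂μ := by
      rw [← integral_sub (hint _ hf') (hint _ hf)]
      congr 1; ext x; ring
    rw [this]
    linarith
  have hle : ‖2 * ∫ x, squareWave ((n + 1 : ℝ) * l x) * f x ∂μ‖
      ≤ ∫ x, ‖f (x + v n) - f x‖ ∂μ := by
    rw [htwo, norm_neg]
    refine (norm_integral_le_integral_norm _).trans (le_of_eq ?_)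
    congr 1; ext x
    rw [norm_mul, Real.norm_eq_abs (squareWave _), abs_squareWave, one_mul]
  rw [norm_mul, Real.norm_ofNat] at hle
  have := norm_nonneg (∫ x, squareWave ((n + 1 : ℝ) * l x) * f x ∂μ)
  linarith

/-- Weak convergence of the square waves, in `[0, ∞]`. -/
theorem tendsto_lintegral_squareWave {l : E →L[ℝ] ℝ} (hl : l ≠ 0) {f : E → ℝ≥0∞}
    (hf : AEMeasurable f μ) (hfin : ∫⁻ x, f x ∂μ ≠ ⊤) {e : ℝ} (he : e = 1 ∨ e = -1) :
    Tendsto (fun n : ℕ => ∫⁻ x, ENNReal.ofReal (1 + e * squareWave ((n + 1 : ℝ) * l x)) * f x ∂μ)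
      atTop (𝓝 (∫⁻ x, f x ∂μ)) := by
  have hg : Integrable (fun x => (f x).toReal) μ := integrable_toReal_of_lintegral_ne_top hf hfin
  have hlt := ae_lt_top' hf hfin
  have hnn : ∀ t, 0 ≤ 1 + e * squareWave t := by
    intro t
    rcases he with rfl | rfl <;> rcases squareWave_eq t with h | h <;> rw [h] <;> norm_num
  have hint : ∀ n : ℕ, Integrable (fun x => squareWave ((n + 1 : ℝ) * l x) * (f x).toReal) μ :=
    fun n => hg.bdd_mul (measurable_squareWave.comp (by fun_prop)).aestronglyMeasurable (c := 1)
      (ae_of_all _ fun x => (abs_squareWave _).le)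
  have e1 : ∀ n : ℕ, ∫⁻ x, ENNReal.ofReal (1 + e * squareWave ((n + 1 : ℝ) * l x)) * f x ∂μ
      = ENNReal.ofReal (∫ x, (f x).toReal ∂μ
        + e * ∫ x, squareWave ((n + 1 : ℝ) * l x) * (f x).toReal ∂μ) := by
    intro n
    rw [← integral_const_mul, ← integral_add hg ((hint n).const_mul e),
      ofReal_integral_eq_lintegral_ofReal (f := fun x => (f x).toReal
        + e * (squareWave ((n + 1 : ℝ) * l x) * (f x).toReal)) (hg.add ((hint n).const_mul e))]
    · refine lintegral_congr_ae ?_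
      filter_upwards [hlt] with x hx
      rw [← mul_assoc, ← one_add_mul, ENNReal.ofReal_mul (hnn _), ENNReal.ofReal_toReal hx.ne]
    · refine ae_of_all _ fun x => ?_
      have := mul_nonneg (hnn ((n + 1 : ℝ) * l x)) (ENNReal.toReal_nonneg (a := f x))
      simp only [Pi.zero_apply]
      linarith
  simp_rw [e1]
  have e2 : ∫⁻ x, f x ∂μ = ENNReal.ofReal (∫ x, (f x).toReal ∂μ + e * 0) := by
    rw [mul_zero, add_zero, integral_toReal hf hlt, ENNReal.ofReal_toReal hfin]
  rw [e2]
  exact (ENNReal.continuous_ofReal.tendsto _).comp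
    (((tendsto_integral_squareWave_mul μ hl hg).const_mul e).const_add _)

end Oscillation

/-! ### Smooth approximation of the triangle wave -/

/-- A smooth approximation, for `0 < a < 1`, of the antiderivative of the square wave. -/
def triangleWave (a t : ℝ) : ℝ := -Real.arcsin (a * Real.cos t)

theorem abs_triangleWave_le (a t : ℝ) : |triangleWave a t| ≤ Real.pi / 2 := by
  rw [triangleWave, abs_neg]
  exact abs_le.2 ⟨Real.neg_pi_div_two_le_arcsin _, Real.arcsin_le_pi_div_two _⟩

theorem abs_mul_cos_lt {a : ℝ} (ha : 0 < a) (ha1 : a < 1) (t : ℝ) : |a * Real.cos t| < 1 := by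
  rw [abs_mul, abs_of_pos ha]
  nlinarith [Real.abs_cos_le_one t, abs_nonneg (Real.cos t)]

theorem contDiff_triangleWave {a : ℝ} (ha : 0 < a) (ha1 : a < 1) {n : WithTop ℕ∞} :
    ContDiff ℝ n (triangleWave a) := by
  refine contDiff_iff_contDiffAt.2 fun t => ContDiffAt.neg ?_
  have h := abs_lt.1 (abs_mul_cos_lt ha ha1 t)
  have hc : ContDiff ℝ n fun t => a * Real.cos t := contDiff_const.mul Real.contDiff_cos
  exact ContDiffAt.comp (g := Real.arcsin) t (Real.contDiffAt_arcsin h.1.ne' h.2.ne) hc.contDiffAt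

/-- The derivative of `triangleWave a`. -/
def smoothWave (a t : ℝ) : ℝ := a * Real.sin t / √(1 - (a * Real.cos t) ^ 2)

theorem hasDerivAt_triangleWave {a : ℝ} (ha : 0 < a) (ha1 : a < 1) (t : ℝ) :
    HasDerivAt (triangleWave a) (smoothWave a t) t := by
  have h := abs_lt.1 (abs_mul_cos_lt ha ha1 t)
  have h1 : HasDerivAt (triangleWave a) _ t :=
    (HasDerivAt.comp (h₂ := Real.arcsin) t (Real.hasDerivAt_arcsin h.1.ne' h.2.ne)
      ((Real.hasDerivAt_cos t).const_mul a)).neg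
  refine h1.congr_deriv ?_
  unfold smoothWave
  ring

theorem abs_smoothWave_le {a : ℝ} (ha : 0 < a) (ha1 : a < 1) (t : ℝ) : |smoothWave a t| ≤ 1 := by
  rw [smoothWave, abs_div, abs_of_nonneg (Real.sqrt_nonneg _)]
  refine div_le_one_of_le₀ (Real.abs_le_sqrt ?_) (Real.sqrt_nonneg _)
  have h : (a * Real.sin t) ^ 2 + (a * Real.cos t) ^ 2 = a ^ 2 := by
    rw [mul_pow, mul_pow, ← mul_add, Real.sin_sq_add_cos_sq, mul_one]
  have : a ^ 2 ≤ 1 := pow_le_one₀ ha.le ha1.le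
  linarith

/-- At `a = 1` the formula reads `sin t / |sin t|`, and it is continuous in `a` there as long as the
denominator does not vanish. -/
theorem tendsto_smoothWave {a : ℕ → ℝ} (ha : Tendsto a atTop (𝓝 1)) {t : ℝ}
    (ht : Real.sin t ≠ 0) : Tendsto (fun n => smoothWave (a n) t) atTop (𝓝 (squareWave t)) := by
  have e : squareWave t = 1 * Real.sin t / √(1 - (1 * Real.cos t) ^ 2) := by
    rw [one_mul, one_mul, ← Real.abs_sin_eq_sqrt_one_sub_cos_sq, squareWave]
    rcases lt_or_gt_of_ne ht with h | h
    · rw [if_neg (by linarith), abs_of_neg h, div_neg, div_self ht]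
    · rw [if_pos h.le, abs_of_pos h, div_self ht]
  rw [e]
  refine (ha.mul_const _).div ?_ ?_
  · exact (Real.continuous_sqrt.tendsto _).comp (((ha.mul_const _).pow 2).const_sub 1)
  · rw [one_mul, ← Real.abs_sin_eq_sqrt_one_sub_cos_sq]
    exact abs_ne_zero.2 ht

theorem continuous_smoothWave {a : ℝ} (ha : 0 < a) (ha1 : a < 1) : Continuous (smoothWave a) := by
  have h : deriv (triangleWave a) = smoothWave a :=
    funext fun t => (hasDerivAt_triangleWave ha ha1 t).deriv
  rw [← h]
  exact (contDiff_triangleWave ha ha1).continuous_deriv (n := 1) le_rfl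

/-! ### Matrix norms, symmetric parts and rank-one matrices. -/

/-- A matrix as a Euclidean vector. -/
def vec : Mat3 →ₗ[ℝ] EuclideanSpace ℝ (Fin 3 × Fin 3) where
  toFun A := WithLp.toLp 2 fun p => A p.1 p.2
  map_add' _ _ := rfl
  map_smul' _ _ := rfl

theorem vec_apply (A : Mat3) (p : Fin 3 × Fin 3) : vec A p = A p.1 p.2 := rfl

theorem norm_vec_sq (A : Mat3) : ‖vec A‖ ^ 2 = frobSq A := by
  rw [EuclideanSpace.real_norm_sq_eq, frobSq, Fintype.sum_prod_type]
  rfl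

theorem norm_vec (A : Mat3) : ‖vec A‖ = frob A := by
  rw [frob, ← norm_vec_sq, Real.sqrt_sq (norm_nonneg _)]

theorem symPart_add (A B : Mat3) : symPart (A + B) = symPart A + symPart B := by
  unfold symPart
  rw [Matrix.transpose_add, ← smul_add]
  congr 1
  abel

theorem symPart_smul (a : ℝ) (A : Mat3) : symPart (a • A) = a • symPart A := by
  unfold symPart
  rw [Matrix.transpose_smul, ← smul_add, smul_comm]

theorem symPart_sub (A B : Mat3) : symPart (A - B) = symPart A - symPart B := by
  rw [sub_eq_add_neg, ← neg_one_smul ℝ B, symPart_add, symPart_smul, neg_one_smul,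
    ← sub_eq_add_neg]

theorem norm_vec_transpose (A : Mat3) : ‖vec A.transpose‖ = ‖vec A‖ := by
  rw [norm_vec, norm_vec, frob, frob, frobSq, frobSq, Finset.sum_comm]
  rfl

theorem norm_vec_symPart_le (A : Mat3) : ‖vec (symPart A)‖ ≤ ‖vec A‖ := by
  unfold symPart
  rw [map_smul, map_add, norm_smul]
  have := norm_add_le (vec A) (vec A.transpose)
  rw [norm_vec_transpose] at this
  norm_num
  linarith

theorem tensor_add_left (s r m : E3) : tensor (s + r) m = tensor s m + tensor r m := by
  ext i k; simp [tensor, add_mul]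

theorem tensor_smul_left (a : ℝ) (s m : E3) : tensor (a • s) m = a • tensor s m := by
  ext i k; simp [tensor, mul_assoc]

theorem tensor_sub_left (s r m : E3) : tensor (s - r) m = tensor s m - tensor r m := by
  ext i k; simp [tensor, sub_mul]

theorem tensor_zero_left (m : E3) : tensor 0 m = 0 := by
  ext i k; simp [tensor]

theorem frobSq_tensor (s m : E3) : frobSq (tensor s m) = ‖s‖ ^ 2 * ‖m‖ ^ 2 := by
  rw [EuclideanSpace.real_norm_sq_eq, EuclideanSpace.real_norm_sq_eq, Finset.sum_mul_sum, frobSq]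
  simp [tensor, mul_pow]

theorem norm_vec_tensor (s m : E3) : ‖vec (tensor s m)‖ = ‖s‖ * ‖m‖ := by
  rw [norm_vec, frob, frobSq_tensor, ← mul_pow, Real.sqrt_sq (by positivity)]

/-- In general there is an additional term `(s·m)² / 2`, which orthogonality removes. This identity
lets the elastic energy control the full slip and not only its symmetric part. -/
theorem frobSq_symPart_tensor {s m : E3} (h : inner ℝ m s = 0) :
    frobSq (symPart (tensor s m)) = 1 / 2 * (‖s‖ ^ 2 * ‖m‖ ^ 2) := by
  have h' : s 0 * m 0 + s 1 * m 1 + s 2 * m 2 = 0 := by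
    rw [← h, PiLp.inner_apply, Fin.sum_univ_three]
    simp
  rw [EuclideanSpace.real_norm_sq_eq, EuclideanSpace.real_norm_sq_eq]
  simp only [frobSq, symPart, tensor, Fin.sum_univ_three, Matrix.smul_apply, Matrix.add_apply,
    Matrix.transpose_apply, Matrix.of_apply, smul_eq_mul]
  linear_combination (1 / 2) * (s 0 * m 0 + s 1 * m 1 + s 2 * m 2) * h'

/-! ### Burgers components as linear functionals, and uniqueness of the slip plane. -/

namespace SlipPlane

variable (S : SlipPlane)

theorem norm_normal : ‖S.normal‖ = 1 := S.frame.orthonormal.1 0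

theorem inner_normal_burgers (i : Fin 2) : inner ℝ S.normal (S.burgers i) = 0 :=
  S.inner_burgers i

theorem inPlane_add (v w : E3) (i : Fin 2) : S.inPlane (v + w) i = S.inPlane v i + S.inPlane w i :=
  inner_add_right _ _ _

theorem inPlane_smul (a : ℝ) (v : E3) (i : Fin 2) : S.inPlane (a • v) i = a * S.inPlane v i :=
  inner_smul_right _ _ _

theorem sum_inPlane_burgers_sq (i : Fin 2) : ∑ k, S.inPlane (S.burgers i) k ^ 2 = 1 := by
  have h := S.frame.sum_sq_norm_inner_right (S.burgers i)
  rw [Fin.sum_univ_three, S.inner_burgers, S.norm_burgers] at h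
  rw [Fin.sum_univ_two]
  simpa [inPlane] using h

/-- The components with respect to the Burgers vectors as linear functionals. -/
def coeffL (i : Fin 2) : E3 →ₗ[ℝ] ℝ where
  toFun s := S.coeff s i
  map_add' v w := by
    fin_cases i <;> simp [coeff, det, inPlane_add] <;> ring
  map_smul' a v := by
    fin_cases i <;> simp [coeff, det, inPlane_smul] <;> ring

theorem coeff_add (s r : E3) (i : Fin 2) : S.coeff (s + r) i = S.coeff s i + S.coeff r i :=
  (S.coeffL i).map_add s r

theorem coeff_smul (a : ℝ) (s : E3) (i : Fin 2) : S.coeff (a • s) i = a * S.coeff s i :=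
  (S.coeffL i).map_smul a s

theorem coeff_zero (i : Fin 2) : S.coeff 0 i = 0 := (S.coeffL i).map_zero

theorem contDiff_coeff (i : Fin 2) {n : WithTop ℕ∞} : ContDiff ℝ n fun s => S.coeff s i :=
  (S.coeffL i).toContinuousLinearMap.contDiff

theorem exists_abs_coeff_le (i : Fin 2) : ∃ C : ℝ, 0 ≤ C ∧ ∀ s, |S.coeff s i| ≤ C * ‖s‖ :=
  ⟨‖(S.coeffL i).toContinuousLinearMap‖, norm_nonneg _,
    fun s => (S.coeffL i).toContinuousLinearMap.le_opNorm s⟩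

/-- Any nonzero row of the matrix determines the line spanned by the normal; unit length leaves only
the sign. -/
theorem tensor_normal_eq {v s m : E3} (hv : v ≠ 0) (hm : ‖m‖ = 1)
    (h : tensor v m = tensor s S.normal) : m = S.normal ∨ m = -S.normal := by
  obtain ⟨i, hi⟩ : ∃ i, v i ≠ 0 := by
    by_contra! hn
    exact hv (by ext i; simp [hn i])
  have e : m = (s i / v i) • S.normal := by
    ext k
    have := congrFun (congrFun h i) k
    simp only [tensor, Matrix.of_apply] at this
    simp only [PiLp.smul_apply, smul_eq_mul]
    field_simp
    linarith
  have hn : |s i / v i| = 1 := by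
    have := congrArg norm e
    rw [hm, norm_smul, S.norm_normal, mul_one] at this
    exact this.symm
  rcases (abs_eq zero_le_one).1 hn with h1 | h1
  · left; rw [e, h1, one_smul]
  · right; rw [e, h1, neg_one_smul]

end SlipPlane

/-! ### Reading off the active slip plane. -/

section Family

variable {M : ℕ} {S : Fin M → SlipPlane}

/-- A nonzero slip cannot be represented on two planes whose normals are not parallel, and a zero
slip is represented everywhere by zero. -/
theorem slip_tensor_of_ne
    (hS : ∀ j k, j ≠ k → (S j).normal ≠ (S k).normal ∧ (S j).normal ≠ -(S k).normal)
    {β : E3 → Mat3} {x v : E3} {j k : Fin M} (hjk : k ≠ j)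
    (h : β x = tensor v (S k).normal) : (S j).slip β x = 0 := by
  by_cases hv : v = 0
  · exact (S j).slip_eq (by simp) (by rw [h, hv, tensor_zero_left, tensor_zero_left])
  · rw [SlipPlane.slip, if_neg]
    rintro ⟨s, -, hs⟩
    rw [h] at hs
    rcases (S j).tensor_normal_eq hv (S k).norm_normal hs with e | e
    · exact (hS k j hjk).1 e
    · exact (hS k j hjk).2 e

theorem slip_sum_tensor
    (hS : ∀ j k, j ≠ k → (S j).normal ≠ (S k).normal ∧ (S j).normal ≠ -(S k).normal)
    {β : E3 → Mat3} {x : E3} {v : Fin M → E3}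
    (hv : ∀ j, inner ℝ (S j).normal (v j) = 0) (hone : ∀ j k, j ≠ k → v j = 0 ∨ v k = 0)
    (h : β x = ∑ k, tensor (v k) (S k).normal) (j : Fin M) : (S j).slip β x = v j := by
  by_cases hex : ∃ k, v k ≠ 0
  · obtain ⟨k, hk⟩ := hex
    have e : β x = tensor (v k) (S k).normal := by
      rw [h]
      refine Finset.sum_eq_single k (fun l _ hl => ?_) (by simp)
      rw [(hone l k hl).resolve_right hk, tensor_zero_left]
    by_cases hjk : k = j
    · subst hjk
      exact (S k).slip_eq (hv k) e
    · rw [slip_tensor_of_ne hS hjk e]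
      exact ((hone k j hjk).resolve_left hk).symm
  · push Not at hex
    have e : β x = tensor 0 (S j).normal := by
      rw [h, tensor_zero_left]
      exact Finset.sum_eq_zero fun k _ => by rw [hex k, tensor_zero_left]
    rw [hex j]
    exact (S j).slip_eq (by simp) e

theorem frob_sum_tensor {v : Fin M → E3} (hone : ∀ j k, j ≠ k → v j = 0 ∨ v k = 0) :
    frob (∑ k, tensor (v k) (S k).normal) = ∑ k, ‖v k‖ := by
  by_cases hex : ∃ k, v k ≠ 0
  · obtain ⟨k, hk⟩ := hex
    have h0 : ∀ l, l ≠ k → v l = 0 := fun l hl => (hone l k hl).resolve_right hk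
    rw [Finset.sum_eq_single k (fun l _ hl => by rw [h0 l hl, tensor_zero_left]) (by simp),
      Finset.sum_eq_single k (fun l _ hl => by rw [h0 l hl, norm_zero]) (by simp),
      ← norm_vec, norm_vec_tensor, (S k).norm_normal, mul_one]
  · push Not at hex
    simp [hex, tensor_zero_left, ← norm_vec]

end Family

/-! ### Slices, and measurability of the slice variation. -/

namespace SlipPlane

variable (S : SlipPlane)

theorem continuous_point : Continuous fun p : ℝ × E2 => S.point p.1 p.2 := by
  unfold point; fun_prop

theorem measurePreserving_point :
    MeasurePreserving (fun p : ℝ × E2 => S.point p.1 p.2) := by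
  have h1 : MeasurePreserving (Prod.map (id : ℝ → ℝ) (WithLp.ofLp : E2 → Fin 2 → ℝ)) :=
    (MeasurePreserving.id volume).prod (PiLp.volume_preserving_ofLp (Fin 2))
  have h2 := (volume_preserving_piFinSuccAbove (fun _ : Fin 3 => ℝ) 0).symm
  have h3 := PiLp.volume_preserving_toLp (Fin 3)
  have h4 := S.frame.measurePreserving_repr_symm
  have h := h4.comp (h3.comp (h2.comp h1))
  refine (congrArg (fun f => MeasurePreserving f volume volume) (funext fun p => ?_)).mpr h
  change S.point p.1 p.2 = S.frame.repr.symm (WithLp.toLp 2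
    ((MeasurableEquiv.piFinSuccAbove (fun _ => ℝ) 0).symm (Prod.map id WithLp.ofLp p)))
  rw [← S.frame.sum_repr_symm, Fin.sum_univ_three]
  rfl

theorem inner_normal_point (t : ℝ) (y : E2) : inner ℝ S.normal (S.point t y) = t := by
  have h := S.frame.orthonormal
  unfold normal point
  rw [inner_add_right, inner_add_right, inner_smul_right, inner_smul_right, inner_smul_right,
    h.2 (by decide : (0 : Fin 3) ≠ 1), h.2 (by decide : (0 : Fin 3) ≠ 2),
    real_inner_self_eq_norm_sq, h.1]
  simp

theorem isOpen_slice {A : Set E3} (hA : IsOpen A) (t : ℝ) : IsOpen (S.slice A t) :=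
  hA.preimage (S.continuous_point.comp (by fun_prop : Continuous fun y : E2 => (t, y)))

theorem contDiff_point (t : ℝ) {n : WithTop ℕ∞} : ContDiff ℝ n fun y => S.point t y := by
  unfold point
  have h : ∀ i : Fin 2, ContDiff ℝ n fun y : E2 => y i := fun i => contDiff_euclidean.1 contDiff_id i
  exact (contDiff_const.add ((h 0).smul contDiff_const)).add ((h 1).smul contDiff_const)

/-- The tube lemma. It makes the condition `K ⊆ A_t` measurable in `t`. -/
theorem isOpen_setOf_subset_slice {A : Set E3} (hA : IsOpen A) {K : Set E2} (hK : IsCompact K) :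
    IsOpen {t | K ⊆ S.slice A t} := by
  rw [isOpen_iff_mem_nhds]
  intro t ht
  refine hK.eventually_forall_of_forall_eventually fun y hy => ?_
  exact (hA.preimage S.continuous_point).mem_nhds (ht hy)

end SlipPlane

/-- Closures of finite unions of basic open sets suffice, keeping those that are compact. The family
does not depend on `U`, so it serves all slices at once. -/
theorem exists_countable_compacts_between (X : Type*) [TopologicalSpace X]
    [SecondCountableTopology X] [LocallyCompactSpace X] [T2Space X] :
    ∃ 𝒦 : Set (Set X), 𝒦.Countable ∧ (∀ K ∈ 𝒦, IsCompact K) ∧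
      ∀ U C : Set X, IsOpen U → IsCompact C → C ⊆ U → ∃ K ∈ 𝒦, C ⊆ K ∧ K ⊆ U := by
  set B := TopologicalSpace.countableBasis X
  have hB := TopologicalSpace.isBasis_countableBasis X
  refine ⟨(fun s => closure (⋃₀ s)) '' {s : Set (Set X) | s.Finite ∧ s ⊆ B} ∩ {K | IsCompact K},
    ?_, fun K hK => hK.2, ?_⟩
  · exact ((Set.countable_ofPred_finite_subset
      (TopologicalSpace.countable_countableBasis X)).image _).mono Set.inter_subset_left
  · intro U C hU hC hCU
    obtain ⟨L, hL, hCL, hLU⟩ := exists_compact_between hC hU hCU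
    have h : ∀ x ∈ C, ∃ b ∈ B, x ∈ b ∧ b ⊆ interior L := fun x hx =>
      hB.exists_subset_of_mem_open (hCL hx) isOpen_interior
    choose! b hbB hxb hbL using h
    obtain ⟨T, hTC, hT⟩ := hC.elim_nhds_subcover b fun x hx =>
      (hB.isOpen (hbB x hx)).mem_nhds (hxb x hx)
    have hsub : ⋃₀ (b '' (T : Set X)) ⊆ L := by
      rintro y ⟨_, ⟨x, hx, rfl⟩, hy⟩
      exact interior_subset (hbL x (hTC x hx) hy)
    have hcl : closure (⋃₀ (b '' (T : Set X))) ⊆ L := closure_minimal hsub hL.isClosed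
    refine ⟨closure (⋃₀ (b '' (T : Set X))), ⟨⟨_, ⟨T.finite_toSet.image b, ?_⟩, rfl⟩,
      hL.of_isClosed_subset isClosed_closure hcl⟩, ?_, hcl.trans hLU⟩
    · rintro _ ⟨x, hx, rfl⟩
      exact hbB x (hTC x hx)
    · intro x hx
      obtain ⟨y, hy, hxy⟩ := Set.mem_iUnion₂.1 (hT hx)
      exact subset_closure ⟨b y, ⟨y, hy, rfl⟩, hxy⟩

theorem setIntegral_divergence_eq {K U : Set E2} (hKU : K ⊆ U) (g : E2 → ℝ) {ψ : E2 → E2}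
    (hψ : tsupport ψ ⊆ K) :
    ∫ y in U, g y * divergence ψ y = ∫ y in K, g y * divergence ψ y := by
  have h : ∀ V, K ⊆ V → ∫ y in V, g y * divergence ψ y = ∫ y, g y * divergence ψ y :=
    fun V hV => setIntegral_eq_integral_of_forall_compl_eq_zero fun y hy => by
      by_contra hn
      exact hy (hV (hψ (support_divergence_subset ψ (right_ne_zero_of_mul hn))))
  rw [h U hKU, h K le_rfl]

/-- The test fields with support in a compact set can be replaced by countably many of them. -/
theorem exists_countable_vectorTest {K : Set E2} (hK : IsCompact K) :
    ∃ D : Set (E2 → E2), D.Countable ∧ D ⊆ vectorTest K ∧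
      ∀ g : E2 → ℝ, IntegrableOn g K volume → ∀ ψ ∈ vectorTest K,
        ENNReal.ofReal (∫ y in K, g y * divergence ψ y)
          ≤ ⨆ χ ∈ D, ENNReal.ofReal (∫ y in K, g y * divergence χ y) := by
  -- Only the divergence of a test field enters the integrals, so the test fields get the topology
  -- induced from `C(E2, ℝ)`, which is second countable; a countable dense set is available.
  let Φ : vectorTest K → C(E2, ℝ) := fun ψ => ⟨divergence ψ, continuous_divergence ψ.2.1⟩
  let _ : TopologicalSpace (vectorTest K) := TopologicalSpace.induced Φ inferInstance
  have hind : IsInducing Φ := ⟨rfl⟩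
  have : SecondCountableTopology (vectorTest K) := hind.secondCountableTopology
  obtain ⟨D, hDc, hDd⟩ := TopologicalSpace.exists_countable_dense (vectorTest K)
  refine ⟨Subtype.val '' D, hDc.image _, by rintro _ ⟨ψ, -, rfl⟩; exact ψ.2, ?_⟩
  intro g hg ψ hψ
  have hcl : (⟨ψ, hψ⟩ : vectorTest K) ∈ closure D := hDd _
  obtain ⟨χ, hχD, hχ⟩ := mem_closure_iff_seq_limit.1 hcl
  have hlim : Tendsto (fun n => Φ (χ n)) atTop (𝓝 (Φ ⟨ψ, hψ⟩)) :=
    (hind.continuous.tendsto _).comp hχ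
  have hu : TendstoUniformlyOn (fun n => divergence (χ n).1) (divergence ψ) atTop K :=
    ContinuousMap.tendsto_iff_forall_isCompact_tendstoUniformlyOn.1 hlim K hK
  -- Once the divergences differ by less than `1` on `K`, the function `|g div ψ| + |g|` is an
  -- integrable majorant.
  have hu1 : ∀ᶠ n in atTop, ∀ y ∈ K, dist (divergence ψ y) (divergence (χ n).1 y) < 1 :=
    Metric.tendstoUniformlyOn_iff.1 hu 1 one_pos
  have hmeas : ∀ χ ∈ vectorTest K, IntegrableOn (fun y => g y * divergence χ y) K volume :=
    fun χ hχ => hg.mul_continuousOn (continuous_divergence hχ.1).continuousOn hK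
  have ht : Tendsto (fun n => ∫ y in K, g y * divergence (χ n).1 y) atTop
      (𝓝 (∫ y in K, g y * divergence ψ y)) := by
    refine tendsto_integral_filter_of_dominated_convergence
      (fun y => |g y * divergence ψ y| + |g y|) ?_ ?_ ?_ ?_
    · exact Eventually.of_forall fun n => (hmeas _ (χ n).2).aestronglyMeasurable
    · filter_upwards [hu1] with n hn
      refine (ae_restrict_iff' hK.measurableSet).2 (ae_of_all _ fun y hy => ?_)
      have h1 := hn y hy
      rw [dist_comm, Real.dist_eq] at h1
      have h2 : |divergence (χ n).1 y| ≤ |divergence ψ y| + 1 := by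
        have := abs_sub_abs_le_abs_sub (divergence (χ n).1 y) (divergence ψ y)
        linarith
      rw [Real.norm_eq_abs, abs_mul, abs_mul]
      nlinarith [abs_nonneg (g y)]
    · exact (hmeas ψ hψ).abs.add hg.abs
    · refine (ae_restrict_iff' hK.measurableSet).2 (ae_of_all _ fun y hy => ?_)
      exact (hu.tendsto_at hy).const_mul _
  refine le_of_tendsto ((ENNReal.continuous_ofReal.tendsto _).comp ht)
    (Eventually.of_forall fun n => ?_)
  exact le_iSup₂_of_le (χ n).1 ⟨χ n, hχD n, rfl⟩ le_rfl

/-- For a strongly measurable representative, the variation of a slice is a countable supremum of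
integrals measurable in `t`, subject to countably many integrability conditions. By Fubini, changing
the representative affects almost no slice. -/
theorem aemeasurable_variation_slice (S : SlipPlane) {A : Set E3} (hA : IsOpen A) {c : E3 → ℝ}
    (hc : AEStronglyMeasurable c (volume.restrict A)) :
    AEMeasurable fun t => variation (S.slice A t) fun y => c (S.point t y) := by
  obtain ⟨𝒦, h𝒦c, h𝒦, h𝒦b⟩ := exists_countable_compacts_between E2
  choose! D hDc hDK hD using fun (K : Set E2) (hK : IsCompact K) => exists_countable_vectorTest hK
  have hc' : AEStronglyMeasurable (A.indicator c) volume :=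
    (aestronglyMeasurable_indicator_iff hA.measurableSet).2 hc
  obtain ⟨f, hf, hcf⟩ := hc'
  classical
  have hfp : StronglyMeasurable fun p : ℝ × E2 => f (S.point p.1 p.2) :=
    hf.comp_measurable S.continuous_point.measurable
  -- Local integrability and the supremum are both tested on the countable family `𝒦`. Compact sets
  -- not contained in the slice contribute `0`, the least element, and so do not affect the
  -- supremum.
  have key : ∀ t, variation (S.slice A t) (fun y => f (S.point t y))
      = if (∀ K ∈ 𝒦, K ⊆ S.slice A t → ∫⁻ y in K, ‖f (S.point t y)‖ₑ < ⊤) then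
          ⨆ K ∈ 𝒦, ⨆ ψ ∈ D K, if K ⊆ S.slice A t then
            ENNReal.ofReal (∫ y in K, f (S.point t y) * divergence ψ y) else 0
        else ⊤ := by
    intro t
    set U := S.slice A t
    have hU : IsOpen U := S.isOpen_slice hA t
    set g : E2 → ℝ := fun y => f (S.point t y) with hgdef
    have hg : StronglyMeasurable g := hfp.comp_measurable measurable_prodMk_left
    have hiff : LocallyIntegrableOn g U volume ↔
        ∀ K ∈ 𝒦, K ⊆ U → ∫⁻ y in K, ‖g y‖ₑ < ⊤ := by
      constructor
      · intro h K hK hKU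
        exact (h.integrableOn_compact_subset hKU (h𝒦 K hK)).2
      · intro h
        refine (locallyIntegrableOn_iff hU.isLocallyClosed).2 fun C hCU hC => ?_
        obtain ⟨K, hK, hCK, hKU⟩ := h𝒦b U C hU hC hCU
        have : IntegrableOn g K volume := ⟨hg.aestronglyMeasurable, h K hK hKU⟩
        exact this.mono_set hCK
    by_cases hl : LocallyIntegrableOn g U volume
    · rw [if_pos (hiff.1 hl)]
      have hv : variation U g = ⨆ ψ ∈ vectorTest U,
        ENNReal.ofReal (∫ y in U, g y * divergence ψ y) := if_pos hl
      rw [hv]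
      apply le_antisymm
      · refine iSup₂_le fun ψ hψ => ?_
        obtain ⟨K, hK, hψK, hKU⟩ := h𝒦b U (tsupport ψ) hU hψ.2.1 hψ.2.2.1
        refine le_iSup₂_of_le K hK ?_
        simp_rw [if_pos hKU]
        rw [setIntegral_divergence_eq hKU g hψK]
        exact hD K (h𝒦 K hK) g (hl.integrableOn_compact_subset hKU (h𝒦 K hK)) ψ
          ⟨hψ.1, hψ.2.1, hψK, hψ.2.2.2⟩
      · refine iSup₂_le fun K hK => iSup₂_le fun ψ hψ => ?_
        split_ifs with hKU
        · have h := hDK K (h𝒦 K hK) hψ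
          refine le_iSup₂_of_le ψ ⟨h.1, h.2.1, h.2.2.1.trans hKU, h.2.2.2⟩ ?_
          rw [setIntegral_divergence_eq hKU g h.2.2.1]
        · exact zero_le
    · rw [if_neg fun h => hl (hiff.2 h)]
      exact if_neg hl
  have hmeas : Measurable fun t => variation (S.slice A t) (fun y => f (S.point t y)) := by
    simp_rw [key]
    have hsub : ∀ K ∈ 𝒦, MeasurableSet {t | K ⊆ S.slice A t} := fun K hK =>
      (S.isOpen_setOf_subset_slice hA (h𝒦 K hK)).measurableSet
    refine Measurable.ite ?_ ?_ measurable_const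
    · have e : {t | ∀ K ∈ 𝒦, K ⊆ S.slice A t → ∫⁻ y in K, ‖f (S.point t y)‖ₑ < ⊤}
          = ⋂ K ∈ 𝒦, ({t | K ⊆ S.slice A t}ᶜ ∪ {t | ∫⁻ y in K, ‖f (S.point t y)‖ₑ < ⊤}) := by
        ext t
        simp only [Set.mem_ofPred_eq, Set.mem_iInter, Set.mem_union, Set.mem_compl_iff,
          imp_iff_not_or]
      rw [e]
      refine MeasurableSet.biInter h𝒦c fun K hK => (hsub K hK).compl.union ?_
      exact measurableSet_lt hfp.enorm.lintegral_prod_right' measurable_const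
    · refine Measurable.biSup _ h𝒦c fun K hK => Measurable.biSup _ (hDc K (h𝒦 K hK)) fun ψ hψ => ?_
      refine Measurable.ite (hsub K hK) (ENNReal.measurable_ofReal.comp ?_) measurable_const
      refine StronglyMeasurable.measurable (StronglyMeasurable.integral_prod_right'
        (f := fun p : ℝ × E2 => f (S.point p.1 p.2) * divergence ψ p.2) ?_)
      refine hfp.mul ?_
      exact ((continuous_divergence (hDK K (h𝒦 K hK) hψ).1).comp continuous_snd).stronglyMeasurable
  refine hmeas.aemeasurable.congr ?_
  -- Fubini in the coordinates `(t, y)`: for almost every `t` the two representatives agree almost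
  -- everywhere in the slice.
  have hae := Measure.ae_ae_of_ae_prod (S.measurePreserving_point.quasiMeasurePreserving.ae hcf)
  filter_upwards [hae] with t ht
  refine variation_congr ((ae_restrict_iff' (S.isOpen_slice hA t).measurableSet).2 ?_)
  filter_upwards [ht] with y hy hyU
  rw [← hy]
  exact Set.indicator_of_mem (show S.point t y ∈ A from hyU) c

/-! ### `L²` convergence, and selection of sequences. -/

section Lp

variable {α F : Type*} [MeasurableSpace α] {μ : Measure α} [NormedAddCommGroup F]

theorem eLpNorm_two_sq (f : α → F) :
    eLpNorm f 2 μ ^ 2 = ∫⁻ x, ENNReal.ofReal (‖f x‖ ^ 2) ∂μ := by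
  have h := eLpNorm_nnreal_eq_lintegral (f := f) (μ := μ) (p := 2) two_ne_zero
  rw [show ((2 : ℝ≥0) : ℝ≥0∞) = 2 from rfl] at h
  rw [h, ← ENNReal.rpow_natCast, ← ENNReal.rpow_mul]
  norm_num

theorem eLpNorm_two_eq (f : α → F) :
    eLpNorm f 2 μ = (∫⁻ x, ENNReal.ofReal (‖f x‖ ^ 2) ∂μ) ^ (1 / 2 : ℝ) := by
  rw [← eLpNorm_two_sq, ← ENNReal.rpow_natCast, ← ENNReal.rpow_mul]
  norm_num

theorem tendsto_eLpNorm_two_zero {f : ℕ → α → F} {g : α → ℝ}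
    (hf : ∀ n, AEStronglyMeasurable (f n) μ) (hg : MemLp g 2 μ)
    (hle : ∀ n, ∀ᵐ x ∂μ, ‖f n x‖ ≤ g x)
    (hlim : ∀ᵐ x ∂μ, Tendsto (fun n => f n x) atTop (𝓝 0)) :
    Tendsto (fun n => eLpNorm (f n) 2 μ) atTop (𝓝 0) := by
  have h : Tendsto (fun n => ∫⁻ x, ENNReal.ofReal (‖f n x‖ ^ 2) ∂μ) atTop
      (𝓝 (∫⁻ _, 0 ∂μ)) := by
    refine tendsto_lintegral_of_dominated_convergence' (fun x => ENNReal.ofReal (‖g x‖ ^ 2))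
      (fun n => ((hf n).norm.aemeasurable.pow_const 2).ennreal_ofReal) (fun n => ?_) ?_ ?_
    · filter_upwards [hle n] with x hx
      refine ENNReal.ofReal_le_ofReal (pow_le_pow_left₀ (norm_nonneg _) ?_ 2)
      exact hx.trans (le_abs_self _)
    · rw [← eLpNorm_two_sq]
      exact ENNReal.pow_ne_top hg.2.ne
    · filter_upwards [hlim] with x hx
      have := (ENNReal.continuous_ofReal.tendsto _).comp (hx.norm.pow 2)
      simpa [Function.comp_def] using this
  rw [lintegral_zero] at h
  simp_rw [eLpNorm_two_eq]
  have h2 := (ENNReal.continuous_rpow_const (y := (1 / 2 : ℝ))).tendsto 0 |>.comp h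
  simpa [Function.comp_def] using h2

/-- `L²` convergence implies convergence of the squared norms. -/
theorem tendsto_lintegral_norm_sq {f : ℕ → α → F} {g : α → F}
    (hf : ∀ n, AEStronglyMeasurable (f n) μ) (hg : AEStronglyMeasurable g μ)
    (h : Tendsto (fun n => eLpNorm (f n - g) 2 μ) atTop (𝓝 0)) :
    Tendsto (fun n => ∫⁻ x, ENNReal.ofReal (‖f n x‖ ^ 2) ∂μ) atTop
      (𝓝 (∫⁻ x, ENNReal.ofReal (‖g x‖ ^ 2) ∂μ)) := by
  simp_rw [← eLpNorm_two_sq]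
  refine (ENNReal.continuous_pow 2).tendsto _ |>.comp ?_
  have hup : Tendsto (fun n => eLpNorm g 2 μ + eLpNorm (f n - g) 2 μ) atTop
      (𝓝 (eLpNorm g 2 μ)) := by
    simpa using tendsto_const_nhds.add h
  have hlow : Tendsto (fun n => eLpNorm g 2 μ - eLpNorm (f n - g) 2 μ) atTop
      (𝓝 (eLpNorm g 2 μ)) := by
    simpa using ENNReal.Tendsto.sub (tendsto_const_nhds (x := eLpNorm g 2 μ)) h (Or.inr (by simp))
  refine tendsto_of_tendsto_of_tendsto_of_le_of_le hlow hup (fun n => ?_) (fun n => ?_)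
  · refine tsub_le_iff_right.2 ?_
    have e : g = f n - (f n - g) := by simp
    conv_lhs => rw [e]
    exact eLpNorm_sub_le (hf n) ((hf n).sub hg) (by norm_num)
  · have e : f n = g + (f n - g) := by simp
    conv_lhs => rw [e]
    exact eLpNorm_add_le hg ((hf n).sub hg) (by norm_num)

end Lp

/-- Picking a near-minimiser of the error for each `n`, within `1 / (n + 1)` of the infimum, turns
an approximation whose parameters depend on `ε` into a single sequence. -/
theorem exists_seq_tendsto_zero {X : Type*} {T : Set X} (hT : T.Nonempty) {err : ℕ → X → ℝ≥0∞}
    (h : ∀ ε > 0, ∀ᶠ n in atTop, ∃ φ ∈ T, err n φ ≤ ε) :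
    ∃ φ : ℕ → X, (∀ n, φ n ∈ T) ∧ Tendsto (fun n => err n (φ n)) atTop (𝓝 0) := by
  have hch : ∀ n : ℕ, ∃ φ ∈ T, err n φ ≤ (⨅ φ ∈ T, err n φ) + ENNReal.ofReal (1 / ((n : ℝ) + 1)) := by
    intro n
    by_cases ht : (⨅ φ ∈ T, err n φ) = ⊤
    · obtain ⟨φ, hφ⟩ := hT
      exact ⟨φ, hφ, by rw [ht]; simp⟩
    · have hlt : (⨅ φ ∈ T, err n φ)
          < (⨅ φ ∈ T, err n φ) + ENNReal.ofReal (1 / ((n : ℝ) + 1)) :=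
        ENNReal.lt_add_right ht (by simp only [ne_eq, ENNReal.ofReal_eq_zero, not_le]; positivity)
      obtain ⟨φ, hφ⟩ := iInf_lt_iff.1 hlt
      obtain ⟨hφT, hφ⟩ := iInf_lt_iff.1 hφ
      exact ⟨φ, hφT, hφ.le⟩
  choose φ hφT hφ using hch
  refine ⟨φ, hφT, ?_⟩
  have hI : Tendsto (fun n => ⨅ φ ∈ T, err n φ) atTop (𝓝 0) := by
    refine ENNReal.tendsto_nhds_zero.2 fun ε hε => ?_
    filter_upwards [h ε hε] with n ⟨φ, hφT, hφ⟩
    exact (iInf₂_le φ hφT).trans hφ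
  have h1 : Tendsto (fun n : ℕ => ENNReal.ofReal (1 / ((n : ℝ) + 1))) atTop (𝓝 0) := by
    simpa [Function.comp_def] using (ENNReal.continuous_ofReal.tendsto _).comp
      (tendsto_one_div_add_atTop_nhds_zero_nat (𝕜 := ℝ))
  have h2 := hI.add h1
  rw [add_zero] at h2
  exact tendsto_of_tendsto_of_tendsto_of_le_of_le tendsto_const_nhds h2 (fun _ => zero_le) hφ

/-! ### Test fields in space -/

/-- Smooth vector fields with compact support in `Ω`. -/
def fieldTest (Ω : Set E3) : Set (E3 → E3) :=
  {φ | ContDiff ℝ ∞ φ ∧ HasCompactSupport φ ∧ tsupport φ ⊆ Ω}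

/-- The matrix of partial derivatives. -/
def jacobian (φ : E3 → E3) (x : E3) : Mat3 :=
  Matrix.of fun i k => fderiv ℝ φ x (EuclideanSpace.single k 1) i

theorem zero_mem_fieldTest (Ω : Set E3) : (0 : E3 → E3) ∈ fieldTest Ω :=
  ⟨contDiff_const, HasCompactSupport.zero, by simp [tsupport]⟩

theorem sum_mem_fieldTest {Ω : Set E3} {ι : Type*} (s : Finset ι) {φ : ι → E3 → E3}
    (h : ∀ i ∈ s, φ i ∈ fieldTest Ω) : ∑ i ∈ s, φ i ∈ fieldTest Ω := by
  classical
  induction s using Finset.induction_on with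
  | empty => simpa using zero_mem_fieldTest Ω
  | insert a s ha ih =>
    rw [Finset.sum_insert ha]
    have h1 := h a (Finset.mem_insert_self a s)
    have h2 := ih fun i hi => h i (Finset.mem_insert_of_mem hi)
    exact ⟨h1.1.add h2.1, h1.2.1.add h2.2.1,
      (tsupport_add _ _).trans (Set.union_subset h1.2.2 h2.2.2)⟩

theorem jacobian_sum {ι : Type*} (s : Finset ι) {φ : ι → E3 → E3} {Ω : Set E3}
    (h : ∀ i ∈ s, φ i ∈ fieldTest Ω) (x : E3) :
    jacobian (∑ i ∈ s, φ i) x = ∑ i ∈ s, jacobian (φ i) x := by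
  ext a b
  rw [Matrix.sum_apply]
  simp only [jacobian, Matrix.of_apply]
  rw [fderiv_sum fun i hi => ((h i hi).1.differentiable (by simp) x)]
  rw [sum_apply]
  simp

theorem continuous_vec_jacobian {Ω : Set E3} {φ : E3 → E3} (h : φ ∈ fieldTest Ω) :
    Continuous fun x => vec (jacobian φ x) := by
  refine (PiLp.continuous_toLp 2 _).comp (continuous_pi fun p => ?_)
  have h1 := (h.1.continuous_fderiv (by simp)).clm_apply
    (continuous_const (y := EuclideanSpace.single p.2 (1 : ℝ)))
  exact (EuclideanSpace.proj (𝕜 := ℝ) p.1).continuous.comp h1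

theorem hasCompactSupport_vec_jacobian {Ω : Set E3} {φ : E3 → E3} (h : φ ∈ fieldTest Ω) :
    HasCompactSupport fun x => vec (jacobian φ x) := by
  refine (h.2.1.fderiv ℝ).mono fun x hx => ?_
  rw [Function.mem_support] at hx ⊢
  intro h0
  apply hx
  have : jacobian φ x = 0 := by ext i k; simp [jacobian, h0]
  rw [this, map_zero]

theorem memLp_vec_jacobian {Ω : Set E3} {φ : E3 → E3} (h : φ ∈ fieldTest Ω) (p : ℝ≥0∞)
    (μ : Measure E3) [IsFiniteMeasureOnCompacts μ] : MemLp (fun x => vec (jacobian φ x)) p μ :=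
  (continuous_vec_jacobian h).memLp_of_hasCompactSupport (hasCompactSupport_vec_jacobian h)

theorem jacobian_apply {φ : E3 → E3} {x : E3} (h : DifferentiableAt ℝ φ x) (i k : Fin 3) :
    jacobian φ x i k = fderiv ℝ (fun y => φ y i) x (EuclideanSpace.single k 1) := by
  have := ((EuclideanSpace.proj (𝕜 := ℝ) i : E3 →L[ℝ] ℝ).hasFDerivAt.comp x h.hasFDerivAt).fderiv
  have e : fderiv ℝ (fun y => φ y i) x = (EuclideanSpace.proj (𝕜 := ℝ) i : E3 →L[ℝ] ℝ).comp
    (fderiv ℝ φ x) := this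
  rw [e]
  rfl

/-- Adding a test field to a Sobolev function. -/
def H1.addTest {Ω : Set E3} (u : H1 Ω) {φ : E3 → E3} (hφ : φ ∈ fieldTest Ω) : H1 Ω where
  toFun x := u.toFun x + φ x
  grad x := u.grad x + jacobian φ x
  memLp_toFun := u.memLp_toFun.add (hφ.1.continuous.memLp_of_hasCompactSupport hφ.2.1)
  memLp_grad i k := by
    refine (u.memLp_grad i k).add ?_
    have h := memLp_vec_jacobian hφ 2 (volume.restrict Ω)
    refine h.mono ?_ (ae_of_all _ fun x => PiLp.norm_apply_le (vec (jacobian φ x)) (i, k))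
    exact ((EuclideanSpace.proj (𝕜 := ℝ) (i, k)).continuous.comp
      (continuous_vec_jacobian hφ)).aestronglyMeasurable
  weak_grad i k ψ h1 h2 h3 := by
    have hd : Continuous fun x => fderiv ℝ ψ x (EuclideanSpace.single k 1) :=
      (h1.continuous_fderiv (by simp)).clm_apply continuous_const
    have hdc : HasCompactSupport fun x => fderiv ℝ ψ x (EuclideanSpace.single k 1) :=
      h2.fderiv_apply ℝ _
    have hui : MemLp (fun x => u.toFun x i) 2 (volume.restrict Ω) :=
      u.memLp_toFun.mono ((EuclideanSpace.proj (𝕜 := ℝ) i).continuous.comp_aestronglyMeasurable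
        u.memLp_toFun.1) (ae_of_all _ fun x => PiLp.norm_apply_le (u.toFun x) i)
    have hφi : ContDiff ℝ 1 fun x => φ x i := contDiff_euclidean.1 (hφ.1.of_le (by simp)) i
    have hgi : Continuous fun x => jacobian φ x i k :=
      (EuclideanSpace.proj (𝕜 := ℝ) (i, k)).continuous.comp (continuous_vec_jacobian hφ)
    have i1 : Integrable (fun x => u.toFun x i * fderiv ℝ ψ x (EuclideanSpace.single k 1))
        (volume.restrict Ω) := hui.integrable_mul (q := 2) (hd.memLp_of_hasCompactSupport hdc)
    have i2 : Integrable (fun x => φ x i * fderiv ℝ ψ x (EuclideanSpace.single k 1))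
        (volume.restrict Ω) :=
      (hφi.continuous.mul hd).integrable_of_hasCompactSupport hdc.mul_left
    have i3 : Integrable (fun x => u.grad x i k * ψ x) (volume.restrict Ω) :=
      (u.memLp_grad i k).integrable_mul (q := 2) (h1.continuous.memLp_of_hasCompactSupport h2)
    have i4 : Integrable (fun x => jacobian φ x i k * ψ x) (volume.restrict Ω) :=
      (hgi.mul h1.continuous).integrable_of_hasCompactSupport h2.mul_left
    have hsupp : ∀ f g : E3 → ℝ, (∀ x, g x ≠ 0 → x ∈ tsupport ψ) →
        ∫ x in Ω, f x * g x = ∫ x, f x * g x := fun f g hg =>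
      setIntegral_eq_integral_of_forall_compl_eq_zero fun x hx => by
        by_contra hn
        exact hx (h3 (hg x (right_ne_zero_of_mul hn)))
    have key : ∫ x in Ω, φ x i * fderiv ℝ ψ x (EuclideanSpace.single k 1)
        = -∫ x in Ω, jacobian φ x i k * ψ x := by
      rw [hsupp _ _ fun x hx => tsupport_fderiv_apply_subset ℝ _ (subset_tsupport _ hx),
        hsupp _ _ fun x hx => subset_tsupport _ hx,
        integral_mul_fderiv_of_tsupport_subset isOpen_univ hφi.contDiffOn (h1.of_le (by simp))
          (Set.subset_univ _) h2]
      congr 2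
      ext x
      rw [jacobian_apply (hφ.1.differentiable (by simp) x)]
    simp only [PiLp.add_apply, Matrix.add_apply, add_mul]
    rw [integral_add i1 i2, integral_add i3 i4, u.weak_grad i k ψ h1 h2 h3, key, neg_add]

theorem sameBoundaryValues_addTest {Ω : Set E3} (u : H1 Ω) {φ : E3 → E3}
    (hφ : φ ∈ fieldTest Ω) : SameBoundaryValues (u.addTest hφ) u := by
  refine ⟨fun _ => φ, fun _ => hφ, ?_, ?_⟩
  · simp [H1.addTest]
  · have : ∀ x, (u.addTest hφ).grad x - u.grad x - (Matrix.of fun i k =>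
        fderiv ℝ φ x (EuclideanSpace.single k 1) i) = 0 := fun x => by
      simp only [H1.addTest, jacobian]
      abel
    have h0 : frobSq 0 = 0 := by simp [frobSq]
    simp only [this, h0, ENNReal.ofReal_zero, lintegral_zero, tendsto_const_nhds]

/-! ### Cut-off functions and gradient correctors. -/

theorem exists_smooth_cutoff {Ω K : Set E3} (hΩ : IsOpen Ω) (hK : IsCompact K) (hKΩ : K ⊆ Ω) :
    ∃ η : E3 → ℝ, ContDiff ℝ ∞ η ∧ HasCompactSupport η ∧ tsupport η ⊆ Ω ∧
      (∀ x ∈ K, η x = 1) ∧ ∀ x, 0 ≤ η x ∧ η x ≤ 1 := by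
  obtain ⟨L, hL, hKL, hLΩ⟩ := exists_compact_between hK hΩ hKΩ
  obtain ⟨f, hf0, hf1, hf⟩ := exists_contMDiffMap_zero_one_of_isClosed (n := ⊤)
    (modelWithCornersSelf ℝ E3) (isOpen_interior (s := L)).isClosed_compl hK.isClosed
    (Set.disjoint_left.2 fun x hx hxK => hx (hKL hxK))
  have hsupp : Function.support f ⊆ L := fun x hx => by
    by_contra hn
    exact hx (hf0 fun h => hn (interior_subset h))
  have hts : tsupport f ⊆ L := closure_minimal hsupp hL.isClosed
  exact ⟨f, contMDiff_iff_contDiff.1 f.contMDiff, hL.of_isClosed_subset (isClosed_tsupport _) hts,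
    hts.trans hLΩ, fun x hx => hf1 hx, fun x => hf x⟩

theorem exists_compact_exhaustion {Ω : Set E3} (hΩ : IsOpen Ω) :
    ∃ K : ℕ → Set E3, (∀ n, IsCompact (K n) ∧ K n ⊆ Ω) ∧ ∀ x ∈ Ω, ∀ᶠ n in atTop, x ∈ K n := by
  obtain ⟨F, hFc, hFΩ, hFU, hFm⟩ := hΩ.exists_iUnion_isClosed
  refine ⟨fun n => F n ∩ Metric.closedBall 0 n, fun n =>
    ⟨(isCompact_closedBall 0 _).inter_left (hFc n), Set.inter_subset_left.trans (hFΩ n)⟩, ?_⟩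
  intro x hx
  rw [← hFU] at hx
  obtain ⟨n, hn⟩ := Set.mem_iUnion.1 hx
  filter_upwards [eventually_ge_atTop n, eventually_ge_atTop ⌈‖x‖⌉₊] with k hk hk'
  refine ⟨hFm hk hn, ?_⟩
  rw [mem_closedBall_zero_iff]
  exact (Nat.le_ceil _).trans (by exact_mod_cast hk')

/-- Cut-offs equal to one on an exhaustion by compact sets converge pointwise, dominated by `‖d‖`.
This is what allows correctors with compact support even though `d` need not vanish near `∂Ω`. -/
theorem exists_cutoff_eLpNorm_le {Ω : Set E3} (hΩ : IsOpen Ω) {d : E3 → E3}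
    (hd : MemLp d 2 (volume.restrict Ω)) {ε : ℝ≥0∞} (hε : 0 < ε) :
    ∃ η : E3 → ℝ, ContDiff ℝ ∞ η ∧ HasCompactSupport η ∧ tsupport η ⊆ Ω ∧
      eLpNorm (fun x => η x • d x - d x) 2 (volume.restrict Ω) ≤ ε := by
  obtain ⟨K, hK, hKx⟩ := exists_compact_exhaustion hΩ
  choose η h1 h2 h3 h4 h5 using fun n => exists_smooth_cutoff hΩ (hK n).1 (hK n).2
  have ht : Tendsto (fun n => eLpNorm (fun x => η n x • d x - d x) 2 (volume.restrict Ω)) atTop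
      (𝓝 0) := by
    refine tendsto_eLpNorm_two_zero (g := fun x => ‖d x‖) (fun n => ?_) hd.norm (fun n => ?_) ?_
    · exact ((h1 n).continuous.aestronglyMeasurable.smul hd.1).sub hd.1
    · refine ae_of_all _ fun x => ?_
      have e : η n x • d x - d x = (η n x - 1) • d x := by rw [sub_smul, one_smul]
      rw [e, norm_smul, Real.norm_eq_abs]
      refine mul_le_of_le_one_left (norm_nonneg _) (abs_le.2 ⟨?_, ?_⟩) <;> linarith [h5 n x]
    · refine (ae_restrict_iff' hΩ.measurableSet).2 (ae_of_all _ fun x hx => ?_)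
      refine tendsto_const_nhds.congr' ?_
      filter_upwards [hKx x hx] with n hn
      rw [h4 n x hn, one_smul, sub_self]
  obtain ⟨n, hn⟩ := (ENNReal.tendsto_nhds_zero.1 ht ε hε).exists
  exact ⟨η n, h1 n, h2 n, h3 n, hn⟩

theorem jacobian_smul {c : E3 → ℝ} {c' : E3 →L[ℝ] ℝ} {e : E3 → E3} {x : E3}
    (hc : HasFDerivAt c c' x) (he : DifferentiableAt ℝ e x) :
    jacobian (fun y => c y • e y) x = c x • jacobian e x
      + Matrix.of fun i k => e x i * c' (EuclideanSpace.single k 1) := by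
  have h : fderiv ℝ (fun y => c y • e y) x = _ := (hc.smul he.hasFDerivAt).fderiv
  ext i k
  simp only [jacobian, h, Matrix.of_apply, Matrix.add_apply, Matrix.smul_apply]
  simp [mul_comm]

/-- The corrector fields of a simple laminate: the oscillating field `± d ⊗ m` is close to the
gradients of test fields. -/
theorem exists_laminate_corrector {Ω : Set E3} (hΩ : IsOpen Ω) {m : E3} (hm : ‖m‖ = 1)
    {d : E3 → E3} (hd : ContDiffOn ℝ ∞ d Ω) (hd2 : MemLp d 2 (volume.restrict Ω)) :
    ∃ φ : ℕ → E3 → E3, (∀ n, φ n ∈ fieldTest Ω) ∧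
      Tendsto (fun n : ℕ => eLpNorm (fun x => vec (jacobian (φ n) x
        - squareWave ((n + 1 : ℝ) * inner ℝ m x) • tensor (d x) m)) 2 (volume.restrict Ω))
        atTop (𝓝 0) := by
  refine exists_seq_tendsto_zero (T := fieldTest Ω)
    (err := fun n φ => eLpNorm (fun x => vec (jacobian φ x
      - squareWave ((n + 1 : ℝ) * inner ℝ m x) • tensor (d x) m)) 2 (volume.restrict Ω)) ⟨0, zero_mem_fieldTest Ω⟩ (fun ε hε => ?_)
  set μ := volume.restrict Ω with hμ
  -- One third each for cutting off `d`, for the derivative of the amplitude, and for smoothing the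
  -- wave. The choices are made in this order: the cut-off, then a large `n`, then the smoothing
  -- parameter, which may depend on `n`.
  set δ : ℝ≥0∞ := ε / 3 with hδ
  have hδ0 : 0 < δ := ENNReal.div_pos hε.ne' (by norm_num)
  obtain ⟨η, h1, h2, h3, h4⟩ := exists_cutoff_eLpNorm_le hΩ hd2 hδ0
  set e : E3 → E3 := fun x => η x • d x with he_def
  have hes : tsupport e ⊆ tsupport η := tsupport_smul_subset_left η d
  have he : e ∈ fieldTest Ω := by
    refine ⟨contDiff_of_contDiffAt_tsupport fun x hx => ?_,
      h2.of_isClosed_subset (isClosed_tsupport _) hes, hes.trans h3⟩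
    exact h1.contDiffAt.smul (hd.contDiffAt (hΩ.mem_nhds (h3 (hes hx))))
  have heL : MemLp e 2 μ := he.1.continuous.memLp_of_hasCompactSupport he.2.1
  have hJL : MemLp (fun x => vec (jacobian e x)) 2 μ := memLp_vec_jacobian he 2 μ
  -- The amplitude `e` is now fixed, and its derivative enters multiplied by a triangle wave of
  -- height at most `π / (2(n + 1))`.
  have hB : Tendsto (fun n : ℕ => eLpNorm
      (fun x => (Real.pi / 2 * (1 / ((n : ℝ) + 1))) • ‖vec (jacobian e x)‖) 2 μ) atTop (𝓝 0) := by
    have hc : Tendsto (fun n : ℕ => Real.pi / 2 * (1 / ((n : ℝ) + 1))) atTop (𝓝 0) := by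
      simpa using tendsto_one_div_add_atTop_nhds_zero_nat.const_mul (Real.pi / 2)
    have hce : Tendsto (fun n : ℕ => ‖Real.pi / 2 * (1 / ((n : ℝ) + 1))‖ₑ) atTop (𝓝 0) := by
      have h := (continuous_enorm.tendsto (0 : ℝ)).comp hc
      rw [enorm_zero] at h
      exact h
    have := ENNReal.Tendsto.mul_const (b := eLpNorm (fun x => ‖vec (jacobian e x)‖) 2 μ) hce
      (Or.inr hJL.norm.2.ne)
    rw [zero_mul] at this
    refine this.congr fun n => ?_
    exact (eLpNorm_const_smul (Real.pi / 2 * (1 / ((n : ℝ) + 1)))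
      (fun x => ‖vec (jacobian e x)‖) 2 μ).symm
  filter_upwards [ENNReal.tendsto_nhds_zero.1 hB δ hδ0] with n hn
  set N : ℝ := (n : ℝ) + 1 with hN
  have hN0 : 0 < N := by positivity
  set l : E3 →L[ℝ] ℝ := innerSL ℝ m with hl
  have hlx : ∀ x, l x = inner ℝ m x := fun x => rfl
  have hl0 : l ≠ 0 := fun h => by
    have h' := congrArg (fun f : E3 →L[ℝ] ℝ => f m) h
    simp only [hlx, real_inner_self_eq_norm_sq, hm] at h'
    norm_num at h'
  -- Strictly between `0` and `1`, which keeps the waves smooth, and tending to `1`; the shift by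
  -- `2` makes the value at `k = 0` positive.
  set a : ℕ → ℝ := fun k => 1 - 1 / ((k : ℝ) + 2) with ha_def
  have ha0 : ∀ k, 0 < a k := fun k => by
    have : 1 / ((k : ℝ) + 2) < 1 := by rw [div_lt_one (by positivity)]; linarith [k.cast_nonneg (α := ℝ)]
    simp only [ha_def]; linarith
  have ha1 : ∀ k, a k < 1 := fun k => by
    have : 0 < 1 / ((k : ℝ) + 2) := by positivity
    simp only [ha_def]; linarith
  have ha : Tendsto a atTop (𝓝 1) := by
    have h := (tendsto_one_div_add_atTop_nhds_zero_nat (𝕜 := ℝ)).comp (tendsto_add_atTop_nat 1)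
    have h' := h.const_sub 1
    rw [sub_zero] at h'
    refine h'.congr fun k => ?_
    simp only [ha_def, Function.comp_apply]
    push_cast
    ring
  have hsw : Measurable fun x : E3 => squareWave (N * l x) :=
    measurable_squareWave.comp (by fun_prop)
  have hsm : ∀ k, Continuous fun x : E3 => smoothWave (a k) (N * l x) := fun k =>
    (continuous_smoothWave (ha0 k) (ha1 k)).comp (by fun_prop)
  have hA : Tendsto (fun k => eLpNorm
      (fun x => (smoothWave (a k) (N * l x) - squareWave (N * l x)) • e x) 2 μ) atTop (𝓝 0) := by
    refine tendsto_eLpNorm_two_zero (g := fun x => 2 * ‖e x‖) (fun k => ?_)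
      (heL.norm.const_mul 2) (fun k => ?_) ?_
    · exact ((hsm k).aestronglyMeasurable.sub hsw.aestronglyMeasurable).smul heL.1
    · refine ae_of_all _ fun x => ?_
      rw [norm_smul]
      refine mul_le_mul_of_nonneg_right ?_ (norm_nonneg _)
      have h1 := abs_smoothWave_le (ha0 k) (ha1 k) (N * l x)
      have h2 := abs_squareWave (N * l x)
      refine (norm_sub_le _ _).trans ?_
      rw [Real.norm_eq_abs, Real.norm_eq_abs]
      linarith
    · filter_upwards [ae_restrict_of_ae (ae_sin_ne_zero volume hl0 hN0.ne')] with x hx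
      have h := ((tendsto_smoothWave ha hx).sub_const (squareWave (N * l x))).smul_const (e x)
      simpa using h
  obtain ⟨k, hk⟩ := (ENNReal.tendsto_nhds_zero.1 hA δ hδ0).exists
  -- The factor `1 / N` cancels the inner derivative: the gradient of `c` is the smoothed wave times
  -- `m`, whereas `c` itself is `O(1/N)`.
  set c : E3 → ℝ := fun x => 1 / N * triangleWave (a k) (N * l x) with hc_def
  have hcd : ∀ x, HasFDerivAt c (smoothWave (a k) (N * l x) • l) x := by
    intro x
    have h := ((hasDerivAt_triangleWave (ha0 k) (ha1 k) (N * l x)).comp_hasFDerivAt x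
      (l.hasFDerivAt.const_mul N)).const_mul (1 / N)
    refine h.congr_fderiv ?_
    ext v
    simp only [smul_apply, smul_eq_mul]
    field_simp
  have hcC : ContDiff ℝ ∞ c := by
    refine contDiff_const.mul ((contDiff_triangleWave (ha0 k) (ha1 k)).comp ?_)
    exact contDiff_const.mul l.contDiff
  have hφs : tsupport (fun x => c x • e x) ⊆ tsupport e := tsupport_smul_subset_right c e
  have hφ : (fun x => c x • e x) ∈ fieldTest Ω :=
    ⟨hcC.smul he.1, he.2.1.of_isClosed_subset (isClosed_tsupport _) hφs, hφs.trans he.2.2⟩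
  refine ⟨_, hφ, ?_⟩
  have hpt : ∀ x, ‖vec (jacobian (fun x => c x • e x) x - squareWave (N * l x) • tensor (d x) m)‖
      ≤ ‖(smoothWave (a k) (N * l x) - squareWave (N * l x)) • e x‖
        + (Real.pi / 2 * (1 / N)) • ‖vec (jacobian e x)‖ + ‖η x • d x - d x‖ := by
    intro x
    -- The three summands are the smoothing error, the derivative of the amplitude, and the cut-off
    -- error.
    have hj : jacobian (fun x => c x • e x) x - squareWave (N * l x) • tensor (d x) m
        = tensor ((smoothWave (a k) (N * l x) - squareWave (N * l x)) • e x) m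
          + c x • jacobian e x + squareWave (N * l x) • tensor (e x - d x) m := by
      rw [jacobian_smul (hcd x) (he.1.differentiable (by simp) x)]
      ext i j
      have : l (EuclideanSpace.single j 1) = m j := by
        rw [hlx, EuclideanSpace.inner_single_right]; simp
      simp only [Matrix.sub_apply, Matrix.add_apply, Matrix.smul_apply, Matrix.of_apply, tensor,
        smul_apply, PiLp.smul_apply, PiLp.sub_apply, smul_eq_mul, this]
      ring
    rw [hj, map_add, map_add, map_smul, map_smul]
    refine (norm_add₃_le).trans ?_
    rw [norm_vec_tensor, norm_smul (c x), norm_smul (squareWave _), norm_vec_tensor, hm, mul_one,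
      mul_one, Real.norm_eq_abs (squareWave _), abs_squareWave, one_mul]
    have hcx : ‖c x‖ ≤ Real.pi / 2 * (1 / N) := by
      simp only [hc_def, norm_mul, Real.norm_eq_abs]
      rw [abs_of_pos (by positivity : (0 : ℝ) < 1 / N), mul_comm]
      exact mul_le_mul_of_nonneg_right (abs_triangleWave_le _ _) (by positivity)
    gcongr
    rw [smul_eq_mul]
    gcongr
  refine (eLpNorm_mono_real hpt).trans ?_
  have m1 : AEStronglyMeasurable
      (fun x => ‖(smoothWave (a k) (N * l x) - squareWave (N * l x)) • e x‖) μ :=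
    (((hsm k).aestronglyMeasurable.sub hsw.aestronglyMeasurable).smul heL.1).norm
  have m2 : AEStronglyMeasurable
      (fun x => (Real.pi / 2 * (1 / N)) • ‖vec (jacobian e x)‖) μ :=
    hJL.1.norm.const_mul (Real.pi / 2 * (1 / N))
  have m3 : AEStronglyMeasurable (fun x => ‖η x • d x - d x‖) μ := (heL.1.sub hd2.1).norm
  refine (eLpNorm_add_le (m1.add m2) m3 (by norm_num)).trans ?_
  refine (add_le_add_left (eLpNorm_add_le m1 m2 (by norm_num)) _).trans ?_
  rw [eLpNorm_norm, eLpNorm_norm, ← ENNReal.add_thirds ε]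
  exact add_le_add (add_le_add hk hn) h4

/-! ### Measurability of the integrands, and convexity of the relaxed energy. -/

theorem aestronglyMeasurable_vec {α : Type*} [MeasurableSpace α] {μ : Measure α} {F : α → Mat3}
    (h : ∀ i k, AEStronglyMeasurable (fun x => F x i k) μ) :
    AEStronglyMeasurable (fun x => vec (F x)) μ :=
  (PiLp.continuous_toLp 2 _).comp_aestronglyMeasurable
    (aemeasurable_pi_lambda (fun x (p : Fin 3 × Fin 3) => F x p.1 p.2)
      fun p => (h p.1 p.2).aemeasurable).aestronglyMeasurable

theorem aestronglyMeasurable_symPart {α : Type*} [MeasurableSpace α] {μ : Measure α}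
    {F : α → Mat3} (h : ∀ i k, AEStronglyMeasurable (fun x => F x i k) μ) (i k : Fin 3) :
    AEStronglyMeasurable (fun x => symPart (F x) i k) μ :=
  ((h i k).add (h k i)).const_mul (1 / 2)

theorem aestronglyMeasurable_tensor {α : Type*} [MeasurableSpace α] {μ : Measure α}
    {v : α → E3} (h : AEStronglyMeasurable v μ) (m : E3) (i k : Fin 3) :
    AEStronglyMeasurable (fun x => tensor (v x) m i k) μ :=
  ((EuclideanSpace.proj (𝕜 := ℝ) i).continuous.comp_aestronglyMeasurable h).mul_const (m k)

theorem H1.aestronglyMeasurable_grad {Ω A : Set E3} (u : H1 Ω) (hA : A ⊆ Ω) (i k : Fin 3) :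
    AEStronglyMeasurable (fun x => u.grad x i k) (volume.restrict A) :=
  (u.memLp_grad i k).1.mono_measure (Measure.restrict_mono hA le_rfl)

theorem elasticEnergy_eq {Ω A : Set E3} (u : H1 Ω) (β : E3 → Mat3) :
    elasticEnergy A u β = ∫⁻ x in A, ENNReal.ofReal (‖vec (symPart (u.grad x - β x))‖ ^ 2) := by
  simp_rw [elasticEnergy, norm_vec_sq]

namespace SlipPlane

theorem lamCurlNorm_eq (S : SlipPlane) {A : Set E3} (hA : IsOpen A) {β : E3 → Mat3}
    {v : E3 → E3} (h : ∀ x ∈ A, S.slip β x = v x) :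
    S.lamCurlNorm A β = ∑ i, ∫⁻ t, variation (S.slice A t) fun y => S.coeff (v (S.point t y)) i := by
  refine Finset.sum_congr rfl fun i _ => lintegral_congr fun t => ?_
  rw [planarVariation_scalar]
  refine variation_congr ((ae_restrict_iff' (S.isOpen_slice hA t).measurableSet).2
    (ae_of_all _ fun y hy => ?_))
  simp only [h (S.point t y) hy]

theorem lamHardening_eq (S : SlipPlane) {A : Set E3} (hA : IsOpen A) {β : E3 → Mat3}
    {v : E3 → E3} (h : ∀ x ∈ A, S.slip β x = v x) :
    S.lamHardening A β = ∑ i, ∫⁻ x in A, ENNReal.ofReal |S.coeff (v x) i| :=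
  Finset.sum_congr rfl fun i _ => setLIntegral_congr_fun hA.measurableSet fun x hx => by
    simp only [h x hx]

theorem aestronglyMeasurable_coeff (S : SlipPlane) {μ : Measure E3} {v : E3 → E3}
    (hv : AEStronglyMeasurable v μ) (i : Fin 2) :
    AEStronglyMeasurable (fun x => S.coeff (v x) i) μ :=
  (S.contDiff_coeff i (n := 0)).continuous.comp_aestronglyMeasurable hv

end SlipPlane

theorem norm_convex_sq {F : Type*} [SeminormedAddCommGroup F] [NormedSpace ℝ F] (X Y : F)
    {a b : ℝ} (ha : 0 ≤ a) (hb : 0 ≤ b) (hab : a + b = 1) :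
    ‖a • X + b • Y‖ ^ 2 ≤ a * ‖X‖ ^ 2 + b * ‖Y‖ ^ 2 := by
  have h : ‖a • X + b • Y‖ ≤ a * ‖X‖ + b * ‖Y‖ := by
    refine (norm_add_le _ _).trans (le_of_eq ?_)
    rw [norm_smul, norm_smul, Real.norm_of_nonneg ha, Real.norm_of_nonneg hb]
  have h2 := pow_le_pow_left₀ (norm_nonneg _) h 2
  have hb' : b = 1 - a := by linarith
  subst hb'
  nlinarith [mul_nonneg (mul_nonneg ha hb) (sq_nonneg (‖X‖ - ‖Y‖))]

/-- Without measurability the lower integral is only superadditive, which is the wrong direction;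
measurability of one summand restores additivity. -/
theorem lintegral_le_convex {α : Type*} [MeasurableSpace α] {μ : Measure α} {f g h : α → ℝ≥0∞}
    (hf : AEMeasurable f μ) {a b : ℝ≥0∞} (ha : a ≠ ⊤) (hb : b ≠ ⊤)
    (hle : ∀ᵐ x ∂μ, h x ≤ a * f x + b * g x) :
    ∫⁻ x, h x ∂μ ≤ a * ∫⁻ x, f x ∂μ + b * ∫⁻ x, g x ∂μ := by
  refine (lintegral_mono_ae hle).trans (le_of_eq ?_)
  rw [lintegral_add_left' (hf.const_mul a), lintegral_const_mul' _ _ ha,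
    lintegral_const_mul' _ _ hb]

section Single

variable {M : ℕ} {S : Fin M → SlipPlane}

/-- The relaxed energy of a slip field on a single slip plane. -/
theorem relEnergy_tensor
    (hS : ∀ j k, j ≠ k → (S j).normal ≠ (S k).normal ∧ (S j).normal ≠ -(S k).normal)
    (σ τ : ℝ≥0) {Ω A : Set E3} (hA : IsOpen A) (u : H1 Ω) (j : Fin M) {r : E3 → E3}
    (hr : ∀ x ∈ A, inner ℝ (S j).normal (r x) = 0) :
    relEnergy S σ τ A u (fun x => tensor (r x) (S j).normal)
      = (∫⁻ x in A, ENNReal.ofReal (‖vec (symPart (u.grad x - tensor (r x) (S j).normal))‖ ^ 2))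
        + (σ : ℝ≥0∞) * (∑ i, ∫⁻ t, variation ((S j).slice A t)
            (fun y => (S j).coeff (r ((S j).point t y)) i))
        + (τ : ℝ≥0∞) * ∑ i, ∫⁻ x in A, ENNReal.ofReal |(S j).coeff (r x) i| := by
  set β : E3 → Mat3 := fun x => tensor (r x) (S j).normal with hβ
  have hself : ∀ x ∈ A, (S j).slip β x = r x := fun x hx => (S j).slip_eq (hr x hx) rfl
  have hne : ∀ k, k ≠ j → ∀ x ∈ A, (S k).slip β x = (fun _ => 0) x := fun k hk x _ =>
    slip_tensor_of_ne hS hk.symm (rfl : β x = tensor (r x) (S j).normal)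
  have hR : RSC S A β := (ae_restrict_iff' hA.measurableSet).2
    (ae_of_all _ fun x hx => ⟨j, r x, hr x hx, rfl⟩)
  rw [relEnergy, if_pos hR, elasticEnergy_eq]
  rw [Finset.sum_eq_single j, Finset.sum_eq_single j, (S j).lamCurlNorm_eq hA hself,
    (S j).lamHardening_eq hA hself]
  · intro k _ hk
    rw [(S k).lamHardening_eq hA (hne k hk)]
    simp [SlipPlane.coeff_zero]
  · simp
  · intro k _ hk
    rw [(S k).lamCurlNorm_eq hA (hne k hk)]
    simp [SlipPlane.coeff_zero, variation_zero]
  · simp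

theorem convexOn_relEnergy
    (hS : ∀ j k, j ≠ k → (S j).normal ≠ (S k).normal ∧ (S j).normal ≠ -(S k).normal)
    (σ τ : ℝ≥0) {Ω A : Set E3} (hA : IsOpen A) (hAΩ : A ⊆ Ω) (u : H1 Ω) (j : Fin M) :
    ConvexOn ℝ≥0 (slipFields A (S j).normal)
      (fun r => relEnergy S σ τ A u (fun x => tensor (r x) (S j).normal)) := by
  have hconv : Convex ℝ≥0 (slipFields A (S j).normal) := by
    intro r hr q hq a b _ _ _
    refine ⟨(hr.1.const_smul a).add (hq.1.const_smul b), fun x hx => ?_⟩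
    have e : (a • r + b • q) x = (a : ℝ) • r x + (b : ℝ) • q x := rfl
    rw [e, inner_add_right, inner_smul_right, inner_smul_right, hr.2 x hx, hq.2 x hx]
    simp
  -- Strictly positive weights suffice, and `variation_add_le` is available only for these.
  refine convexOn_iff_forall_pos.2 ⟨hconv, ?_⟩
  intro r hr q hq a b ha hb hab
  have hmem := hconv hr hq ha.le hb.le hab
  have e : ∀ x, (a • r + b • q) x = (a : ℝ) • r x + (b : ℝ) • q x := fun _ => rfl
  have hab' : (a : ℝ) + b = 1 := by exact_mod_cast hab
  rw [relEnergy_tensor hS σ τ hA u j hmem.2, relEnergy_tensor hS σ τ hA u j hr.2,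
    relEnergy_tensor hS σ τ hA u j hq.2]
  simp only [e]
  set m := (S j).normal with hm
  have hR : ∀ c : ℝ≥0, ENNReal.ofReal (c : ℝ) = (c : ℝ≥0∞) := fun c => ENNReal.ofReal_coe_nnreal
  have T1 : ∫⁻ x in A, ENNReal.ofReal
        (‖vec (symPart (u.grad x - tensor ((a : ℝ) • r x + (b : ℝ) • q x) m))‖ ^ 2)
      ≤ (a : ℝ≥0∞) * (∫⁻ x in A, ENNReal.ofReal (‖vec (symPart (u.grad x - tensor (r x) m))‖ ^ 2))
        + (b : ℝ≥0∞) * ∫⁻ x in A,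
          ENNReal.ofReal (‖vec (symPart (u.grad x - tensor (q x) m))‖ ^ 2) := by
    refine lintegral_le_convex ?_ ENNReal.coe_ne_top ENNReal.coe_ne_top (ae_of_all _ fun x => ?_)
    · refine AEMeasurable.ennreal_ofReal (AEMeasurable.pow_const ?_ 2)
      exact (aestronglyMeasurable_vec (aestronglyMeasurable_symPart fun i k =>
        (u.aestronglyMeasurable_grad hAΩ i k).sub
          (aestronglyMeasurable_tensor hr.1 m i k))).norm.aemeasurable
    · have e1 : vec (symPart (u.grad x - tensor ((a : ℝ) • r x + (b : ℝ) • q x) m))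
          = (a : ℝ) • vec (symPart (u.grad x - tensor (r x) m))
            + (b : ℝ) • vec (symPart (u.grad x - tensor (q x) m)) := by
        simp only [← map_smul, ← map_add, ← symPart_smul, ← symPart_add, tensor_add_left,
          tensor_smul_left]
        congr 2
        -- The integrand is affine in the slip field, so the displacement gradient has to be split
        -- with `a + b = 1`.
        have : u.grad x = (a : ℝ) • u.grad x + (b : ℝ) • u.grad x := by
          rw [← add_smul, hab', one_smul]
        conv_lhs => rw [this]
        simp only [smul_sub]
        abel
      rw [e1, ← hR a, ← hR b, ← ENNReal.ofReal_mul a.coe_nonneg, ← ENNReal.ofReal_mul b.coe_nonneg,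
        ← ENNReal.ofReal_add (by positivity) (by positivity)]
      exact ENNReal.ofReal_le_ofReal (norm_convex_sq _ _ a.coe_nonneg b.coe_nonneg hab')
  have T2 : ∀ i, ∫⁻ t, variation ((S j).slice A t)
        (fun y => (S j).coeff ((a : ℝ) • r ((S j).point t y) + (b : ℝ) • q ((S j).point t y)) i)
      ≤ (a : ℝ≥0∞) * (∫⁻ t, variation ((S j).slice A t)
          (fun y => (S j).coeff (r ((S j).point t y)) i))
        + (b : ℝ≥0∞) * ∫⁻ t, variation ((S j).slice A t)
          (fun y => (S j).coeff (q ((S j).point t y)) i) := by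
    intro i
    refine lintegral_le_convex ?_ ENNReal.coe_ne_top ENNReal.coe_ne_top (ae_of_all _ fun t => ?_)
    · exact aemeasurable_variation_slice (S j) hA (c := fun x => (S j).coeff (r x) i)
        ((S j).aestronglyMeasurable_coeff hr.1 i)
    · simp only [SlipPlane.coeff_add, SlipPlane.coeff_smul]
      rw [← hR a, ← hR b]
      exact variation_add_le _ _ _ ha hb
  have T3 : ∀ i, ∫⁻ x in A, ENNReal.ofReal |(S j).coeff ((a : ℝ) • r x + (b : ℝ) • q x) i|
      ≤ (a : ℝ≥0∞) * (∫⁻ x in A, ENNReal.ofReal |(S j).coeff (r x) i|)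
        + (b : ℝ≥0∞) * ∫⁻ x in A, ENNReal.ofReal |(S j).coeff (q x) i| := by
    intro i
    refine lintegral_le_convex ?_ ENNReal.coe_ne_top ENNReal.coe_ne_top (ae_of_all _ fun x => ?_)
    · exact ((S j).aestronglyMeasurable_coeff hr.1 i).norm.aemeasurable.ennreal_ofReal
    · simp only [SlipPlane.coeff_add, SlipPlane.coeff_smul]
      rw [← hR a, ← hR b, ← ENNReal.ofReal_mul a.coe_nonneg, ← ENNReal.ofReal_mul b.coe_nonneg,
        ← ENNReal.ofReal_add (by positivity) (by positivity)]
      refine ENNReal.ofReal_le_ofReal ((abs_add_le _ _).trans (le_of_eq ?_))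
      rw [abs_mul, abs_mul, abs_of_nonneg a.coe_nonneg, abs_of_nonneg b.coe_nonneg]
  refine (add_le_add (add_le_add T1 (mul_le_mul_right (Finset.sum_le_sum fun i _ => T2 i) _))
    (mul_le_mul_right (Finset.sum_le_sum fun i _ => T3 i) _)).trans (le_of_eq ?_)
  simp only [ENNReal.smul_def, smul_eq_mul, Finset.sum_add_distrib, ← Finset.mul_sum]
  ring

end Single

/-! ### Strains given by Burgers components, and their laminates. -/

namespace SlipPlane

variable (S : SlipPlane)

/-- The slip vector with given Burgers components. -/
def slipVec (c : Fin 2 → ℝ) : E3 := c 0 • S.burgers 0 + c 1 • S.burgers 1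

theorem inner_normal_slipVec (c : Fin 2 → ℝ) : inner ℝ S.normal (S.slipVec c) = 0 := by
  simp [slipVec, inner_add_right, inner_smul_right, inner_normal_burgers]

theorem coeff_slipVec (c : Fin 2 → ℝ) (i : Fin 2) : S.coeff (S.slipVec c) i = c i := by
  have hd := S.det_burgers_ne_zero
  rw [slipVec, coeff_add, coeff_smul, coeff_smul]
  have h0 : ∀ v, S.det v v = 0 := fun v => by unfold det; ring
  fin_cases i <;> simp [coeff, h0, hd]

theorem norm_slipVec_le (c : Fin 2 → ℝ) : ‖S.slipVec c‖ ≤ ∑ i, |c i| := by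
  rw [Fin.sum_univ_two]
  refine (norm_add_le _ _).trans (le_of_eq ?_)
  rw [norm_smul, norm_smul, S.norm_burgers, S.norm_burgers, mul_one, mul_one]
  rfl

end SlipPlane

variable {M : ℕ}

/-- The plastic strain with given Burgers components. -/
def strain (S : Fin M → SlipPlane) (c : Fin M → Fin 2 → E3 → ℝ) (x : E3) : Mat3 :=
  ∑ j, tensor ((S j).slipVec fun i => c j i x) (S j).normal

/-- At most one slip plane is active at each point. -/
def SingleSlip (A : Set E3) (c : Fin M → Fin 2 → E3 → ℝ) : Prop :=
  ∀ x ∈ A, ∀ j k, j ≠ k → (∀ i, c j i x = 0) ∨ ∀ i, c k i x = 0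

theorem SingleSlip.slipVec {A : Set E3} {c : Fin M → Fin 2 → E3 → ℝ} (hc : SingleSlip A c)
    (S : Fin M → SlipPlane) {x : E3} (hx : x ∈ A) (j k : Fin M) (hjk : j ≠ k) :
    ((S j).slipVec fun i => c j i x) = 0 ∨ ((S k).slipVec fun i => c k i x) = 0 := by
  rcases hc x hx j k hjk with h | h
  · left; simp [SlipPlane.slipVec, h]
  · right; simp [SlipPlane.slipVec, h]

theorem SingleSlip.exists_strain_eq (hM : 0 < M) {A : Set E3} {c : Fin M → Fin 2 → E3 → ℝ}
    (hc : SingleSlip A c) (S : Fin M → SlipPlane) {x : E3} (hx : x ∈ A) :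
    ∃ j, strain S c x = tensor ((S j).slipVec fun i => c j i x) (S j).normal := by
  by_cases hex : ∃ k, ((S k).slipVec fun i => c k i x) ≠ 0
  · obtain ⟨k, hk⟩ := hex
    refine ⟨k, Finset.sum_eq_single k (fun l _ hl => ?_) (by simp)⟩
    rw [(hc.slipVec S hx l k hl).resolve_right hk, tensor_zero_left]
  · push Not at hex
    -- If no plane is active, the strain is zero and any plane will do.
    exact ⟨⟨0, hM⟩, by simp [strain, hex, tensor_zero_left]⟩

theorem slip_strain {S : Fin M → SlipPlane}
    (hS : ∀ j k, j ≠ k → (S j).normal ≠ (S k).normal ∧ (S j).normal ≠ -(S k).normal)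
    {A : Set E3} {c : Fin M → Fin 2 → E3 → ℝ} (hc : SingleSlip A c) {β : E3 → Mat3} {x : E3}
    (hx : x ∈ A) (hβ : β x = strain S c x) (j : Fin M) :
    (S j).slip β x = (S j).slipVec fun i => c j i x :=
  slip_sum_tensor (v := fun j => (S j).slipVec fun i => c j i x) hS
    (fun j => (S j).inner_normal_slipVec _) (hc.slipVec S hx) hβ j

/-- The total variation of a Burgers component in the slices, integrated. -/
def sliceVariation (S : SlipPlane) (A : Set E3) (f : E3 → ℝ) : ℝ≥0∞ :=
  ∫⁻ t, variation (S.slice A t) fun y => f (S.point t y)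

/-- With at most one active plane per point, the slip on every plane is recovered from the strain
itself, so the energy becomes an expression in the scalar components alone. -/
theorem relEnergy_strain (hM : 0 < M) {S : Fin M → SlipPlane}
    (hS : ∀ j k, j ≠ k → (S j).normal ≠ (S k).normal ∧ (S j).normal ≠ -(S k).normal)
    (σ τ : ℝ≥0) {Ω A : Set E3} (hA : IsOpen A) (u : H1 Ω) {c : Fin M → Fin 2 → E3 → ℝ}
    (hc : SingleSlip A c) {β : E3 → Mat3} (hβ : ∀ x ∈ A, β x = strain S c x) :
    relEnergy S σ τ A u β
      = (∫⁻ x in A, ENNReal.ofReal (‖vec (symPart (u.grad x - strain S c x))‖ ^ 2))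
        + (σ : ℝ≥0∞) * (∑ j, ∑ i, sliceVariation (S j) A (c j i))
        + (τ : ℝ≥0∞) * ∑ j, ∑ i, ∫⁻ x in A, ENNReal.ofReal |c j i x| := by
  have hR : RSC S A β := (ae_restrict_iff' hA.measurableSet).2 (ae_of_all _ fun x hx => by
    obtain ⟨j, hj⟩ := hc.exists_strain_eq hM S hx
    exact ⟨j, _, (S j).inner_normal_slipVec _, (hβ x hx).trans hj⟩)
  have hsl := fun j x hx => slip_strain hS hc hx (hβ x hx) j
  rw [relEnergy, if_pos hR, elasticEnergy_eq]
  congr 2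
  · exact setLIntegral_congr_fun hA.measurableSet fun x hx => by simp only [hβ x hx]
  · congr 1
    refine Finset.sum_congr rfl fun j _ => ?_
    rw [(S j).lamCurlNorm_eq hA (hsl j)]
    simp only [SlipPlane.coeff_slipVec]
    rfl
  · refine Finset.sum_congr rfl fun j _ => ?_
    rw [(S j).lamHardening_eq hA (hsl j)]
    simp only [SlipPlane.coeff_slipVec]

/-- The signs of the two Burgers components in the laminate. -/
def lamSign : Fin 2 → ℝ := ![1, -1]

theorem lamSign_eq (i : Fin 2) : lamSign i = 1 ∨ lamSign i = -1 := by
  fin_cases i <;> simp [lamSign]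

/-- The Burgers components of the laminate, with alternating layers parallel to the slip planes
in each of which a single Burgers vector is active. -/
def laminate (S : Fin M → SlipPlane) (c : Fin M → Fin 2 → E3 → ℝ) (n : ℕ) (j : Fin M) (i : Fin 2)
    (x : E3) : ℝ :=
  (1 + lamSign i * squareWave ((n + 1 : ℝ) * inner ℝ (S j).normal x)) * c j i x

/-- The two factors `1 ± q` are `2` and `0` in one order or the other. The active index depends only
on the height `t`, so it is the same throughout a slice. -/
theorem laminate_cases (S : Fin M → SlipPlane) (c : Fin M → Fin 2 → E3 → ℝ) (n : ℕ) (j : Fin M)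
    (t : ℝ) : ∃ k : Fin 2, (∀ i, ENNReal.ofReal (1 + lamSign i * squareWave ((n + 1 : ℝ) * t))
        = if i = k then 2 else 0) ∧ (∀ i, (1 + lamSign i * squareWave ((n + 1 : ℝ) * t))
        = if i = k then 2 else 0) ∧ ∀ x, inner ℝ (S j).normal x = t →
      ((S j).slipVec fun i => laminate S c n j i x) = (2 * c j k x) • (S j).burgers k := by
  rcases squareWave_eq ((n + 1 : ℝ) * t) with h | h
  · refine ⟨0, fun i => ?_, fun i => ?_, ?_⟩
    · fin_cases i <;> simp [lamSign, h, one_add_one_eq_two]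
    · fin_cases i <;> simp [lamSign, h, one_add_one_eq_two]
    · rintro x rfl
      simp [SlipPlane.slipVec, laminate, lamSign, h, one_add_one_eq_two]
  · refine ⟨1, fun i => ?_, fun i => ?_, ?_⟩
    · fin_cases i <;> simp [lamSign, h, one_add_one_eq_two]
    · fin_cases i <;> simp [lamSign, h, one_add_one_eq_two]
    · rintro x rfl
      simp [SlipPlane.slipVec, laminate, lamSign, h, one_add_one_eq_two]

theorem SingleSlip.laminate {A : Set E3} {c : Fin M → Fin 2 → E3 → ℝ} (hc : SingleSlip A c)
    (S : Fin M → SlipPlane) (n : ℕ) : SingleSlip A (laminate S c n) := by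
  intro x hx j k hjk
  refine (hc x hx j k hjk).imp (fun h i => ?_) (fun h i => ?_) <;>
  simp [SlipRelax.laminate, h i]

theorem SSC_laminate (hM : 0 < M) {A : Set E3} (hA : IsOpen A) {c : Fin M → Fin 2 → E3 → ℝ}
    (hc : SingleSlip A c) (S : Fin M → SlipPlane) (n : ℕ) :
    SSC S A (strain S (laminate S c n)) := by
  refine (ae_restrict_iff' hA.measurableSet).2 (ae_of_all _ fun x hx => ?_)
  obtain ⟨j, hj⟩ := (hc.laminate S n).exists_strain_eq hM S hx
  obtain ⟨k, -, -, hk⟩ := laminate_cases S c n j (inner ℝ (S j).normal x)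
  exact ⟨j, k, 2 * c j k x, by rw [hj, hk x rfl]⟩

/-- In the slice at height `t` the laminate is `2 cₖ bₖ` for one fixed `k`, and
`planarVariation_smul` applies with `a = 2`. The weights select this `k`, so the identity is exact
for every `n`. -/
theorem curlNorm_laminate {S : Fin M → SlipPlane}
    (hS : ∀ j k, j ≠ k → (S j).normal ≠ (S k).normal ∧ (S j).normal ≠ -(S k).normal)
    {A : Set E3} (hA : IsOpen A) {c : Fin M → Fin 2 → E3 → ℝ} (hc : SingleSlip A c)
    (hcm : ∀ j i, AEStronglyMeasurable (c j i) (volume.restrict A)) (n : ℕ) (j : Fin M) :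
    (S j).curlNorm A (strain S (laminate S c n))
      = ∑ i, ∫⁻ t, ENNReal.ofReal (1 + lamSign i * squareWave ((n + 1 : ℝ) * t))
        * variation ((S j).slice A t) fun y => c j i ((S j).point t y) := by
  have hm : ∀ i, AEMeasurable fun t =>
      ENNReal.ofReal (1 + lamSign i * squareWave ((n + 1 : ℝ) * t))
        * variation ((S j).slice A t) fun y => c j i ((S j).point t y) := fun i => by
    refine (Measurable.ennreal_ofReal ?_).aemeasurable.mul
      (aemeasurable_variation_slice (S j) hA (hcm j i))
    exact (((measurable_squareWave.comp (measurable_const_mul _)).const_mul _).const_add 1)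
  rw [← lintegral_finsetSum' _ fun i _ => hm i]
  refine lintegral_congr fun t => ?_
  obtain ⟨k, hk, -, hv⟩ := laminate_cases S c n j t
  simp only [hk, ite_mul, zero_mul, Finset.sum_ite_eq', Finset.mem_univ, if_true]
  have h2 := planarVariation_smul (U := (S j).slice A t) (fun y => c j k ((S j).point t y))
    ((S j).sum_inPlane_burgers_sq k) (a := 2) two_pos
  rw [ENNReal.ofReal_ofNat] at h2
  rw [← h2]
  refine planarVariation_congr ((S j).isOpen_slice hA t).measurableSet fun y hy => ?_
  rw [slip_strain hS (hc.laminate S n) (show (S j).point t y ∈ A from hy) rfl,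
    hv _ ((S j).inner_normal_point t y)]
  funext i
  exact (S j).inPlane_smul _ _ _

theorem frob_laminate {A : Set E3} {c : Fin M → Fin 2 → E3 → ℝ} (hc : SingleSlip A c)
    (S : Fin M → SlipPlane) (n : ℕ) {x : E3} (hx : x ∈ A) :
    frob (strain S (laminate S c n) x) = ∑ j, ∑ i,
      (1 + lamSign i * squareWave ((n + 1 : ℝ) * inner ℝ (S j).normal x)) * |c j i x| := by
  rw [strain, frob_sum_tensor ((hc.laminate S n).slipVec S hx)]
  refine Finset.sum_congr rfl fun j _ => ?_
  obtain ⟨k, -, hk, hv⟩ := laminate_cases S c n j (inner ℝ (S j).normal x)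
  rw [hv x rfl, norm_smul, (S j).norm_burgers, mul_one, Real.norm_eq_abs, abs_mul]
  simp [hk]

theorem lamFactor_nonneg (i : Fin 2) (t : ℝ) : 0 ≤ 1 + lamSign i * squareWave t := by
  rcases lamSign_eq i with h | h <;> rcases squareWave_eq t with h' | h' <;> rw [h, h'] <;> norm_num

theorem lamFactor_le (i : Fin 2) (t : ℝ) : 1 + lamSign i * squareWave t ≤ 2 := by
  rcases lamSign_eq i with h | h <;> rcases squareWave_eq t with h' | h' <;> rw [h, h'] <;> norm_num

theorem measurable_lamFactor (S : SlipPlane) (n : ℕ) (i : Fin 2) :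
    Measurable fun x => 1 + lamSign i * squareWave ((n + 1 : ℝ) * inner ℝ S.normal x) :=
  ((measurable_squareWave.comp
    (by fun_prop : Measurable fun x : E3 => (n + 1 : ℝ) * inner ℝ S.normal x)).const_mul _).const_add 1

theorem lintegral_frob_laminate {A : Set E3} (hA : IsOpen A) {c : Fin M → Fin 2 → E3 → ℝ}
    (hc : SingleSlip A c) (hcm : ∀ j i, AEStronglyMeasurable (c j i) (volume.restrict A))
    (S : Fin M → SlipPlane) (n : ℕ) :
    ∫⁻ x in A, ENNReal.ofReal (frob (strain S (laminate S c n) x))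
      = ∑ j, ∑ i, ∫⁻ x in A,
        ENNReal.ofReal (1 + lamSign i * squareWave ((n + 1 : ℝ) * inner ℝ (S j).normal x))
          * ENNReal.ofReal |c j i x| := by
  have hm : ∀ j i, AEMeasurable (fun x =>
      ENNReal.ofReal (1 + lamSign i * squareWave ((n + 1 : ℝ) * inner ℝ (S j).normal x))
          * ENNReal.ofReal |c j i x|) (volume.restrict A) := fun j i =>
    (measurable_lamFactor (S j) n i).ennreal_ofReal.aemeasurable.mul
      (hcm j i).norm.aemeasurable.ennreal_ofReal
  simp_rw [← lintegral_finsetSum' _ fun i _ => hm _ i]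
  rw [← lintegral_finsetSum' _ fun j _ => Finset.aemeasurable_fun_sum _ fun i _ => hm j i]
  refine setLIntegral_congr_fun hA.measurableSet fun x hx => ?_
  have hnn : ∀ j i, 0 ≤ (1 + lamSign i * squareWave ((n + 1 : ℝ) * inner ℝ (S j).normal x))
      * |c j i x| := fun j i => mul_nonneg (lamFactor_nonneg _ _) (abs_nonneg _)
  rw [frob_laminate hc S n hx, ENNReal.ofReal_sum_of_nonneg
    fun j _ => Finset.sum_nonneg fun i _ => hnn j i]
  refine Finset.sum_congr rfl fun j _ => ?_
  rw [ENNReal.ofReal_sum_of_nonneg fun i _ => hnn j i]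
  exact Finset.sum_congr rfl fun i _ => ENNReal.ofReal_mul (lamFactor_nonneg _ _)

theorem strain_sub (S : Fin M → SlipPlane) (c d : Fin M → Fin 2 → E3 → ℝ) (x : E3) :
    strain S c x - strain S d x = strain S (fun j i x => c j i x - d j i x) x := by
  simp only [strain, ← Finset.sum_sub_distrib, ← tensor_sub_left]
  refine Finset.sum_congr rfl fun j _ => ?_
  congr 1
  simp only [SlipPlane.slipVec]
  module

theorem norm_vec_strain_le (S : Fin M → SlipPlane) (c : Fin M → Fin 2 → E3 → ℝ) (x : E3) :
    ‖vec (strain S c x)‖ ≤ ∑ j, ∑ i, |c j i x| := by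
  rw [strain, map_sum]
  refine (norm_sum_le _ _).trans (Finset.sum_le_sum fun j _ => ?_)
  rw [norm_vec_tensor, (S j).norm_normal, mul_one]
  exact (S j).norm_slipVec_le _

theorem aestronglyMeasurable_slipVec (S : SlipPlane) {μ : Measure E3} {c : Fin 2 → E3 → ℝ}
    (hc : ∀ i, AEStronglyMeasurable (c i) μ) :
    AEStronglyMeasurable (fun x => S.slipVec fun i => c i x) μ :=
  ((hc 0).smul_const _).add ((hc 1).smul_const _)

theorem aestronglyMeasurable_strain (S : Fin M → SlipPlane) {μ : Measure E3}
    {c : Fin M → Fin 2 → E3 → ℝ} (hc : ∀ j i, AEStronglyMeasurable (c j i) μ) (a b : Fin 3) :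
    AEStronglyMeasurable (fun x => strain S c x a b) μ := by
  simp only [strain, Matrix.sum_apply]
  exact Finset.aestronglyMeasurable_fun_sum _ fun j _ =>
    aestronglyMeasurable_tensor (aestronglyMeasurable_slipVec (S j) (hc j)) _ a b

/-! ### Truncation -/

/-- A smooth truncation of the real line. -/
def truncation (k : ℕ) (x : ℝ) : ℝ := (k + 1) * Real.arctan (x / (k + 1))

theorem contDiff_truncation (k : ℕ) {n : WithTop ℕ∞} : ContDiff ℝ n (truncation k) :=
  contDiff_const.mul (Real.contDiff_arctan.comp (contDiff_id.div_const _))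

theorem hasDerivAt_truncation (k : ℕ) (x : ℝ) :
    HasDerivAt (truncation k) (1 / (1 + (x / (k + 1)) ^ 2)) x := by
  have h := (((hasDerivAt_id x).div_const ((k : ℝ) + 1)).arctan).const_mul ((k : ℝ) + 1)
  refine h.congr_deriv ?_
  have : (k : ℝ) + 1 ≠ 0 := by positivity
  simp only [id]
  field_simp

theorem abs_deriv_truncation_le (k : ℕ) (x : ℝ) : |deriv (truncation k) x| ≤ 1 := by
  rw [(hasDerivAt_truncation k x).deriv, abs_of_pos (by positivity), div_le_one (by positivity)]
  nlinarith [sq_nonneg (x / ((k : ℝ) + 1))]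

theorem truncation_zero (k : ℕ) : truncation k 0 = 0 := by simp [truncation]

theorem abs_truncation_le (k : ℕ) (x : ℝ) : |truncation k x| ≤ |x| := by
  have h := Convex.norm_image_sub_le_of_norm_deriv_le (f := truncation k) (C := 1) (s := Set.univ)
    (x := 0) (y := x) (fun y _ => (hasDerivAt_truncation k y).differentiableAt)
    (fun y _ => abs_deriv_truncation_le k y) convex_univ (Set.mem_univ _) (Set.mem_univ _)
  rw [truncation_zero, sub_zero, sub_zero, one_mul] at h
  exact h

theorem abs_truncation_le_const (k : ℕ) (x : ℝ) : |truncation k x| ≤ (k + 1) * (Real.pi / 2) := by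
  rw [truncation, abs_mul, abs_of_pos (by positivity)]
  refine mul_le_mul_of_nonneg_left (abs_le.2 ⟨?_, ?_⟩) (by positivity)
  · exact (Real.neg_pi_div_two_lt_arctan _).le
  · exact (Real.arctan_lt_pi_div_two _).le

/-- The truncations are the difference quotients at `0` of `t ↦ arctan (x t)`, with increment `t = 1
/ (k + 1)`. -/
theorem tendsto_truncation (x : ℝ) : Tendsto (fun k => truncation k x) atTop (𝓝 x) := by
  have h : HasDerivAt (fun t => Real.arctan (x * t)) x 0 := by
    have := ((hasDerivAt_id (0 : ℝ)).const_mul x).arctan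
    simpa using this
  have h1 := hasDerivAt_iff_tendsto_slope_zero.1 h
  have h2 : Tendsto (fun k : ℕ => 1 / ((k : ℝ) + 1)) atTop (𝓝[≠] 0) := by
    refine tendsto_nhdsWithin_iff.2 ⟨tendsto_one_div_add_atTop_nhds_zero_nat, ?_⟩
    refine Eventually.of_forall fun k => ?_
    have : 0 < 1 / ((k : ℝ) + 1) := by positivity
    exact this.ne'
  refine (h1.comp h2).congr fun k => ?_
  simp [truncation, div_eq_mul_inv]

/-! ### Recovery sequences -/

/-- The energies of the admissible pairs with given boundary values. -/
def admissibleEnergies (S : Fin M → SlipPlane) (σ τ : ℝ≥0) {Ω : Set E3} (u : H1 Ω) : Set ℝ≥0∞ :=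
  {e | ∃ (v : H1 Ω) (β : E3 → Mat3), SameBoundaryValues v u ∧
    (∀ a b, MemLp (fun x => β x a b) ∞ (volume.restrict Ω)) ∧ SSC S Ω β ∧
    e = energy S σ τ Ω v β}

theorem memLp_of_bounded_of_support {Ω K : Set E3} (hΩ : IsOpen Ω) (hK : IsCompact K) {B : ℝ}
    {f : E3 → ℝ} (hf : AEStronglyMeasurable f (volume.restrict Ω)) (hB : ∀ x ∈ Ω, |f x| ≤ B)
    (hs : ∀ x ∈ Ω, x ∉ K → f x = 0) (p : ℝ≥0∞) : MemLp f p (volume.restrict Ω) := by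
  have e : K.indicator f =ᵐ[volume.restrict Ω] f :=
    (ae_restrict_iff' hΩ.measurableSet).2 (ae_of_all _ fun x hx => by
      by_cases hxK : x ∈ K
      · exact Set.indicator_of_mem hxK f
      · rw [Set.indicator_of_notMem hxK, hs x hx hxK])
  refine MemLp.ae_eq e ((memLp_indicator_iff_restrict hK.measurableSet).2 ?_)
  have : IsFiniteMeasure ((volume.restrict Ω).restrict K) := by
    refine ⟨?_⟩
    rw [Measure.restrict_apply_univ]
    exact (Measure.restrict_apply_le _ _).trans_lt hK.measure_lt_top
  refine MemLp.of_bound hf.restrict B (ae_restrict_of_ae ?_)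
  exact (ae_restrict_iff' hΩ.measurableSet).2 (ae_of_all _ fun x hx => hB x hx)

theorem memLp_top_laminate {Ω : Set E3} (hΩ : IsOpen Ω) {c : Fin M → Fin 2 → E3 → ℝ}
    (hcm : ∀ j i, AEStronglyMeasurable (c j i) (volume.restrict Ω)) {B : ℝ}
    (hB : ∀ j i, ∀ x ∈ Ω, |c j i x| ≤ B) (S : Fin M → SlipPlane) (n : ℕ) (a b : Fin 3) :
    MemLp (fun x => strain S (laminate S c n) x a b) ∞ (volume.restrict Ω) := by
  refine memLp_top_of_bound (aestronglyMeasurable_strain S (fun j i =>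
    (measurable_lamFactor (S j) n i).aestronglyMeasurable.mul (hcm j i)) a b)
    (∑ _ : Fin M, ∑ _ : Fin 2, 2 * B)
    ((ae_restrict_iff' hΩ.measurableSet).2 (ae_of_all _ fun x hx => ?_))
  refine (PiLp.norm_apply_le (vec (strain S (laminate S c n) x)) (a, b)).trans
    ((norm_vec_strain_le S _ x).trans ?_)
  refine Finset.sum_le_sum fun j _ => Finset.sum_le_sum fun i _ => ?_
  rw [laminate, abs_mul, abs_of_nonneg (lamFactor_nonneg _ _)]
  exact mul_le_mul (lamFactor_le _ _) (hB j i x hx) (abs_nonneg _) two_pos.le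

theorem strain_laminate_sub (S : Fin M → SlipPlane) (c : Fin M → Fin 2 → E3 → ℝ) (n : ℕ) (x : E3) :
    strain S (laminate S c n) x - strain S c x
      = ∑ j, squareWave ((n + 1 : ℝ) * inner ℝ (S j).normal x)
        • tensor ((S j).slipVec fun i => lamSign i * c j i x) (S j).normal := by
  rw [strain_sub, strain]
  refine Finset.sum_congr rfl fun j _ => ?_
  rw [← tensor_smul_left]
  congr 1
  simp only [SlipPlane.slipVec, laminate]
  module

/-- The elastic energies of the laminates, with suitable correctors, converge. -/
theorem exists_tendsto_elastic {Ω : Set E3} (hΩ : IsOpen Ω) (S : Fin M → SlipPlane) (u : H1 Ω)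
    {c : Fin M → Fin 2 → E3 → ℝ} (hsm : ∀ j i, ContDiffOn ℝ ∞ (c j i) Ω)
    (hc2 : ∀ j i, MemLp (c j i) 2 (volume.restrict Ω)) :
    ∃ v : ℕ → H1 Ω, (∀ n, SameBoundaryValues (v n) u) ∧
      Tendsto (fun n => elasticEnergy Ω (v n) (strain S (laminate S c n))) atTop
        (𝓝 (∫⁻ x in Ω, ENNReal.ofReal (‖vec (symPart (u.grad x - strain S c x))‖ ^ 2))) := by
  -- The amplitude of the oscillation on plane `j`: `c₁ b₁ - c₂ b₂`.
  set d : Fin M → E3 → E3 := fun j x => (S j).slipVec fun i => lamSign i * c j i x with hd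
  have hdsm : ∀ j, ContDiffOn ℝ ∞ (d j) Ω := fun j =>
    ((contDiffOn_const.mul (hsm j 0)).smul contDiffOn_const).add
      ((contDiffOn_const.mul (hsm j 1)).smul contDiffOn_const)
  have hd2 : ∀ j, MemLp (d j) 2 (volume.restrict Ω) := by
    intro j
    have h : ∀ i, MemLp (fun x => (lamSign i * c j i x) • (S j).burgers i) 2
        (volume.restrict Ω) := by
      intro i
      refine MemLp.of_le ((hc2 j i).const_mul (lamSign i))
        (((hc2 j i).1.const_mul (lamSign i)).smul_const _) (ae_of_all _ fun x => ?_)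
      rw [norm_smul, (S j).norm_burgers, mul_one]
    exact (h 0).add (h 1)
  choose φ hφ hφt using fun j =>
    exists_laminate_corrector hΩ (S j).norm_normal (hdsm j) (hd2 j)
  have hsum : ∀ n, (∑ j, φ j n) ∈ fieldTest Ω := fun n =>
    sum_mem_fieldTest _ fun j _ => hφ j n
  have hcm : ∀ j i, AEStronglyMeasurable (c j i) (volume.restrict Ω) := fun j i => (hc2 j i).1
  refine ⟨fun n => u.addTest (hsum n), fun n => sameBoundaryValues_addTest u (hsum n), ?_⟩
  simp_rw [elasticEnergy_eq]
  have hlm : ∀ n j i, AEStronglyMeasurable (laminate S c n j i) (volume.restrict Ω) :=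
    fun n j i => (measurable_lamFactor (S j) n i).aestronglyMeasurable.mul (hcm j i)
  refine tendsto_lintegral_norm_sq (fun n => ?_) ?_ ?_
  · exact aestronglyMeasurable_vec (aestronglyMeasurable_symPart fun a b =>
      ((u.addTest (hsum n)).aestronglyMeasurable_grad le_rfl a b).sub
        (aestronglyMeasurable_strain S (hlm n) a b))
  · exact aestronglyMeasurable_vec (aestronglyMeasurable_symPart fun a b =>
      (u.aestronglyMeasurable_grad le_rfl a b).sub (aestronglyMeasurable_strain S hcm a b))
  · have hz : Tendsto (fun n => ∑ j, eLpNorm (fun x => vec (jacobian (φ j n) x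
        - squareWave ((n + 1 : ℝ) * inner ℝ (S j).normal x) • tensor (d j x) (S j).normal)) 2
        (volume.restrict Ω)) atTop (𝓝 0) := by
      have := tendsto_finsetSum Finset.univ fun j _ => hφt j
      simpa using this
    refine tendsto_of_tendsto_of_tendsto_of_le_of_le tendsto_const_nhds hz (fun _ => zero_le)
      fun n => ?_
    have hms : ∀ j, AEStronglyMeasurable (fun x => vec (jacobian (φ j n) x
        - squareWave ((n + 1 : ℝ) * inner ℝ (S j).normal x) • tensor (d j x) (S j).normal))
        (volume.restrict Ω) := by
      intro j
      simp only [map_sub, map_smul]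
      have ht : AEStronglyMeasurable (fun x => vec (tensor (d j x) (S j).normal))
          (volume.restrict Ω) :=
        aestronglyMeasurable_vec fun a b => aestronglyMeasurable_tensor (hd2 j).1 _ a b
      have hw : AEStronglyMeasurable
          (fun x => squareWave ((n + 1 : ℝ) * inner ℝ (S j).normal x)) (volume.restrict Ω) :=
        (measurable_squareWave.comp (by fun_prop)).aestronglyMeasurable
      exact (continuous_vec_jacobian (hφ j n)).aestronglyMeasurable.sub (hw.smul ht)
    have hle := eLpNorm_sum_le (s := Finset.univ) (p := 2) (fun j _ => hms j) (by norm_num)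
    refine le_trans (eLpNorm_mono fun x => ?_) hle
    -- The change in the elastic strain is exactly the symmetric part of the sum of the corrector
    -- errors of the individual planes.
    have e : symPart ((u.addTest (hsum n)).grad x - strain S (laminate S c n) x)
        - symPart (u.grad x - strain S c x) = symPart (∑ j, (jacobian (φ j n) x
        - squareWave ((n + 1 : ℝ) * inner ℝ (S j).normal x) • tensor (d j x) (S j).normal)) := by
      rw [← symPart_sub, Finset.sum_sub_distrib, ← strain_laminate_sub,
        ← jacobian_sum _ fun j _ => hφ j n]
      congr 1
      simp only [H1.addTest]
      abel
    rw [Pi.sub_apply, ← map_sub, e, Finset.sum_apply, ← map_sum]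
    exact norm_vec_symPart_le _

/-- The relaxed energy of a bounded strain is approximated by the energies of laminates. -/
theorem relEnergy_mem_closure_of_bounded (hM : 0 < M) {S : Fin M → SlipPlane}
    (hS : ∀ j k, j ≠ k → (S j).normal ≠ (S k).normal ∧ (S j).normal ≠ -(S k).normal)
    (σ τ : ℝ≥0) {Ω K : Set E3} (hΩ : IsOpen Ω) (u : H1 Ω) {c : Fin M → Fin 2 → E3 → ℝ}
    (hc : SingleSlip Ω c) (hsm : ∀ j i, ContDiffOn ℝ ∞ (c j i) Ω) {B : ℝ}
    (hB : ∀ j i, ∀ x ∈ Ω, |c j i x| ≤ B) (hK : IsCompact K)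
    (hs : ∀ j i, ∀ x ∈ Ω, x ∉ K → c j i x = 0)
    (hfin : σ ≠ 0 → ∀ j i, sliceVariation (S j) Ω (c j i) ≠ ⊤) :
    relEnergy S σ τ Ω u (strain S c) ∈ closure (admissibleEnergies S σ τ u) := by
  have hcm : ∀ j i, AEStronglyMeasurable (c j i) (volume.restrict Ω) := fun j i =>
    (hsm j i).continuousOn.aestronglyMeasurable hΩ.measurableSet
  have hLp : ∀ p j i, MemLp (c j i) p (volume.restrict Ω) := fun p j i =>
    memLp_of_bounded_of_support hΩ hK (hcm j i) (hB j i) (hs j i) p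
  obtain ⟨v, hv, hvt⟩ := exists_tendsto_elastic hΩ S u hsm (hLp 2)
  have hen : ∀ n, energy S σ τ Ω (v n) (strain S (laminate S c n)) ∈ admissibleEnergies S σ τ u :=
    fun n => ⟨v n, _, hv n, memLp_top_laminate hΩ hcm hB S n, SSC_laminate hM hΩ hc S n, rfl⟩
  refine mem_closure_of_tendsto (b := atTop) ?_ (Eventually.of_forall hen)
  rw [relEnergy_strain hM hS σ τ hΩ u hc fun _ _ => rfl]
  have e : ∀ n, energy S σ τ Ω (v n) (strain S (laminate S c n))
      = elasticEnergy Ω (v n) (strain S (laminate S c n))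
        + (σ : ℝ≥0∞) * (∑ j, (S j).curlNorm Ω (strain S (laminate S c n)))
        + (τ : ℝ≥0∞) * ∫⁻ x in Ω, ENNReal.ofReal (frob (strain S (laminate S c n) x)) :=
    fun n => if_pos (SSC_laminate hM hΩ hc S n)
  simp_rw [e]
  refine (hvt.add ?_).add ?_
  -- For `σ = 0` the variations may be infinite, and the term vanishes by `0 · ∞ = 0`; weak
  -- convergence needs them finite.
  · by_cases hσ : σ = 0
    · simp [hσ]
    refine ENNReal.Tendsto.const_mul ?_ (Or.inr ENNReal.coe_ne_top)
    refine tendsto_finsetSum _ fun j _ => ?_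
    simp_rw [curlNorm_laminate hS hΩ hc hcm]
    refine tendsto_finsetSum _ fun i _ => ?_
    -- The oscillation is in the height `t` alone, and the slice variation plays the role of the
    -- fixed integrable weight.
    exact tendsto_lintegral_squareWave volume (l := ContinuousLinearMap.id ℝ ℝ)
      (fun h => one_ne_zero (congrArg (fun f : ℝ →L[ℝ] ℝ => f 1) h))
      (aemeasurable_variation_slice (S j) hΩ (hcm j i)) (hfin hσ j i) (lamSign_eq i)
  · refine ENNReal.Tendsto.const_mul ?_ (Or.inr ENNReal.coe_ne_top)
    simp_rw [lintegral_frob_laminate hΩ hc hcm]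
    refine tendsto_finsetSum _ fun j _ => tendsto_finsetSum _ fun i _ => ?_
    have h1 : ∫⁻ x in Ω, ENNReal.ofReal |c j i x| ≠ ⊤ := by
      have := (memLp_one_iff_integrable.1 (hLp 1 j i)).2.ne
      simpa [← Real.enorm_eq_ofReal_abs] using this
    have h2 := tendsto_lintegral_squareWave volume (l := innerSL ℝ (S j).normal)
      (f := Ω.indicator fun x => ENNReal.ofReal |c j i x|) (fun h => ?_)
      ((aemeasurable_indicator_iff hΩ.measurableSet).2 (hcm j i).norm.aemeasurable.ennreal_ofReal)
      (by rwa [lintegral_indicator hΩ.measurableSet]) (lamSign_eq i)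
    · rw [lintegral_indicator hΩ.measurableSet] at h2
      refine h2.congr fun n => ?_
      rw [← lintegral_indicator hΩ.measurableSet]
      refine lintegral_congr fun x => ?_
      by_cases hx : x ∈ Ω
      · rw [Set.indicator_of_mem hx, Set.indicator_of_mem hx]
        rfl
      · rw [Set.indicator_of_notMem hx, Set.indicator_of_notMem hx, mul_zero]
    · have h' := congrArg (fun f : E3 →L[ℝ] ℝ => f (S j).normal) h
      simp only [innerSL_apply_apply, real_inner_self_eq_norm_sq, (S j).norm_normal] at h'
      norm_num at h'

/-- Truncation reduces the approximation of the relaxed energy to bounded strains. -/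
theorem relEnergy_mem_closure (hM : 0 < M) {S : Fin M → SlipPlane}
    (hS : ∀ j k, j ≠ k → (S j).normal ≠ (S k).normal ∧ (S j).normal ≠ -(S k).normal)
    (σ τ : ℝ≥0) {Ω K : Set E3} (hΩ : IsOpen Ω) (u : H1 Ω) {c : Fin M → Fin 2 → E3 → ℝ}
    (hc : SingleSlip Ω c) (hsm : ∀ j i, ContDiffOn ℝ ∞ (c j i) Ω)
    (hc2 : ∀ j i, MemLp (c j i) 2 (volume.restrict Ω)) (hK : IsCompact K)
    (hs : ∀ j i, ∀ x ∈ Ω, x ∉ K → c j i x = 0)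
    (hfin : σ ≠ 0 → ∀ j i, sliceVariation (S j) Ω (c j i) ≠ ⊤) :
    relEnergy S σ τ Ω u (strain S c) ∈ closure (admissibleEnergies S σ τ u) := by
  have hcm : ∀ j i, AEStronglyMeasurable (c j i) (volume.restrict Ω) := fun j i => (hc2 j i).1
  set T : ℕ → Fin M → Fin 2 → E3 → ℝ := fun k j i x => truncation k (c j i x) with hT
  have hTm : ∀ k j i, AEStronglyMeasurable (T k j i) (volume.restrict Ω) := fun k j i =>
    (contDiff_truncation k (n := 0)).continuous.comp_aestronglyMeasurable (hcm j i)
  have hTc : ∀ k, SingleSlip Ω (T k) := fun k x hx j l hjl =>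
    (hc x hx j l hjl).imp (fun h i => by simp [hT, h i, truncation_zero])
      (fun h i => by simp [hT, h i, truncation_zero])
  have hslice : ∀ j i t, ContDiffOn ℝ 2 (fun y => c j i ((S j).point t y)) ((S j).slice Ω t) :=
    fun j i t => (contDiffOn_infty.1 (hsm j i) 2).comp
      ((S j).contDiff_point t).contDiffOn fun y hy => hy
  have hvar : ∀ k j i t, variation ((S j).slice Ω t) (fun y => T k j i ((S j).point t y))
      ≤ variation ((S j).slice Ω t) (fun y => c j i ((S j).point t y)) := fun k j i t =>
    variation_comp_le ((S j).isOpen_slice hΩ t) (hslice j i t) (contDiff_truncation k)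
      (abs_deriv_truncation_le k)
  have hvarlim : ∀ j i t, Tendsto
      (fun k => variation ((S j).slice Ω t) (fun y => T k j i ((S j).point t y))) atTop
      (𝓝 (variation ((S j).slice Ω t) (fun y => c j i ((S j).point t y)))) := fun j i t =>
    tendsto_variation_comp ((S j).isOpen_slice hΩ t) (hslice j i t)
      (fun k => contDiff_truncation k) abs_deriv_truncation_le abs_truncation_le tendsto_truncation
  have hmem : ∀ k, relEnergy S σ τ Ω u (strain S (T k)) ∈ closure (admissibleEnergies S σ τ u) := by
    intro k
    refine relEnergy_mem_closure_of_bounded hM hS σ τ hΩ u (hTc k)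
      (fun j i => (contDiff_truncation k).comp_contDiffOn (hsm j i))
      (fun j i x _ => abs_truncation_le_const k _) hK
      (fun j i x hx hxK => by simp [hT, hs j i x hx hxK, truncation_zero]) (fun hσ j i => ?_)
    exact ne_top_of_le_ne_top (hfin hσ j i) (lintegral_mono fun t => hvar k j i t)
  -- Each truncated energy is itself only a limit of admissible energies; idempotence of the closure
  -- replaces a diagonal sequence.
  rw [← closure_closure]
  refine mem_closure_of_tendsto (b := atTop) ?_ (Eventually.of_forall hmem)
  rw [relEnergy_strain hM hS σ τ hΩ u hc fun _ _ => rfl]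
  have e := fun k => relEnergy_strain hM hS σ τ hΩ u (hTc k) (β := strain S (T k)) fun _ _ => rfl
  simp_rw [e]
  -- Functions bounded by their pointwise limit: Fatou bounds the integrals from below and the bound
  -- itself from above. No finiteness of the limit integral and no monotonicity in `k` is needed.
  have hmono : ∀ {α : Type} [MeasurableSpace α] {μ : Measure α} {f : ℕ → α → ℝ≥0∞} {g : α → ℝ≥0∞},
      (∀ k, AEMeasurable (f k) μ) → (∀ k x, f k x ≤ g x) →
      (∀ x, Tendsto (fun k => f k x) atTop (𝓝 (g x))) →
      Tendsto (fun k => ∫⁻ x, f k x ∂μ) atTop (𝓝 (∫⁻ x, g x ∂μ)) := by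
    intro α _ μ f g hf hle hlim
    refine tendsto_of_le_liminf_of_limsup_le ?_ ?_
    · calc ∫⁻ x, g x ∂μ = ∫⁻ x, liminf (fun k => f k x) atTop ∂μ :=
            lintegral_congr fun x => (hlim x).liminf_eq.symm
        _ ≤ _ := lintegral_liminf_le' hf
    · exact limsup_le_of_le (by isBoundedDefault)
        (Eventually.of_forall fun k => lintegral_mono (hle k))
  refine (Tendsto.add ?_ ?_).add ?_
  · refine tendsto_lintegral_norm_sq (fun k => ?_) ?_ ?_
    · exact aestronglyMeasurable_vec (aestronglyMeasurable_symPart fun a b =>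
        (u.aestronglyMeasurable_grad le_rfl a b).sub (aestronglyMeasurable_strain S (hTm k) a b))
    · exact aestronglyMeasurable_vec (aestronglyMeasurable_symPart fun a b =>
        (u.aestronglyMeasurable_grad le_rfl a b).sub (aestronglyMeasurable_strain S hcm a b))
    · have hpt : ∀ k x, ‖vec (symPart (u.grad x - strain S (T k) x))
          - vec (symPart (u.grad x - strain S c x))‖ ≤ ∑ j, ∑ i, |c j i x - T k j i x| := by
        intro k x
        rw [← map_sub, ← symPart_sub, sub_sub_sub_cancel_left, strain_sub]
        exact (norm_vec_symPart_le _).trans (norm_vec_strain_le _ _ _)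
      refine tendsto_eLpNorm_two_zero (g := fun x => ∑ j, ∑ i, 2 * ‖c j i x‖) (fun k => ?_)
        (memLp_finsetSum _ fun j _ => memLp_finsetSum _ fun i _ => (hc2 j i).norm.const_mul 2)
        (fun k => ae_of_all _ fun x => ?_) (ae_of_all _ fun x => ?_)
      · exact (aestronglyMeasurable_vec (aestronglyMeasurable_symPart fun a b =>
          (u.aestronglyMeasurable_grad le_rfl a b).sub
            (aestronglyMeasurable_strain S (hTm k) a b))).sub
          (aestronglyMeasurable_vec (aestronglyMeasurable_symPart fun a b =>
            (u.aestronglyMeasurable_grad le_rfl a b).sub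
              (aestronglyMeasurable_strain S hcm a b)))
      · refine (hpt k x).trans (Finset.sum_le_sum fun j _ => Finset.sum_le_sum fun i _ => ?_)
        have h1 := abs_truncation_le k (c j i x)
        have h2 := abs_sub (c j i x) (T k j i x)
        rw [Real.norm_eq_abs]
        have h3 : |T k j i x| ≤ |c j i x| := h1
        linarith
      · refine squeeze_zero_norm (hpt · x) ?_
        have h0 : ∀ j i, Tendsto (fun k => |c j i x - T k j i x|) atTop (𝓝 0) := fun j i => by
          have := ((tendsto_truncation (c j i x)).const_sub (c j i x)).abs
          simpa using this
        have := tendsto_finsetSum (Finset.univ (α := Fin M)) fun j _ =>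
          tendsto_finsetSum (Finset.univ (α := Fin 2)) fun i _ => h0 j i
        simpa using this
  · refine ENNReal.Tendsto.const_mul ?_ (Or.inr ENNReal.coe_ne_top)
    refine tendsto_finsetSum _ fun j _ => tendsto_finsetSum _ fun i _ => ?_
    exact hmono (fun k => aemeasurable_variation_slice (S j) hΩ (hTm k j i))
      (fun k t => hvar k j i t) (fun t => hvarlim j i t)
  · refine ENNReal.Tendsto.const_mul ?_ (Or.inr ENNReal.coe_ne_top)
    refine tendsto_finsetSum _ fun j _ => tendsto_finsetSum _ fun i _ => ?_
    refine hmono (fun k => (hTm k j i).norm.aemeasurable.ennreal_ofReal)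
      (fun k x => ENNReal.ofReal_le_ofReal (abs_truncation_le k _)) fun x => ?_
    exact (ENNReal.continuous_ofReal.tendsto _).comp (tendsto_truncation _).abs

theorem SlipPlane.slipVec_coeff (S : SlipPlane) {s : E3} (hs : inner ℝ S.normal s = 0) :
    (S.slipVec fun i => S.coeff s i) = s :=
  (S.eq_sum_coeff hs).symm

theorem sameBoundaryValues_refl {Ω : Set E3} (u : H1 Ω) : SameBoundaryValues u u := by
  refine ⟨fun _ => 0, fun _ => zero_mem_fieldTest Ω, by simp, ?_⟩
  have h : ∀ x, u.grad x - u.grad x - (Matrix.of fun i k =>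
      fderiv ℝ (0 : E3 → E3) x (EuclideanSpace.single k 1) i) = 0 := fun x => by
    ext i k
    simp
  have h0 : frobSq 0 = 0 := by simp [frobSq]
  simp only [h, h0, ENNReal.ofReal_zero, lintegral_zero, tendsto_const_nhds]

theorem memLp_vec_symPart_grad {Ω : Set E3} (u : H1 Ω) :
    MemLp (fun x => vec (symPart (u.grad x))) 2 (volume.restrict Ω) := by
  have h : MemLp (fun x => ∑ i, ∑ k, ‖u.grad x i k‖) 2 (volume.restrict Ω) :=
    memLp_finsetSum _ fun i _ => memLp_finsetSum _ fun k _ => (u.memLp_grad i k).norm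
  refine h.mono' (aestronglyMeasurable_vec (aestronglyMeasurable_symPart fun a b =>
    (u.memLp_grad a b).1)) (ae_of_all _ fun x => (norm_vec_symPart_le _).trans ?_)
  have e : vec (u.grad x) = ∑ p, EuclideanSpace.single p (u.grad x p.1 p.2) := by
    ext p
    simp [vec_apply]
  rw [e]
  refine (norm_sum_le _ _).trans (le_of_eq ?_)
  rw [Fintype.sum_prod_type]
  simp

/-- Energies of admissible pairs are unbounded. -/
theorem top_mem_closure_admissibleEnergies (hM : 0 < M) (S : Fin M → SlipPlane) (σ τ : ℝ≥0)
    {Ω : Set E3} (hΩ : IsOpen Ω) (hne : Ω.Nonempty) (u : H1 Ω) :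
    ⊤ ∈ closure (admissibleEnergies S σ τ u) := by
  set j : Fin M := ⟨0, hM⟩
  set b := (S j).burgers 0 with hb
  set m := (S j).normal with hm
  -- With the displacement fixed, a growing constant slip along one Burgers vector drives the
  -- elastic energy to infinity.
  set βn : ℕ → E3 → Mat3 := fun n _ => tensor ((n : ℝ) • b) m with hβn
  have hssc : ∀ n, SSC S Ω (βn n) := fun n => ae_of_all _ fun x => ⟨j, 0, n, rfl⟩
  have hadm : ∀ n, energy S σ τ Ω u (βn n) ∈ admissibleEnergies S σ τ u := fun n =>
    ⟨u, βn n, sameBoundaryValues_refl u, fun a c => memLp_top_const _, hssc n, rfl⟩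
  refine mem_closure_of_tendsto (b := atTop) ?_ (Eventually.of_forall hadm)
  have hel : ∀ n, elasticEnergy Ω u (βn n) ≤ energy S σ τ Ω u (βn n) := fun n => by
    rw [energy, if_pos (hssc n), add_assoc]
    exact le_self_add
  refine tendsto_nhds_top_mono ?_ (Eventually.of_forall hel)
  set C : ℝ≥0∞ := ∫⁻ x in Ω, ENNReal.ofReal (‖vec (symPart (u.grad x))‖ ^ 2) with hC
  have hCfin : C ≠ ⊤ := by
    rw [hC, ← eLpNorm_two_sq]
    exact ENNReal.pow_ne_top (memLp_vec_symPart_grad u).2.ne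
  have hY : ∀ n : ℕ, ‖vec (symPart (tensor ((n : ℝ) • b) m))‖ ^ 2 = 1 / 2 * (n : ℝ) ^ 2 := by
    intro n
    rw [norm_vec_sq, frobSq_symPart_tensor, norm_smul, hb, (S j).norm_burgers, hm,
      (S j).norm_normal]
    · simp
    · rw [inner_smul_right, hb, hm, (S j).inner_normal_burgers, mul_zero]
  -- Integrated form of `|Y|² ≤ 2 |X - Y|² + 2 |X|²`, with `X` and `Y` the symmetric parts of `∇u`
  -- and `βₙ`. The bound is useful because the integral of `|X|²` is finite.
  have hkey : ∀ n : ℕ, ENNReal.ofReal (1 / 2 * (n : ℝ) ^ 2) * volume Ω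
      ≤ 2 * elasticEnergy Ω u (βn n) + 2 * C := by
    intro n
    have hCm : AEMeasurable (fun x => ENNReal.ofReal (‖vec (symPart (u.grad x))‖ ^ 2))
        (volume.restrict Ω) :=
      ((memLp_vec_symPart_grad u).1.norm.aemeasurable.pow_const 2).ennreal_ofReal
    rw [elasticEnergy_eq, hC, ← lintegral_const_mul' _ _ ENNReal.ofNat_ne_top,
      ← lintegral_const_mul' _ _ ENNReal.ofNat_ne_top,
      ← lintegral_add_right' _ (hCm.const_mul 2), ← setLIntegral_const]
    refine lintegral_mono fun x => ?_
    rw [← hY n]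
    have e : vec (symPart (tensor ((n : ℝ) • b) m))
        = vec (symPart (u.grad x)) - vec (symPart (u.grad x - βn n x)) := by
      rw [symPart_sub, map_sub, sub_sub_cancel]
    have h2 : ∀ y : ℝ, (2 : ℝ≥0∞) * ENNReal.ofReal y = ENNReal.ofReal (2 * y) := fun y => by
      rw [ENNReal.ofReal_mul two_pos.le, ENNReal.ofReal_ofNat]
    rw [h2, h2, ← ENNReal.ofReal_add (by positivity) (by positivity)]
    refine ENNReal.ofReal_le_ofReal ?_
    rw [e]
    have h3 := norm_sub_le (vec (symPart (u.grad x))) (vec (symPart (u.grad x - βn n x)))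
    have h4 := pow_le_pow_left₀ (norm_nonneg _) h3 2
    nlinarith [sq_nonneg (‖vec (symPart (u.grad x))‖ - ‖vec (symPart (u.grad x - βn n x))‖)]
  have hlow : ∀ n : ℕ, (ENNReal.ofReal (1 / 2 * (n : ℝ) ^ 2) * volume Ω - 2 * C) / 2
      ≤ elasticEnergy Ω u (βn n) := fun n =>
    ENNReal.div_le_of_le_mul' (tsub_le_iff_right.2 (hkey n))
  refine tendsto_nhds_top_mono ?_ (Eventually.of_forall hlow)
  have h1 : Tendsto (fun n : ℕ => ENNReal.ofReal (1 / 2 * (n : ℝ) ^ 2)) atTop (𝓝 ⊤) :=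
    ENNReal.tendsto_ofReal_atTop.comp (((tendsto_pow_atTop two_ne_zero).comp
      tendsto_natCast_atTop_atTop).const_mul_atTop (by norm_num))
  have hvol : volume Ω ≠ 0 := (hΩ.measure_pos volume hne).ne'
  have h2 := ENNReal.Tendsto.mul_const (b := volume Ω) h1 (Or.inl ENNReal.top_ne_zero)
  rw [ENNReal.top_mul hvol] at h2
  have h2C : 2 * C ≠ ⊤ := ENNReal.mul_ne_top ENNReal.ofNat_ne_top hCfin
  have h3 := ENNReal.Tendsto.sub h2 (tendsto_const_nhds (x := 2 * C)) (Or.inr h2C)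
  rw [ENNReal.top_sub h2C] at h3
  have h4 := ENNReal.Tendsto.div_const h3 (b := 2) (Or.inl ENNReal.top_ne_zero)
  rwa [ENNReal.top_div_of_ne_top ENNReal.ofNat_ne_top] at h4

/-- Slip patches with a strain that is smooth across their boundaries inside `Ω`. -/
theorem relEnergy_mem_closure_of_patches (hM : 0 < M) {S : Fin M → SlipPlane}
    (hS : ∀ j k, j ≠ k → (S j).normal ≠ (S k).normal ∧ (S j).normal ≠ -(S k).normal)
    (σ τ : ℝ≥0) {Ω : Set E3} (hΩ : IsOpen Ω) (hne : Ω.Nonempty)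
    {ι : Type} [Finite ι] {P : ι → Set E3} {ν : ι → Fin M} (hP : ∀ i, IsOpen (P i))
    (u : H1 Ω) {β : E3 → Mat3} {s : E3 → E3}
    (hsm : ∀ a b, ContDiffOn ℝ ∞ (fun x => β x a b) Ω)
    (hslip : ∀ i, ∀ x ∈ P i,
      inner ℝ (S (ν i)).normal (s x) = 0 ∧ β x = tensor (s x) (S (ν i)).normal)
    (hzero : ∀ x ∈ Ω, (∀ i, x ∉ P i) → β x = 0)
    (hcomp : ∀ i, IsCompact (closure {x | x ∈ P i ∧ s x ≠ 0}))
    (hsub : ∀ i, closure {x | x ∈ P i ∧ s x ≠ 0} ⊆ P i ∪ (frontier Ω ∩ frontier (P i))) :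
    relEnergy S σ τ Ω u β ∈ closure (admissibleEnergies S σ τ u) := by
  by_cases htop : relEnergy S σ τ Ω u β = ⊤
  · rw [htop]
    exact top_mem_closure_admissibleEnergies hM S σ τ hΩ hne u
  set K : Set E3 := ⋃ i, closure {x | x ∈ P i ∧ s x ≠ 0} with hK
  have hKc : IsCompact K := isCompact_iUnion hcomp
  have hself : ∀ i, ∀ x ∈ P i, (S (ν i)).slip β x = s x := fun i x hx =>
    (S (ν i)).slip_eq (hslip i x hx).1 (hslip i x hx).2
  have hother : ∀ i, ∀ x ∈ P i, ∀ k, ν i ≠ k → (S k).slip β x = 0 := fun i x hx k hk =>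
    slip_tensor_of_ne hS hk (hslip i x hx).2
  have hnone : ∀ x, β x = 0 → ∀ k, (S k).slip β x = 0 := fun x hx k =>
    (S k).slip_eq (by simp) (by rw [hx, tensor_zero_left])
  have hoffK : ∀ x ∈ Ω, x ∉ K → β x = 0 := by
    intro x hx hxK
    by_cases hex : ∃ i, x ∈ P i
    · obtain ⟨i, hi⟩ := hex
      have h0 : s x = 0 := by
        by_contra hn
        exact hxK (Set.mem_iUnion.2 ⟨i, subset_closure ⟨hi, hn⟩⟩)
      rw [(hslip i x hi).2, h0, tensor_zero_left]
    · push Not at hex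
      exact hzero x hx hex
  -- The supports can leave their patches only through `∂Ω`, which is disjoint from the open set
  -- `Ω`. So every point of `Ω` has a neighbourhood inside a single patch or one where the strain
  -- vanishes.
  have hcases : ∀ x ∈ Ω, (∃ i, x ∈ P i) ∨ x ∉ K := by
    intro x hx
    by_contra! hn
    obtain ⟨h1, h2⟩ := hn
    obtain ⟨i, hi⟩ := Set.mem_iUnion.1 h2
    rcases hsub i hi with h | h
    · exact h1 i h
    · have := h.1
      rw [hΩ.frontier_eq] at this
      exact this.2 hx
  have horth : ∀ j, ∀ x ∈ Ω, inner ℝ (S j).normal ((S j).slip β x) = 0 := by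
    intro j x hx
    rcases hcases x hx with ⟨i, hi⟩ | h
    · by_cases hij : ν i = j
      · subst hij
        rw [hself i x hi]
        exact (hslip i x hi).1
      · rw [hother i x hi j hij, inner_zero_right]
    · rw [hnone x (hoffK x hx h) j, inner_zero_right]
  set c : Fin M → Fin 2 → E3 → ℝ := fun j i x => (S j).coeff ((S j).slip β x) i with hc_def
  have hc : SingleSlip Ω c := by
    intro x hx j k hjk
    rcases hcases x hx with ⟨i, hi⟩ | h
    · by_cases hij : ν i = j
      · right
        intro l
        simp only [hc_def, hother i x hi k (hij.trans_ne hjk), SlipPlane.coeff_zero]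
      · left
        intro l
        simp only [hc_def, hother i x hi j hij, SlipPlane.coeff_zero]
    · left
      intro l
      simp only [hc_def, hnone x (hoffK x hx h) j, SlipPlane.coeff_zero]
  have hβ : ∀ x ∈ Ω, β x = strain S c x := by
    intro x hx
    have e : strain S c x = ∑ j, tensor ((S j).slip β x) (S j).normal :=
      Finset.sum_congr rfl fun j _ => by rw [(S j).slipVec_coeff (horth j x hx)]
    rw [e]
    rcases hcases x hx with ⟨i, hi⟩ | h
    · rw [Finset.sum_eq_single (ν i) (fun k _ hk => by
        rw [hother i x hi k hk.symm, tensor_zero_left]) (by simp), hself i x hi]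
      exact (hslip i x hi).2
    · rw [hoffK x hx h]
      exact (Finset.sum_eq_zero fun k _ => by
        rw [hnone x (hoffK x hx h) k, tensor_zero_left]).symm
  -- The slip is defined by cases, but locally it is either `β m` or identically zero, and both are
  -- smooth.
  have hcsm : ∀ j i, ContDiffOn ℝ ∞ (c j i) Ω := by
    intro j i x hx
    refine ContDiffAt.contDiffWithinAt ?_
    refine ((S j).contDiff_coeff i).contDiffAt.comp x ?_
    rcases hcases x hx with ⟨l, hl⟩ | h
    · by_cases hij : ν l = j
      · subst hij
        have hbm : ContDiffAt ℝ ∞ (fun y => WithLp.toLp 2 ((β y).mulVec (S (ν l)).normal) :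
            E3 → E3) x := by
          refine contDiffAt_euclidean.2 fun a => ?_
          simp only [Matrix.mulVec, dotProduct]
          exact ContDiffAt.sum fun k _ =>
            ((hsm a k).contDiffAt (hΩ.mem_nhds hx)).mul contDiffAt_const
        refine hbm.congr_of_eventuallyEq ?_
        filter_upwards [(hP l).mem_nhds hl] with y hy
        exact if_pos ⟨s y, hslip l y hy⟩
      · refine contDiffAt_const (c := (0 : E3)) |>.congr_of_eventuallyEq ?_
        filter_upwards [(hP l).mem_nhds hl] with y hy
        exact hother l y hy j hij
    · refine contDiffAt_const (c := (0 : E3)) |>.congr_of_eventuallyEq ?_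
      filter_upwards [hKc.isClosed.isOpen_compl.mem_nhds h, hΩ.mem_nhds hx] with y hy hyΩ
      exact hnone y (hoffK y hyΩ hy) j
  have hs0 : ∀ j i, ∀ x ∈ Ω, x ∉ K → c j i x = 0 := fun j i x hx hxK => by
    simp only [hc_def, hnone x (hoffK x hx hxK) j, SlipPlane.coeff_zero]
  have hrel : relEnergy S σ τ Ω u β = _ := relEnergy_strain hM hS σ τ hΩ u hc hβ
  have hrel' : relEnergy S σ τ Ω u (strain S c) = _ :=
    relEnergy_strain hM hS σ τ hΩ u hc fun _ _ => rfl
  rw [hrel, ← hrel']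
  -- A finite relaxed energy has a finite elastic part, which yields `L²` bounds on the slip, and a
  -- finite curl part.
  rw [hrel] at htop
  obtain ⟨htop1, -⟩ := ENNReal.add_ne_top.1 htop
  obtain ⟨hel, hvar⟩ := ENNReal.add_ne_top.1 htop1
  have hcm : ∀ j i, AEStronglyMeasurable (c j i) (volume.restrict Ω) := fun j i =>
    (hcsm j i).continuousOn.aestronglyMeasurable hΩ.measurableSet
  have hX : MemLp (fun x => vec (symPart (u.grad x - strain S c x))) 2 (volume.restrict Ω) := by
    refine ⟨aestronglyMeasurable_vec (aestronglyMeasurable_symPart fun a b =>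
      (u.aestronglyMeasurable_grad le_rfl a b).sub (aestronglyMeasurable_strain S hcm a b)), ?_⟩
    rw [← eLpNorm_two_sq] at hel
    exact lt_top_iff_ne_top.2 fun h => hel (by rw [h]; simp)
  have hsym : MemLp (fun x => vec (symPart (strain S c x))) 2 (volume.restrict Ω) := by
    refine ((memLp_vec_symPart_grad u).sub hX).ae_eq (ae_of_all _ fun x => ?_)
    simp only [Pi.sub_apply, symPart_sub, map_sub, sub_sub_cancel]
  have hc2 : ∀ j i, MemLp (c j i) 2 (volume.restrict Ω) := by
    intro j i
    obtain ⟨C, hC0, hC⟩ := (S j).exists_abs_coeff_le i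
    refine MemLp.of_le (hsym.const_smul (C * 2)) (hcm j i)
      ((ae_restrict_iff' hΩ.measurableSet).2 (ae_of_all _ fun x hx => ?_))
    -- The sharp constant is `√2`, from `|sym(s ⊗ m)|² = |s|² / 2`.
    have hn : ‖(S j).slip β x‖ ≤ 2 * ‖vec (symPart (strain S c x))‖ := by
      rcases hcases x hx with ⟨l, hl⟩ | h
      · by_cases hij : ν l = j
        · subst hij
          rw [hself l x hl, ← hβ x hx, (hslip l x hl).2]
          have h2 := frobSq_symPart_tensor (hslip l x hl).1
          rw [← norm_vec_sq, (S (ν l)).norm_normal] at h2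
          refine abs_le_of_sq_le_sq' ?_ (by positivity) |>.2
          nlinarith [norm_nonneg (s x)]
        · rw [hother l x hl j hij, norm_zero]
          positivity
      · rw [hnone x (hoffK x hx h) j, norm_zero]
        positivity
    have h3 := (hC ((S j).slip β x)).trans (mul_le_mul_of_nonneg_left hn hC0)
    rw [Pi.smul_apply, norm_smul, Real.norm_of_nonneg (by positivity : (0 : ℝ) ≤ C * 2), mul_assoc]
    exact h3
  refine relEnergy_mem_closure hM hS σ τ hΩ u hc hcsm hc2 hKc hs0 fun hσ j i => ?_
  have h1 : ∑ j, ∑ i, sliceVariation (S j) Ω (c j i) ≠ ⊤ := fun h => by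
    -- Finiteness of `σ` times the variation bounds the variation itself only when `σ ≠ 0`.
    rw [h, ENNReal.mul_top (by simpa using hσ)] at hvar
    exact hvar rfl
  exact ENNReal.sum_ne_top.1 (ENNReal.sum_ne_top.1 h1 j (Finset.mem_univ j)) i (Finset.mem_univ i)

end SlipRelax

end

theorem mainTheorem3 {M : ℕ} (hM : 0 < M) (S : Fin M → SlipRelax.SlipPlane)
    (hS : ∀ j k, j ≠ k →
      (S j).normal ≠ (S k).normal ∧ (S j).normal ≠ -(S k).normal)
    (σ τ : ℝ≥0)
    (Ω : Set SlipRelax.E3) (hΩ : SlipRelax.IsLipschitzDomain Ω)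
    {ι : Type} [Finite ι] (P : ι → Set SlipRelax.E3) (ν : ι → Fin M)
    (hP_open : ∀ i, IsOpen (P i)) (hP_sub : ∀ i, P i ⊆ Ω)
    (hP_disj : ∀ i k, i ≠ k → Disjoint (P i) (P k))
    (u : SlipRelax.H1 Ω) (β : SlipRelax.E3 → SlipRelax.Mat3) (s : SlipRelax.E3 → SlipRelax.E3)
    (hβ_smooth : ∀ a b, ContDiffOn ℝ ∞ (fun x => β x a b) Ω)
    (hβ_slip : ∀ i, ∀ x ∈ P i,
      inner ℝ (S (ν i)).normal (s x) = 0 ∧ β x = SlipRelax.tensor (s x) (S (ν i)).normal)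
    (hβ_zero : ∀ x ∈ Ω, (∀ i, x ∉ P i) → β x = 0)
    (hsupp_compact : ∀ i, IsCompact (closure {x | x ∈ P i ∧ s x ≠ 0}))
    (hsupp_sub : ∀ i, closure {x | x ∈ P i ∧ s x ≠ 0} ⊆ P i ∪ (frontier Ω ∩ frontier (P i)))
    (hsupp_lip : ∀ i, SlipRelax.HasLipschitzBoundary (closure {x | x ∈ P i ∧ s x ≠ 0})) :
    (∃ (un : ℕ → SlipRelax.H1 Ω) (βn : ℕ → SlipRelax.E3 → SlipRelax.Mat3),
      (∀ n, SlipRelax.SameBoundaryValues (un n) u) ∧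
      (∀ n a b, MemLp (fun x => βn n x a b) ∞ (volume.restrict Ω)) ∧
      (∀ n, SlipRelax.SSC S Ω (βn n)) ∧
      Tendsto (fun n => SlipRelax.energy S σ τ Ω (un n) (βn n)) atTop
        (𝓝 (SlipRelax.relEnergy S σ τ Ω u β))) ∧
    (∀ i, ConvexOn ℝ≥0 (SlipRelax.slipFields (P i) (S (ν i)).normal)
      (fun r => SlipRelax.relEnergy S σ τ (P i) u
        (fun x => SlipRelax.tensor (r x) (S (ν i)).normal))) := by
  refine ⟨?_, fun i => SlipRelax.convexOn_relEnergy hS σ τ (hP_open i) (hP_sub i) u (ν i)⟩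
  -- In `[0, ∞]` closure points are limits of sequences, and each term of the sequence is the energy
  -- of an admissible pair.
  obtain ⟨e, he, hlim⟩ := mem_closure_iff_seq_limit.1
    (SlipRelax.relEnergy_mem_closure_of_patches hM hS σ τ hΩ.1 hΩ.2.1.nonempty hP_open u
      hβ_smooth hβ_slip hβ_zero hsupp_compact hsupp_sub)
  choose un βn h1 h2 h3 h4 using he
  exact ⟨un, βn, h1, h2, h3, hlim.congr h4⟩
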